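/- **Setting.** For $h:\mathbb R^k\to\mathbb R$, $k\in\{1,2\}$, call $h$ $(\beta,H)$-Hölder smooth on $[0,1]^k$ if it is $\lfloor\beta\rfloor$ times differentiable there and its derivative of order $\lfloor\beta\rfloor$ is Hölder with exponent $\beta-\lfloor\beta\rfloor$ and constant $H$. Let $\mathcal F_{NN}(d,N,L,W,o)$ be the set of functions $\mathbb R^d\to\mathbb R^o$ computed by feed-forward ReLU networks with at most $L$ hidden layers, at most $N$ neurons in each hidden layer, and at most $W$ nonzero weights and biases. For constants $c_1,c_2,c_3>0$ and integers $N,L\ge 2$ let * $\mathcal F^1_{NN}(N,L)$ be the set of $\Phi\in\mathcal F_{NN}\big(d,\;c_1dN\log N,\;c_2L\log L,\;c_3d(N\log N)^2L\log L,\;1\big)$ of the form $\Phi(x)=\sum_{j=1}^d\varphi_j(x_j)$ with $\varphi_j\in\mathcal F_{NN}\big(1,\;c_1N\log N,\;c_2L\log L,\;c_3(N\log N)^2L\log L,\;1\big)$; * $\mathcal F^2_{NN}(N,L)$ be the set of $\Phi\in\mathcal F_{NN}\big(d,\;c_1d^2N\log N,\;c_2L\log L,\;c_3d^2(N\log N)^2L\log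 L,\;1\big)$ of the form $\Phi(x)=\sum_{j<k}\varphi_{jk}(x_j,x_k)$ with $\varphi_{jk}\in\mathcal F_{NN}\big(2,\;c_1N\log N,\;c_2L\log L,\;c_3(N\log N)^2L\log L,\;1\big)$. **Theorem.** Let $\beta_1,\beta_2>0$. There are constants $c_1,c_2,c_3>0$ depending only on $\beta_1,\beta_2$ such that for all real $H,B,p_{\max},K$ there is a constant $C>0$, depending only on $\beta_1,\beta_2,H,B,p_{\max},K$, for which the following holds. Let $d$ be a nonnegative integer and let $N_1,L_1,N_2,L_2\ge2$ be integers with $$\binom d2 (N_2L_2)^{-2\beta_2}\le K .$$ Let $X$ be a random vector supported on $[0,1]^d$ with a density bounded by $p_{\max}$ on $[0,1]^d$, and let $$f_0(x)=\sum_{j=1}^d f_{0,j}(x_j)+\sum_{j<k}f_{0,jk}(x_j,x_k),$$ where every $f_{0,j}$ is $(\beta_1,H)$-Hölder smooth on $[0,1]$ with $\int_0^1 f_{0,j}(x)\,dx=0$, every $f_{0,jk}$ is $(\beta_2,H)$-Hölder smooth on $[0,1]^2$ with $\int_0^1f_{0,jk}(x,y)\,dx=0$ for all $y\in[0,1]$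 and $\int_0^1 f_{0,jk}(x,y)\,dy=0$ for all $x\in[0,1]$, and $|f_0|\le B$ on $[0,1]^d$. Then $$\inf_{\phi_1\in\mathcal F^1_{NN}(N_1,L_1),\ \phi_2\in\mathcal F^2_{NN}(N_2,L_2)}\mathbb E\big[(f_0(X)-\phi_1(X)-\phi_2(X))^2\big]\le C\left(d\,(N_1L_1)^{-4\beta_1}+\binom d2(N_2L_2)^{-2\beta_2}\right).$$ -/

import Mathlib

open MeasureTheory
open scoped ENNReal

noncomputable section

/-- Feed-forward ReLU networks with output dimension `o`, indexed by their input dimension.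
`output A b` is the final affine layer; `hidden A b rest` is a hidden layer with `k` neurons
followed by the rest of the network. -/
inductive ReLUNet (o : ℕ) : ℕ → Type
  | output {m : ℕ} (A : Matrix (Fin o) (Fin m) ℝ) (b : Fin o → ℝ) : ReLUNet o m
  | hidden {m k : ℕ} (A : Matrix (Fin k) (Fin m) ℝ) (b : Fin k → ℝ)
      (rest : ReLUNet o k) : ReLUNet o m

namespace ReLUNet

/-- The function computed by a network; the activation is `t ↦ max t 0`. -/
def eval {o : ℕ} : {m : ℕ} → ReLUNet o m → (Fin m → ℝ) → (Fin o → ℝ)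
  | _, output A b, x => A.mulVec x + b
  | _, hidden A b rest, x => rest.eval (fun i => max ((A.mulVec x + b) i) 0)

/-- The number of hidden layers. -/
def depth {o : ℕ} : {m : ℕ} → ReLUNet o m → ℕ
  | _, output _ _ => 0
  | _, hidden _ _ rest => rest.depth + 1

/-- The maximal number of neurons in a hidden layer. -/
def width {o : ℕ} : {m : ℕ} → ReLUNet o m → ℕ
  | _, output _ _ => 0
  | _, hidden (k := k) _ _ rest => max k rest.width

/-- The number of nonzero entries of an affine layer (weights and biases). -/
def layerSize {m k : ℕ} (A : Matrix (Fin k) (Fin m) ℝ) (b : Fin k → ℝ) : ℕ :=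
  Set.ncard {q : Fin k × Fin m | A q.1 q.2 ≠ 0} + Set.ncard {i : Fin k | b i ≠ 0}

/-- The total number of active (nonzero) weights, biases included. -/
def activeWeights {o : ℕ} : {m : ℕ} → ReLUNet o m → ℕ
  | _, output A b => layerSize A b
  | _, hidden A b rest => layerSize A b + rest.activeWeights

end ReLUNet

/-- `FNN d N L W o`: the functions from `ℝ^d` to `ℝ^o` computed by ReLU networks of width at
most `N`, depth at most `L`, with at most `W` active weights. The bounds are real numbers. -/
def FNN (d : ℕ) (N L W : ℝ) (o : ℕ) : Set ((Fin d → ℝ) → (Fin o → ℝ)) :=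
  {φ | ∃ net : ReLUNet o d, (net.width : ℝ) ≤ N ∧ (net.depth : ℝ) ≤ L ∧
    (net.activeWeights : ℝ) ≤ W ∧ net.eval = φ}

/-- `n log n`. -/
def nlogn (n : ℕ) : ℝ := (n : ℝ) * Real.log n

/-- The structured class for the univariate part: networks on `ℝ^d` of width
`c₁ d N log N`, depth `c₂ L log L` and `c₃ d (N log N)² L log L` active weights which are sums of
one univariate network per coordinate, each of width `c₁ N log N` and depth `c₂ L log L`. -/
def FNN1 (c₁ c₂ c₃ : ℝ) (d N L : ℕ) : Set ((Fin d → ℝ) → ℝ) :=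
  {Φ | (fun x (_ : Fin 1) => Φ x) ∈
      FNN d (c₁ * d * nlogn N) (c₂ * nlogn L) (c₃ * d * nlogn N ^ 2 * nlogn L) 1 ∧
    ∃ φ : Fin d → (Fin 1 → ℝ) → (Fin 1 → ℝ),
      (∀ j, φ j ∈ FNN 1 (c₁ * nlogn N) (c₂ * nlogn L) (c₃ * nlogn N ^ 2 * nlogn L) 1) ∧
      ∀ x, Φ x = ∑ j, φ j ![x j] 0}

/-- The structured class for the bivariate part: networks on `ℝ^d` of width
`c₁ d² N log N`, depth `c₂ L log L` and `c₃ d² (N log N)² L log L` active weights which are sums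
of one bivariate network per pair `j < k` of coordinates, each of width `c₁ N log N` and depth
`c₂ L log L`. -/
def FNN2 (c₁ c₂ c₃ : ℝ) (d N L : ℕ) : Set ((Fin d → ℝ) → ℝ) :=
  {Φ | (fun x (_ : Fin 1) => Φ x) ∈
      FNN d (c₁ * d ^ 2 * nlogn N) (c₂ * nlogn L) (c₃ * d ^ 2 * nlogn N ^ 2 * nlogn L) 1 ∧
    ∃ φ : Fin d → Fin d → (Fin 2 → ℝ) → (Fin 1 → ℝ),
      (∀ j k, j < k →
        φ j k ∈ FNN 2 (c₁ * nlogn N) (c₂ * nlogn L) (c₃ * nlogn N ^ 2 * nlogn L) 1) ∧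
      ∀ x, Φ x = ∑ j, ∑ k ∈ Finset.Ioi j, φ j k ![x j, x k] 0}

/-- `f` is `(β, H)`-Hölder smooth on `s`: it is `⌊β⌋` times differentiable on `s` and its
derivative of order `⌊β⌋` is Hölder with exponent `β - ⌊β⌋` and constant `H`. (One-sided
derivatives at the boundary; `s` is meant to have unique derivatives.) -/
def HolderSmoothOn {E : Type*} [NormedAddCommGroup E] [NormedSpace ℝ E]
    (β H : ℝ) (f : E → ℝ) (s : Set E) : Prop :=
  (∀ m < ⌊β⌋₊, DifferentiableOn ℝ (iteratedFDerivWithin ℝ m f s) s) ∧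
  ∀ x ∈ s, ∀ y ∈ s,
    ‖iteratedFDerivWithin ℝ ⌊β⌋₊ f s x - iteratedFDerivWithin ℝ ⌊β⌋₊ f s y‖
      ≤ H * ‖x - y‖ ^ (β - ⌊β⌋₊)

/-- The unit cube in `ℝ^d`. -/
def unitCube (d : ℕ) : Set (Fin d → ℝ) := Set.Icc 0 1

/-- The mean function `∑ⱼ fⱼ(xⱼ) + ∑_{j<k} gⱼₖ(xⱼ, xₖ)` of the two-way interaction model. -/
def interactionMean {d : ℕ} (f : Fin d → ℝ → ℝ) (g : Fin d → Fin d → ℝ → ℝ → ℝ)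
    (x : Fin d → ℝ) : ℝ :=
  ∑ j, f j (x j) + ∑ j, ∑ k ∈ Finset.Ioi j, g j k (x j) (x k)

/-- The mean function with components `f`, `g` satisfies the standing assumptions: univariate
components `β₁`-smooth with integral zero, bivariate components `β₂`-smooth with both marginals
zero, and the mean function is bounded by `B` on the unit cube. -/
structure InteractionModel (β₁ β₂ H B : ℝ) {d : ℕ} (f : Fin d → ℝ → ℝ)
    (g : Fin d → Fin d → ℝ → ℝ → ℝ) : Prop where
  smooth₁ : ∀ j, HolderSmoothOn β₁ H (f j) (Set.Icc 0 1)
  smooth₂ : ∀ j k, j < k → HolderSmoothOn β₂ H (fun z : ℝ × ℝ => g j k z.1 z.2)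
    (Set.Icc 0 1 ×ˢ Set.Icc 0 1)
  integral_zero : ∀ j, ∫ x in (0 : ℝ)..1, f j x = 0
  marginal_fst : ∀ j k, j < k → ∀ y ∈ Set.Icc (0 : ℝ) 1, ∫ x in (0 : ℝ)..1, g j k x y = 0
  marginal_snd : ∀ j k, j < k → ∀ x ∈ Set.Icc (0 : ℝ) 1, ∫ y in (0 : ℝ)..1, g j k x y = 0
  bounded : ∀ x ∈ unitCube d, |interactionMean f g x| ≤ B

/-- `P` is a probability law supported on the unit cube which has a density bounded there by
`pmax`. -/
def HasBoundedDensity {d : ℕ} (P : Measure (Fin d → ℝ)) (pmax : ℝ) : Prop :=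
  IsProbabilityMeasure P ∧ ∃ p : (Fin d → ℝ) → ℝ≥0∞, Measurable p ∧
    (∀ x ∈ unitCube d, p x ≤ ENNReal.ofReal pmax) ∧
    P = (volume.restrict (unitCube d)).withDensity p

end

/-!
The risk is an `L²` distance for a law dominated by a multiple of the uniform law on the cube, so
it suffices to approximate in `L²` of the uniform law. There, centered functions of single
coordinates are mutually orthogonal, and so are functions of pairs of coordinates without
marginals. Hence mean squared errors of the components add up, provided that the errors are
centered, respectively without marginals; a plain triangle inequality would lose a factor `d` or
`d.choose 2`.

*Univariate part.* A network reproduces the piecewise Taylor polynomial on a grid of about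
`(N * L) ^ 2` cells, and the mean of the error is added to the output bias, which centers the
error exactly (`exists_univariate_net`, `exists_univariate_sum`).

*Bivariate part.* The marginals of the error of a network cannot be removed exactly. Instead, the
marginals of the piecewise Taylor polynomial on a grid with about `N * L` cells per axis are
removed, which yields another piecewise polynomial on the same grid
(`exists_interactionPart_eq`). Its errors are orthogonal and have the right size. The network
computes it with an error of the order of the *square* of the target rate; summed over all pairs by
the triangle inequality, this contributes at most
`(d.choose 2) ^ 2 * (N * L) ^ (-4 * β₂) ≤ K * (d.choose 2) * (N * L) ^ (-2 * β₂)`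
(`exists_bivariate_net`, `exists_bivariate_sum`).

*Networks.* The inputs are read digit by digit in the bases `N` and `2`. The single gadget
`Computes.digits` extracts the digits of a number and multiplies the integer they form by another
function; it yields the cell indices, the truncated local coordinates, and exact products with
numbers of finitely many digits. The coefficients are read from a table with `N ^ 2 * L ^ 2`
entries, by a choice of one of `N ^ 2` entries in one layer, repeated `L` times, and by digit
extraction from a number which stores `L` entries (`Computes.lookup`). All this is valid for
inputs which keep some distance from the right ends of the cells of a fine grid (`AvoidsGrid`). The
other inputs have arbitrarily small measure, and the output is clipped, so they do not matter in
`L²`. The number of weights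
follows from width and depth, since fully connected networks are within the allowance.

*Coefficients.* No bound on the derivatives of the components below the top order is assumed. The
components themselves are averages of the mean function and hence bounded (`abs_component_le`), and
bounds on the values of a polynomial bound its coefficients (`exists_coeff_bound`).
-/


noncomputable section

/-! ### Elementary operations on networks -/

namespace ReLUNet

/-- The network `x ↦ net (A x + b)`; the affine map is merged into the first layer. -/
def precomp {o m k : ℕ} : ReLUNet o k → Matrix (Fin k) (Fin m) ℝ → (Fin k → ℝ) → ReLUNet o m
  | output A' b', A, b => output (A' * A) (A'.mulVec b + b')
  | hidden A' b' rest, A, b => hidden (A' * A) (A'.mulVec b + b') rest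

variable {o m k : ℕ}

lemma eval_precomp (net : ReLUNet o k) (A : Matrix (Fin k) (Fin m) ℝ) (b : Fin k → ℝ)
    (x : Fin m → ℝ) : (net.precomp A b).eval x = net.eval (A.mulVec x + b) := by
  cases net <;> simp [precomp, eval, Matrix.mulVec_add, Matrix.mulVec_mulVec, add_assoc]

lemma depth_precomp (net : ReLUNet o k) (A : Matrix (Fin k) (Fin m) ℝ) (b : Fin k → ℝ) :
    (net.precomp A b).depth = net.depth := by
  cases net <;> simp [precomp, depth]

lemma width_precomp (net : ReLUNet o k) (A : Matrix (Fin k) (Fin m) ℝ) (b : Fin k → ℝ) :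
    (net.precomp A b).width = net.width := by
  cases net <;> simp [precomp, width]

open Classical in
lemma layerSize_eq_sum (A : Matrix (Fin k) (Fin m) ℝ) (b : Fin k → ℝ) :
    layerSize A b = (∑ i, ∑ j, if A i j ≠ 0 then 1 else 0) + ∑ i, if b i ≠ 0 then 1 else 0 := by
  unfold layerSize
  congr 1
  · rw [← Finset.coe_filter_univ, Set.ncard_coe_finset, Finset.card_filter,
      ← Finset.univ_product_univ, Finset.sum_product]
  · rw [← Finset.coe_filter_univ, Set.ncard_coe_finset, Finset.card_filter]

lemma layerSize_le (A : Matrix (Fin k) (Fin m) ℝ) (b : Fin k → ℝ) :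
    layerSize A b ≤ k * m + k := by
  classical
  rw [layerSize_eq_sum]
  gcongr
  · calc _ ≤ ∑ _i : Fin k, ∑ _j : Fin m, 1 := by
          gcongr; split_ifs <;> simp
      _ = k * m := by simp
  · calc _ ≤ ∑ _i : Fin k, 1 := by
          gcongr; split_ifs <;> simp
      _ = k := by simp

/-- A fully connected network of width and input dimension at most `w` has at most
`(w + o) (w + 1)` weights per layer. -/
lemma activeWeights_le (w : ℕ) : ∀ {m : ℕ} (net : ReLUNet o m), m ≤ w → net.width ≤ w →
    net.activeWeights ≤ (net.depth + 1) * ((w + o) * (w + 1))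
  | m, output A b, hm, _ => by
    have := layerSize_le A b
    simp only [activeWeights, depth]
    nlinarith [Nat.mul_le_mul_left o hm]
  | m, hidden (k := k) A b rest, hm, hw => by
    simp only [width, max_le_iff] at hw
    have h1 := layerSize_le A b
    have h2 := activeWeights_le w rest hw.1 hw.2
    simp only [activeWeights, depth]
    have : k * m + k ≤ (w + o) * (w + 1) := by
      calc k * m + k = k * (m + 1) := by ring
        _ ≤ (w + o) * (w + 1) := Nat.mul_le_mul (by omega) (by omega)
    linarith

/-- Restriction of the input to coordinates selected by `σ` (repetitions allowed). -/
def select {n : ℕ} (net : ReLUNet o n) (σ : Fin n → Fin m) : ReLUNet o m :=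
  net.precomp (Matrix.of fun i q => if σ i = q then 1 else 0) 0

lemma eval_select {n : ℕ} (net : ReLUNet o n) (σ : Fin n → Fin m) (x : Fin m → ℝ) :
    (net.select σ).eval x = net.eval (fun i => x (σ i)) := by
  rw [select, eval_precomp]
  congr 1
  ext i
  simp [Matrix.mulVec, dotProduct]

lemma layerSize_select_le {n : ℕ} (A : Matrix (Fin k) (Fin n) ℝ) (b : Fin k → ℝ)
    (σ : Fin n → Fin m) :
    layerSize (A * Matrix.of fun i q => if σ i = q then (1 : ℝ) else 0)
      (A.mulVec 0 + b) ≤ layerSize A b := by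
  classical
  simp only [layerSize_eq_sum, Matrix.mulVec_zero, zero_add]
  gcongr with i
  -- each nonzero entry in column `q` of the product comes from a nonzero entry of `A` over `q`
  calc _ ≤ ∑ q, ∑ p, if σ p = q then (if A i p ≠ 0 then 1 else 0) else 0 := by
        gcongr with q
        split_ifs with h
        · simp only [Matrix.mul_apply, Matrix.of_apply, mul_ite, mul_one, mul_zero] at h
          obtain ⟨p, -, hp⟩ := Finset.exists_ne_zero_of_sum_ne_zero h
          have hp' : σ p = q ∧ A i p ≠ 0 := by
            by_contra hc; apply hp; split_ifs <;> simp_all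
          refine le_trans ?_ (Finset.single_le_sum (fun _ _ => Nat.zero_le _)
            (Finset.mem_univ p))
          simp [hp'.1, hp'.2]
        · exact Nat.zero_le _
    _ = ∑ p, if A i p ≠ 0 then 1 else 0 := by
        rw [Finset.sum_comm]
        simp

lemma activeWeights_select_le {n : ℕ} (net : ReLUNet o n) (σ : Fin n → Fin m) :
    (net.select σ).activeWeights ≤ net.activeWeights := by
  cases net with
  | output A b => exact layerSize_select_le A b σ
  | hidden A b rest => exact Nat.add_le_add_right (layerSize_select_le A b σ) _

/-- Two networks of equal depth on separate inputs run side by side (block diagonal layers), and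
their outputs are added. -/
lemma exists_sum_of_depth_eq : ∀ {m₁ m₂ : ℕ} (n₁ : ReLUNet o m₁) (n₂ : ReLUNet o m₂),
    n₁.depth = n₂.depth → ∃ n : ReLUNet o (m₁ + m₂), n.depth = n₁.depth ∧
      n.width ≤ n₁.width + n₂.width ∧ n.activeWeights ≤ n₁.activeWeights + n₂.activeWeights ∧
      ∀ x y, n.eval (Fin.append x y) = n₁.eval x + n₂.eval y
  | m₁, m₂, output A b, output A' b', _ => by
    classical
    refine ⟨output (Matrix.of fun i => Fin.append (A i) (A' i)) (b + b'), rfl, by simp [width],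
      ?_, fun x y => ?_⟩
    · simp only [activeWeights, layerSize_eq_sum, Fin.sum_univ_add, Matrix.of_apply,
        Fin.append_left, Fin.append_right, Finset.sum_add_distrib]
      have : (∑ i, if (b + b') i ≠ 0 then 1 else 0) ≤
          (∑ i, if b i ≠ 0 then 1 else 0) + ∑ i, if b' i ≠ 0 then 1 else 0 := by
        rw [← Finset.sum_add_distrib]
        gcongr with i
        by_cases h1 : b i = 0 <;> by_cases h2 : b' i = 0 <;> simp [h1, h2]
        split_ifs <;> simp
      omega
    · ext i
      simp [eval, Matrix.mulVec, dotProduct, Fin.sum_univ_add]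
      ring
  | m₁, m₂, hidden (k := k₁) A b rest, hidden (k := k₂) A' b' rest', h => by
    classical
    obtain ⟨n, hd, hw, ha, he⟩ := exists_sum_of_depth_eq rest rest' (by simpa [depth] using h)
    refine ⟨hidden (Matrix.of (Fin.append (fun i => Fin.append (A i) 0)
        (fun i => Fin.append 0 (A' i)))) (Fin.append b b') n, by simp [depth, hd], ?_, ?_, ?_⟩
    · simp only [width]
      omega
    · have : layerSize (Matrix.of (Fin.append (fun i => Fin.append (A i) 0)
          (fun i => Fin.append 0 (A' i)))) (Fin.append b b') = layerSize A b + layerSize A' b' := by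
        simp only [layerSize_eq_sum, Fin.sum_univ_add, Matrix.of_apply, Fin.append_left,
          Fin.append_right]
        simp
        ring
      simp only [activeWeights, this]
      omega
    · intro x y
      simp only [eval, ← he]
      congr 1
      ext i
      refine Fin.addCases (fun i => ?_) (fun i => ?_) i <;>
      simp [Matrix.mulVec, dotProduct, Fin.sum_univ_add]

/-- A finite sum of networks of equal depth, each reading selected coordinates of the input. -/
lemma exists_finset_sum {ι : Type*} {n d : ℕ} (S : Finset ι) (D w W : ℕ)
    (net : ι → ReLUNet o n) (σ : ι → Fin n → Fin d) (hD : ∀ i ∈ S, (net i).depth = D)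
    (hw : ∀ i ∈ S, (net i).width ≤ w) (hW : ∀ i ∈ S, (net i).activeWeights ≤ W) :
    ∃ Φ : ReLUNet o d, Φ.depth = D ∧ Φ.width ≤ S.card * w ∧ Φ.activeWeights ≤ S.card * W ∧
      ∀ x, Φ.eval x = ∑ i ∈ S, (net i).eval (fun p => x (σ i p)) := by
  classical
  induction S using Finset.induction_on with
  | empty =>
    suffices H : ∀ D d : ℕ, ∃ Φ : ReLUNet o d, Φ.depth = D ∧ Φ.width = 0 ∧ Φ.activeWeights = 0 ∧
        ∀ x, Φ.eval x = 0 by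
      obtain ⟨Φ, h1, h2, h3, h4⟩ := H D d
      exact ⟨Φ, h1, by simp [h2], by simp [h3], by simpa using h4⟩
    intro D
    induction D with
    | zero => exact fun d => ⟨output 0 0, rfl, rfl, by simp [activeWeights, layerSize],
        fun x => by simp [eval]⟩
    | succ D ih =>
      intro d
      obtain ⟨Φ, h1, h2, h3, h4⟩ := ih 0
      exact ⟨hidden 0 0 Φ, by simp [depth, h1], by simp [width, h2],
        by simp [activeWeights, h3, layerSize], fun x => by simp [eval, h4]⟩
  | insert i S hi ih =>
    obtain ⟨Φ, h1, h2, h3, h4⟩ := ih (fun j hj => hD j (Finset.mem_insert_of_mem hj))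
      (fun j hj => hw j (Finset.mem_insert_of_mem hj))
      (fun j hj => hW j (Finset.mem_insert_of_mem hj))
    have hi' := Finset.mem_insert_self i S
    obtain ⟨Ψ, g1, g2, g3, g4⟩ := exists_sum_of_depth_eq Φ (net i) (by rw [h1, hD i hi'])
    refine ⟨Ψ.select (Fin.append id (σ i)), ?_, ?_, ?_, fun x => ?_⟩
    · rw [select, depth_precomp, g1, h1]
    · rw [select, width_precomp, Finset.card_insert_of_notMem hi]
      have := hw i hi'
      linarith
    · refine (activeWeights_select_le _ _).trans ?_
      rw [Finset.card_insert_of_notMem hi]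
      have := hW i hi'
      linarith
    · have hx : (fun p => x (Fin.append id (σ i) p)) = Fin.append x (fun p => x (σ i p)) := by
        ext p
        refine Fin.addCases (fun p => ?_) (fun p => ?_) p <;> simp
      rw [eval_select, Finset.sum_insert hi, ← h4, hx, g4, add_comm]

/-- The composition of two networks. -/
def comp {p : ℕ} : {m : ℕ} → ReLUNet o m → ReLUNet p o → ReLUNet p m
  | _, output A b, net => net.precomp A b
  | _, hidden A b rest, net => hidden A b (rest.comp net)

lemma eval_comp {p : ℕ} : ∀ {m : ℕ} (n₁ : ReLUNet o m) (n₂ : ReLUNet p o) (x : Fin m → ℝ),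
    (n₁.comp n₂).eval x = n₂.eval (n₁.eval x)
  | _, output A b, n₂, x => by rw [comp, eval_precomp, eval]
  | _, hidden A b rest, n₂, x => by rw [comp, eval, eval_comp, eval]

lemma depth_comp {p : ℕ} : ∀ {m : ℕ} (n₁ : ReLUNet o m) (n₂ : ReLUNet p o),
    (n₁.comp n₂).depth = n₁.depth + n₂.depth
  | _, output A b, n₂ => by simp [comp, depth_precomp, depth]
  | _, hidden A b rest, n₂ => by simp [comp, depth, depth_comp rest n₂]; omega

lemma width_comp {p : ℕ} : ∀ {m : ℕ} (n₁ : ReLUNet o m) (n₂ : ReLUNet p o),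
    (n₁.comp n₂).width = max n₁.width n₂.width
  | _, output A b, n₂ => by simp [comp, width_precomp, width]
  | _, hidden A b rest, n₂ => by simp [comp, width, width_comp rest n₂, max_assoc]

/-- The outputs of a network can be clipped to `[-B, B]` at the cost of one layer. -/
lemma exists_clip {m : ℕ} (net : ReLUNet 1 m) {B : ℝ} (hB : 0 ≤ B) :
    ∃ net' : ReLUNet 1 m, net'.depth = net.depth + 1 ∧ net'.width ≤ max net.width 2 ∧
      (∀ x, |net'.eval x 0| ≤ B) ∧ ∀ x, |net.eval x 0| ≤ B → net'.eval x 0 = net.eval x 0 := by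
  refine ⟨net.comp (hidden (k := 2) (Matrix.of ![![1], ![1]]) ![B, -B]
    (output (Matrix.of ![![1, -1]]) ![-B])), by simp [depth_comp, depth],
    by simp [width_comp, width], fun x => ?_, fun x hx => ?_⟩ <;>
  simp only [eval_comp, eval] <;> generalize net.eval x = y at * <;>
  simp [dotProduct]
  · rw [abs_le]
    constructor <;>
    rcases le_total (y 0 + B) 0 with h | h <;> rcases le_total (y 0 + -B) 0 with h' | h' <;>
    simp only [h, h', max_eq_left, max_eq_right] <;> linarith
  · rw [abs_le] at hx
    rw [max_eq_left (by linarith), max_eq_right (by linarith)]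
    ring

/-- A constant can be added to the output by changing the last bias. -/
lemma exists_add_const {m : ℕ} (net : ReLUNet 1 m) (a : ℝ) :
    ∃ net' : ReLUNet 1 m, net'.depth = net.depth ∧ net'.width = net.width ∧
      ∀ x, net'.eval x 0 = net.eval x 0 + a := by
  refine ⟨net.comp (output 1 fun _ => a), by simp [depth_comp, depth],
    by simp [width_comp, width], fun x => by simp [eval_comp, eval]⟩

end ReLUNet

/-! ### Functions computed by a network on a set of inputs -/

section Computes

variable {X : Type*} {m : ℕ}

/-- The affine span of `1` and the functions in the list `l`. -/
def affSpan (l : List (X → ℝ)) : Submodule ℝ (X → ℝ) :=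
  Submodule.span ℝ (insert 1 {f | f ∈ l})

/-- `Layers inp w ℓ V`: there are `ℓ` hidden layers of at most `w` neurons, acting on the inputs
`inp`, such that `V` is the space of affine functions of the last layer. Inputs are parametrized
by an arbitrary type `X`, so that only their values on a given set of inputs matter. -/
inductive Layers (inp : Fin m → X → ℝ) (w : ℕ) : ℕ → Submodule ℝ (X → ℝ) → Prop
  | base : Layers inp w 0 (affSpan (List.ofFn inp))
  | step {ℓ : ℕ} {V : Submodule ℝ (X → ℝ)} (h : Layers inp w ℓ V) (l : List (X → ℝ))
      (hl : l.length ≤ w) (hV : ∀ f ∈ l, f ∈ V) :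
      Layers inp w (ℓ + 1) (affSpan (l.map fun f x => max (f x) 0))

/-- `Computes inp w ℓ C`: the functions in `C` are affine functions of the last of `ℓ` hidden
layers of at most `w` neurons. -/
def Computes (inp : Fin m → X → ℝ) (w ℓ : ℕ) (C : List (X → ℝ)) : Prop :=
  ∃ V, Layers inp w ℓ V ∧ ∀ f ∈ C, f ∈ V

lemma one_mem_affSpan (l : List (X → ℝ)) : (1 : X → ℝ) ∈ affSpan l :=
  Submodule.subset_span (Set.mem_insert _ _)

lemma const_mem_affSpan (l : List (X → ℝ)) (a : ℝ) : (fun _ : X => a) ∈ affSpan l := by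
  have : (fun _ : X => a) = a • (1 : X → ℝ) := by ext; simp
  rw [this]
  exact Submodule.smul_mem _ _ (one_mem_affSpan l)

lemma mem_affSpan {l : List (X → ℝ)} {f : X → ℝ} (h : f ∈ l) : f ∈ affSpan l :=
  Submodule.subset_span (Set.mem_insert_of_mem _ h)

lemma Layers.one_mem {inp : Fin m → X → ℝ} {w ℓ : ℕ} {V : Submodule ℝ (X → ℝ)}
    (h : Layers inp w ℓ V) : (1 : X → ℝ) ∈ V := by
  cases h <;> exact one_mem_affSpan _

lemma affSpan_le {l : List (X → ℝ)} {V : Submodule ℝ (X → ℝ)} (h1 : (1 : X → ℝ) ∈ V)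
    (h : ∀ f ∈ l, f ∈ V) : affSpan l ≤ V := by
  refine Submodule.span_le.2 ?_
  rintro f (rfl | hf)
  exacts [h1, h f hf]

lemma exists_coeff_of_mem_affSpan {k : ℕ} {u : Fin k → X → ℝ} {f : X → ℝ}
    (h : f ∈ affSpan (List.ofFn u)) : ∃ (a : Fin k → ℝ) (b : ℝ),
      ∀ x, f x = ∑ i, a i * u i x + b := by
  rw [affSpan, Submodule.mem_span_insert] at h
  obtain ⟨b, g, hg, rfl⟩ := h
  have : {f | f ∈ List.ofFn u} = Set.range u := by ext; simp [List.mem_ofFn]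
  rw [this, Submodule.mem_span_range_iff_exists_fun] at hg
  obtain ⟨a, rfl⟩ := hg
  exact ⟨a, b, fun x => by simp [add_comm]⟩

namespace Computes

variable {inp : Fin m → X → ℝ} {w ℓ : ℕ} {C D : List (X → ℝ)}

/-- A network can be put in front of any network: the realization of the computed functions. -/
lemma exists_net_comp {V : Submodule ℝ (X → ℝ)} (h : Layers inp w ℓ V) :
    ∀ {o k : ℕ} (rest : ReLUNet o k) (v : Fin k → X → ℝ), (∀ i, v i ∈ V) →
      ∃ net : ReLUNet o m, net.width ≤ max w rest.width ∧ net.depth = ℓ + rest.depth ∧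
        ∀ x, net.eval (fun i => inp i x) = rest.eval (fun i => v i x) := by
  induction h with
  | base =>
    intro o k rest v hv
    choose a b hab using fun i => exists_coeff_of_mem_affSpan (hv i)
    refine ⟨rest.precomp (Matrix.of a) b, by simp [ReLUNet.width_precomp],
      by simp [ReLUNet.depth_precomp], fun x => ?_⟩
    rw [ReLUNet.eval_precomp]
    congr 1
    ext i
    simp [hab, Matrix.mulVec, dotProduct]
  | step h l hl hV ih =>
    intro o k rest v hv
    have hof : (l.map fun f x => max (f x) 0) = List.ofFn fun i : Fin l.length =>
        fun x => max (l.get i x) 0 := by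
      conv_lhs => rw [← List.ofFn_get l, List.map_ofFn]
      rfl
    rw [hof] at hv
    choose a b hab using fun i => exists_coeff_of_mem_affSpan (hv i)
    obtain ⟨net, h1, h2, h3⟩ := ih (ReLUNet.hidden 1 0 (rest.precomp (Matrix.of a) b)) l.get
      (fun i => hV _ (List.get_mem l i))
    refine ⟨net, ?_, ?_, fun x => ?_⟩
    · simp only [ReLUNet.width, ReLUNet.width_precomp] at h1
      omega
    · simp only [ReLUNet.depth, ReLUNet.depth_precomp] at h2
      omega
    · rw [h3, ReLUNet.eval, ReLUNet.eval_precomp]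
      congr 1
      ext i
      simp [hab, Matrix.mulVec, dotProduct]

lemma exists_net {f : X → ℝ} (h : Computes inp w ℓ [f]) :
    ∃ net : ReLUNet 1 m, net.width ≤ w ∧ net.depth = ℓ ∧
      ∀ x, net.eval (fun i => inp i x) 0 = f x := by
  obtain ⟨V, hV, hf⟩ := h
  obtain ⟨net, h1, h2, h3⟩ := exists_net_comp hV (ReLUNet.output (1 : Matrix (Fin 1) (Fin 1) ℝ) 0)
    (fun _ => f) (fun _ => hf f (by simp))
  refine ⟨net, by simpa [ReLUNet.width] using h1, by simpa [ReLUNet.depth] using h2, fun x => ?_⟩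
  rw [h3]
  simp [ReLUNet.eval]

lemma base (h : ∀ f ∈ C, f ∈ affSpan (List.ofFn inp)) : Computes inp w 0 C :=
  ⟨_, Layers.base, h⟩

lemma aff (h : Computes inp w ℓ C) (hD : ∀ f ∈ D, f ∈ affSpan C) : Computes inp w ℓ D := by
  obtain ⟨V, hV, hC⟩ := h
  exact ⟨V, hV, fun f hf => affSpan_le hV.one_mem hC (hD f hf)⟩

lemma mono (h : Computes inp w ℓ C) (hD : D ⊆ C) : Computes inp w ℓ D :=
  h.aff fun _ hf => mem_affSpan (hD hf)

/-- One more layer: it applies the activation to the functions in `D`, and passes on those in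
`C'`, which costs two neurons each since `t = max t 0 - max (-t) 0`. -/
lemma relu {C' : List (X → ℝ)} (h : Computes inp w ℓ C) (hC : ∀ f ∈ C', f ∈ affSpan C)
    (hD : ∀ f ∈ D, f ∈ affSpan C) (hw : 2 * C'.length + D.length ≤ w) :
    Computes inp w (ℓ + 1) (C' ++ D.map fun f x => max (f x) 0) := by
  obtain ⟨V, hV, hCV⟩ := h
  have hle := affSpan_le hV.one_mem hCV
  refine ⟨_, hV.step (C' ++ (C'.map fun f x => -f x) ++ D) (by simp; omega) ?_, ?_⟩
  · intro f hf
    simp only [List.mem_append, List.mem_map] at hf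
    rcases hf with (hf | ⟨g, hg, rfl⟩) | hf
    · exact hle (hC f hf)
    · exact V.neg_mem (hle (hC g hg))
    · exact hle (hD f hf)
  · intro f hf
    simp only [List.mem_append] at hf
    rcases hf with hf | hf
    · have : f = (fun x => max (f x) 0) - (fun x => max (-f x) 0) := by
        ext x
        simp only [Pi.sub_apply]
        rcases le_total (f x) 0 with h | h <;> simp [h]
      rw [this]
      refine Submodule.sub_mem _ (mem_affSpan ?_) (mem_affSpan ?_)
      · exact List.mem_map.2 ⟨f, by simp [hf], rfl⟩
      · exact List.mem_map.2 ⟨fun x => -f x, by simp; exact Or.inr (Or.inl ⟨f, hf, rfl⟩), rfl⟩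
    · obtain ⟨g, hg, rfl⟩ := List.mem_map.1 hf
      exact mem_affSpan (List.mem_map.2 ⟨g, by simp [hg], rfl⟩)

lemma pad (h : Computes inp w ℓ C) (hw : 2 * C.length ≤ w) (k : ℕ) :
    Computes inp w (ℓ + k) C := by
  induction k with
  | zero => exact h
  | succ k ih =>
    have := ih.relu (C' := C) (D := []) (fun _ => mem_affSpan) (by simp) (by simpa using hw)
    rwa [List.map_nil, List.append_nil] at this

end Computes

end Computes

section AffSpan

variable {X : Type*} {l : List (X → ℝ)} {f g : X → ℝ}

lemma affSpan_add (hf : f ∈ affSpan l) (hg : g ∈ affSpan l) :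
    (fun x => f x + g x) ∈ affSpan l := Submodule.add_mem _ hf hg

lemma affSpan_sub (hf : f ∈ affSpan l) (hg : g ∈ affSpan l) :
    (fun x => f x - g x) ∈ affSpan l := Submodule.sub_mem _ hf hg

lemma affSpan_mul (a : ℝ) (hf : f ∈ affSpan l) :
    (fun x => a * f x) ∈ affSpan l := Submodule.smul_mem _ a hf

lemma affSpan_sum {ι : Type*} {s : Finset ι} {f : ι → X → ℝ} (hf : ∀ i ∈ s, f i ∈ affSpan l) :
    (fun x => ∑ i ∈ s, f i x) ∈ affSpan l := by
  have := Submodule.sum_mem _ hf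
  convert this using 1
  ext x
  simp

end AffSpan

/-! ### Digits, products and table lookup by networks -/

namespace Computes

variable {X : Type*} {m : ℕ} {inp : Fin m → X → ℝ} {w : ℕ}

lemma threshold_eq {y δ : ℝ} (hδ : 0 < δ) (h : 0 ≤ y ∨ y ≤ -δ) :
    max (δ⁻¹ * y + 1) 0 - max (δ⁻¹ * y) 0 = if 0 ≤ y then 1 else 0 := by
  split_ifs with h0
  · have : 0 ≤ δ⁻¹ * y := by positivity
    rw [max_eq_left (by linarith), max_eq_left this]
    ring
  · have h1 : y ≤ -δ := h.resolve_left h0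
    have : δ⁻¹ * y ≤ -1 := by
      rw [inv_mul_le_iff₀ hδ]; linarith
    rw [max_eq_right (by linarith), max_eq_right (by linarith), sub_zero]

lemma sum_range_pred_ite (b d : ℕ) (h : d < b) (c : ℝ) :
    ∑ i ∈ Finset.range (b - 1), (if i + 1 ≤ d then c else 0) = d * c := by
  have : ∀ i, (i + 1 ≤ d) ↔ i ∈ Finset.range d := fun i => by simp
  simp_rw [this]
  rw [Finset.sum_ite_mem, Finset.inter_eq_right.2 (by
    intro i hi; simp only [Finset.mem_range] at *; omega)]
  simp

/-- The basic gadget: if `z = (Z + r) / P` with an integer `Z < P = ∏ b` and a remainder `r`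
bounded away from `1`, then the digits of `Z` in the mixed basis `Bs` are extracted one after
another, two layers each, and multiplied by a function `c`, so that `Z * c` is computed. With
`c = 1` this is the integer part of `P * z`; with `r = 0` it is the product of `z` and `c`. -/
lemma digits {δ M : ℝ} (hδ : 0 < δ) {N : ℕ} {c : X → ℝ} {C : List (X → ℝ)}
    {r : X → ℝ} (hr0 : ∀ x, 0 ≤ r x) (hr1 : ∀ x, r x ≤ 1 - δ)
    (hc0 : ∀ x, 0 ≤ c x) (hc1 : ∀ x, c x ≤ M) (hw : 2 * (C.length + 3) + 2 * N ≤ w) :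
    ∀ (Bs : List ℕ) (ℓ : ℕ) (z acc : X → ℝ) (γ : ℝ) (Z : X → ℕ), (∀ b ∈ Bs, 0 < b) →
      (∀ b ∈ Bs, b ≤ N) → (∀ x, Z x < Bs.prod) → (∀ x, z x = (Z x + r x) / Bs.prod) →
      Computes inp w ℓ (z :: c :: acc :: C) →
      Computes inp w (ℓ + 2 * Bs.length) ((fun x => acc x + γ * (Z x * c x)) :: C) := by
  intro Bs
  induction Bs with
  | nil =>
    intro ℓ z acc γ Z _ _ hZ _ h
    have : (fun x => acc x + γ * (Z x * c x)) = acc := by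
      ext x
      have : Z x = 0 := by simpa using hZ x
      simp [this]
    rw [this]
    exact h.mono (by simp)
  | cons b Bs ih =>
    intro ℓ z acc γ Z hpos hN hZ hz h
    have hb : 0 < b := hpos b (by simp)
    have hbN : b ≤ N := hN b (by simp)
    have hpos' : ∀ b ∈ Bs, 0 < b := fun a ha => hpos a (by simp [ha])
    set P := Bs.prod with hP
    have hPpos : 0 < P := List.prod_pos hpos'
    have hPR : (0 : ℝ) < P := by exact_mod_cast hPpos
    simp only [List.prod_cons, ← hP, Nat.cast_mul] at hZ hz
    have hbR : (0 : ℝ) < b := by exact_mod_cast hb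
    set e : ℝ := δ / P with he
    have hepos : 0 < e := by positivity
    -- the indicators of `i ≤ Z / P`
    set ind : ℕ → X → ℝ := fun i x => if i ≤ Z x / P then 1 else 0 with hind
    have hind_eq : ∀ i x, ind i x = max (e⁻¹ * (b * z x - i) + 1) 0 - max (e⁻¹ * (b * z x - i)) 0 := by
      intro i x
      have hbz : b * z x - i = (Z x + r x - i * P) / P := by
        rw [hz]; field_simp
      have hcast : i ≤ Z x / P ↔ i * P ≤ Z x := Nat.le_div_iff_mul_le hPpos
      have h0 := hr0 x
      have h1 := hr1 x
      by_cases hi : i ≤ Z x / P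
      · have h2 : (i * P : ℝ) ≤ Z x := by exact_mod_cast hcast.1 hi
        have hy : 0 ≤ b * z x - i := by
          rw [hbz]; exact div_nonneg (by linarith) hPR.le
        rw [threshold_eq hepos (Or.inl hy), if_pos hy]
        simp [hind, hi]
      · have h2 : (Z x + 1 : ℝ) ≤ i * P := by
          have : Z x + 1 ≤ i * P := by
            have := mt hcast.2 hi; omega
          exact_mod_cast this
        have hy : b * z x - i ≤ -e := by
          rw [hbz, he, ← neg_div]; gcongr; linarith
        rw [threshold_eq hepos (Or.inr hy), if_neg (by linarith)]
        simp [hind, hi]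
    have hZP : ∀ x, Z x / P < b := fun x => by
      rw [Nat.div_lt_iff_lt_mul hPpos]; exact hZ x
    have hmem : ∀ a : ℝ, ∀ i : ℕ, (fun x => e⁻¹ * (b * z x - i) + a) ∈
        affSpan (z :: c :: acc :: C) := fun a i =>
      affSpan_add (affSpan_mul _ (affSpan_sub (affSpan_mul _ (mem_affSpan (by simp)))
        (const_mem_affSpan _ _))) (const_mem_affSpan _ _)
    have L1 := h.relu (C' := z :: c :: acc :: C)
      (D := ((List.range b).map fun i x => e⁻¹ * (b * z x - (i : ℕ)) + 1) ++
        ((List.range b).map fun i x => e⁻¹ * (b * z x - (i : ℕ))))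
      (fun f hf => mem_affSpan hf) (by
        intro f hf
        simp only [List.mem_append, List.mem_map] at hf
        rcases hf with ⟨i, -, rfl⟩ | ⟨i, -, rfl⟩
        · exact hmem 1 i
        · simpa using hmem 0 i) (by simp; omega)
    set L := (z :: c :: acc :: C) ++ List.map (fun (f : X → ℝ) x => max (f x) 0)
      (((List.range b).map fun i x => e⁻¹ * (b * z x - (i : ℕ)) + 1) ++
        ((List.range b).map fun i x => e⁻¹ * (b * z x - (i : ℕ)))) with hL
    have hindL : ∀ i < b, ind i ∈ affSpan L := by
      intro i hi
      have : ind i = fun x => max (e⁻¹ * (b * z x - i) + 1) 0 - max (e⁻¹ * (b * z x - i)) 0 :=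
        funext (hind_eq i)
      rw [this]
      refine affSpan_sub (mem_affSpan (List.mem_append_right _ (List.mem_map.2 ⟨_,
        List.mem_append_left _ (List.mem_map.2 ⟨i, List.mem_range.2 hi, rfl⟩), rfl⟩)))
        (mem_affSpan (List.mem_append_right _ (List.mem_map.2 ⟨_,
        List.mem_append_right _ (List.mem_map.2 ⟨i, List.mem_range.2 hi, rfl⟩), rfl⟩)))
    have hdig : ∀ x, ∑ i ∈ Finset.range (b - 1), ind (i + 1) x = (Z x / P : ℕ) := fun x => by
      simpa [hind] using sum_range_pred_ite b (Z x / P) (hZP x) 1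
    have hmemL : ∀ f ∈ z :: c :: acc :: C, f ∈ affSpan L := fun f hf =>
      mem_affSpan (List.mem_append_left _ hf)
    set z' : X → ℝ := fun x => b * z x - ∑ i ∈ Finset.range (b - 1), ind (i + 1) x with hz'
    have hz'L : z' ∈ affSpan L := affSpan_sub (affSpan_mul _ (hmemL _ (by simp)))
      (affSpan_sum fun i hi => hindL _ (by have := Finset.mem_range.1 hi; omega))
    have L2 := L1.relu (C' := z' :: c :: acc :: C)
      (D := (List.range (b - 1)).map fun i x => c x + M * (ind (i + 1) x - 1))
      (by
        intro f hf
        rcases List.mem_cons.1 hf with rfl | hf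
        · exact hz'L
        · exact hmemL f (List.mem_cons_of_mem _ hf))
      (by
        intro f hf
        obtain ⟨i, hi, rfl⟩ := List.mem_map.1 hf
        exact affSpan_add (hmemL _ (by simp)) (affSpan_mul _ (affSpan_sub
          (hindL _ (by have := List.mem_range.1 hi; omega)) (const_mem_affSpan _ _))))
      (by simp; omega)
    set acc' : X → ℝ := fun x => acc x + (γ * P) *
      ∑ i ∈ Finset.range (b - 1), max (c x + M * (ind (i + 1) x - 1)) 0 with hacc'
    have hacc'_eq : ∀ x, acc' x = acc x + γ * P * ((Z x / P : ℕ) * c x) := by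
      intro x
      simp only [hacc']
      rw [← sum_range_pred_ite b (Z x / P) (hZP x) (c x)]
      congr 2
      refine Finset.sum_congr rfl fun i _ => ?_
      simp only [hind]
      have := hc0 x
      have := hc1 x
      split_ifs
      · rw [max_eq_left] <;> linarith
      · rw [max_eq_right]; linarith
    have L3 : Computes inp w (ℓ + 1 + 1) (z' :: c :: acc' :: C) := by
      refine L2.aff fun f hf => ?_
      have hgen : ∀ f ∈ z' :: c :: acc :: C, f ∈ affSpan (z' :: c :: acc :: C ++
          List.map (fun (f : X → ℝ) x => max (f x) 0)
            ((List.range (b - 1)).map fun i x => c x + M * (ind (i + 1) x - 1))) := fun f hf =>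
        mem_affSpan (List.mem_append_left _ hf)
      simp only [List.mem_cons] at hf
      rcases hf with rfl | rfl | rfl | hf
      · exact hgen _ (by simp)
      · exact hgen _ (by simp)
      · refine affSpan_add (hgen _ (by simp)) (affSpan_mul _ (affSpan_sum fun i hi => ?_))
        exact mem_affSpan (List.mem_append_right _ (List.mem_map.2 ⟨_,
          List.mem_map.2 ⟨i, List.mem_range.2 (Finset.mem_range.1 hi), rfl⟩, rfl⟩))
      · exact hgen _ (by simp [hf])
    have L4 := ih (ℓ + 1 + 1) z' acc' γ (fun x => Z x % P) hpos' (fun a ha => hN a (by simp [ha]))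
      (fun x => Nat.mod_lt _ hPpos) (fun x => by
        have h1 : (Z x : ℝ) = P * (Z x / P : ℕ) + (Z x % P : ℕ) := by
          exact_mod_cast (Nat.div_add_mod (Z x) P).symm
        simp only [hz', hdig, hz, h1]
        field_simp
        ring) L3
    have hlen : ℓ + 2 * (b :: Bs).length = ℓ + 1 + 1 + 2 * Bs.length := by
      simp; ring
    rw [hlen]
    convert L4 using 3 with x
    have h1 : (Z x : ℝ) = P * (Z x / P : ℕ) + (Z x % P : ℕ) := by
      exact_mod_cast (Nat.div_add_mod (Z x) P).symm
    rw [hacc'_eq]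
    simp only [h1]
    ring

end Computes

/-- The number `∑_{k < n} ξ k / Q ^ (k + 1)`, whose expansion in base `Q` stores `n` digits. -/
def digitCode (Q : ℕ) : (ℕ → ℕ) → ℕ → ℝ
  | _, 0 => 0
  | ξ, n + 1 => (ξ 0 + digitCode Q (fun k => ξ (k + 1)) n) / Q

lemma digitCode_nonneg (Q : ℕ) : ∀ (n : ℕ) (ξ : ℕ → ℕ), 0 ≤ digitCode Q ξ n
  | 0, _ => le_rfl
  | n + 1, ξ => by
    have := digitCode_nonneg Q n (fun k => ξ (k + 1))
    unfold digitCode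
    positivity

lemma digitCode_le {Q : ℕ} (hQ : 0 < Q) : ∀ (n : ℕ) (ξ : ℕ → ℕ), (∀ k, ξ k < Q) →
    digitCode Q ξ n ≤ 1 - ((Q : ℝ) ^ n)⁻¹
  | 0, _, _ => by simp [digitCode]
  | n + 1, ξ, h => by
    have := digitCode_le hQ n (fun k => ξ (k + 1)) (fun k => h _)
    have h0 : (ξ 0 + 1 : ℝ) ≤ Q := by exact_mod_cast h 0
    have hQ' : (0 : ℝ) < Q := by exact_mod_cast hQ
    unfold digitCode
    rw [div_le_iff₀ hQ', sub_mul, pow_succ, mul_inv, mul_assoc, inv_mul_cancel₀ hQ'.ne']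
    linarith

lemma digitCode_le_of_le {Q : ℕ} (hQ : 0 < Q) {n L : ℕ} (hn : n ≤ L) (ξ : ℕ → ℕ)
    (h : ∀ k, ξ k < Q) : digitCode Q ξ n ≤ 1 - ((Q : ℝ) ^ L)⁻¹ := by
  refine (digitCode_le hQ n ξ h).trans ?_
  have hQ' : (1 : ℝ) ≤ Q := by exact_mod_cast hQ
  gcongr

namespace Computes

variable {X : Type*} {m : ℕ} {inp : Fin m → X → ℝ} {w ℓ : ℕ} {C : List (X → ℝ)}

/-- Splitting off the leading digits: with `P₂` a nonzero integer, `(Z + r) / (∏ Bs * P₂)` is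
turned into the integer `Z / P₂` and the rest `(Z % P₂ + r) / P₂`. -/
lemma split {δ : ℝ} (hδ : 0 < δ) {N : ℕ} (Bs : List ℕ) (P₂ : ℕ) (hP₂ : 0 < P₂) {r z : X → ℝ}
    {Z : X → ℕ} (hr0 : ∀ x, 0 ≤ r x) (hr1 : ∀ x, r x ≤ 1 - δ) (hw : 2 * (C.length + 4) + 2 * N ≤ w)
    (hpos : ∀ b ∈ Bs, 0 < b) (hN : ∀ b ∈ Bs, b ≤ N) (hZ : ∀ x, Z x < Bs.prod * P₂)
    (hz : ∀ x, z x = (Z x + r x) / (Bs.prod * P₂ : ℕ)) (h : Computes inp w ℓ (z :: C)) :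
    Computes inp w (ℓ + 2 * Bs.length)
      ((fun x => ((Z x / P₂ : ℕ) : ℝ)) :: (fun x => ((Z x % P₂ : ℕ) + r x) / P₂) :: C) := by
  have hP : (0 : ℝ) < P₂ := by exact_mod_cast hP₂
  have hB : (0 : ℝ) < Bs.prod := by exact_mod_cast List.prod_pos hpos
  have hmod : ∀ x, (Z x : ℝ) = P₂ * (Z x / P₂ : ℕ) + (Z x % P₂ : ℕ) := fun x => by
    exact_mod_cast (Nat.div_add_mod (Z x) P₂).symm
  have hlt : ∀ x, ((Z x % P₂ : ℕ) : ℝ) + 1 ≤ P₂ := fun x => by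
    exact_mod_cast Nat.mod_lt _ hP₂
  have h1 : Computes inp w ℓ (z :: (fun _ => 1) :: (fun _ => 0) :: z :: C) := by
    refine h.aff fun f hf => ?_
    simp only [List.mem_cons] at hf
    rcases hf with rfl | rfl | rfl | rfl | hf
    · exact mem_affSpan (by simp)
    · exact const_mem_affSpan _ _
    · exact const_mem_affSpan _ _
    · exact mem_affSpan (by simp)
    · exact mem_affSpan (by simp [hf])
  have h2 := digits (δ := δ / P₂) (M := 1) (by positivity) (N := N) (c := fun _ => 1) (C := z :: C)
    (r := fun x => ((Z x % P₂ : ℕ) + r x) / P₂)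
    (fun x => by have := hr0 x; positivity)
    (fun x => by
      rw [div_le_iff₀ hP, sub_mul, div_mul_cancel₀ _ hP.ne']
      have := hr1 x; have := hlt x; linarith)
    (fun _ => zero_le_one) (fun _ => le_rfl) (by simp; omega) Bs ℓ z (fun _ => 0) 1
    (fun x => Z x / P₂) hpos hN (fun x => by
      rw [Nat.div_lt_iff_lt_mul hP₂]; exact hZ x) (fun x => by
      rw [hz, Nat.cast_mul, hmod x]
      field_simp
      ring) h1
  refine h2.aff fun f hf => ?_
  simp only [List.mem_cons] at hf
  rcases hf with rfl | rfl | hf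
  · exact mem_affSpan (by simp)
  · have : (fun x => ((Z x % P₂ : ℕ) + r x) / P₂) = fun x =>
        (Bs.prod : ℝ) * z x - (0 + 1 * ((Z x / P₂ : ℕ) * 1)) := by
      ext x
      rw [hz, Nat.cast_mul, hmod x]
      field_simp
      ring
    rw [this]
    exact affSpan_sub (affSpan_mul _ (mem_affSpan (by simp))) (mem_affSpan (by simp))
  · exact mem_affSpan (by simp [hf])

/-- Exact product with a function `T` of finitely many digits, that is, with values in the
multiples of `1 / ∏ Bs`. -/
lemma mul_left {N : ℕ} (Bs : List ℕ) {T v : X → ℝ} {Z : X → ℕ}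
    (hpos : ∀ b ∈ Bs, 0 < b) (hN : ∀ b ∈ Bs, b ≤ N) (hZ : ∀ x, Z x < Bs.prod)
    (hT : ∀ x, T x = Z x / Bs.prod) (hv0 : ∀ x, 0 ≤ v x) (hv1 : ∀ x, v x ≤ 1) (hTC : T ∈ C)
    (hw : 2 * (C.length + 3) + 2 * N ≤ w) (h : Computes inp w ℓ (v :: C)) :
    Computes inp w (ℓ + 2 * Bs.length) ((fun x => T x * v x) :: C) := by
  have h1 : Computes inp w ℓ (T :: v :: (fun _ => 0) :: C) := by
    refine h.aff fun f hf => ?_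
    simp only [List.mem_cons] at hf
    rcases hf with rfl | rfl | rfl | hf
    · exact mem_affSpan (by simp [hTC])
    · exact mem_affSpan (by simp)
    · exact const_mem_affSpan _ _
    · exact mem_affSpan (by simp [hf])
  have h2 := digits (δ := 1) (M := 1) one_pos (N := N) (c := v) (C := C) (r := fun _ => 0)
    (fun _ => le_rfl) (fun _ => by simp) hv0 hv1 hw Bs ℓ T (fun _ => 0) (Bs.prod : ℝ)⁻¹ Z
    hpos hN hZ (fun x => by simp [hT]) h1
  convert h2 using 3 with x
  rw [hT]
  ring

lemma pow_mul_left {N : ℕ} (Bs : List ℕ) {T v : X → ℝ} {Z : X → ℕ}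
    (hpos : ∀ b ∈ Bs, 0 < b) (hN : ∀ b ∈ Bs, b ≤ N) (hZ : ∀ x, Z x < Bs.prod)
    (hT : ∀ x, T x = Z x / Bs.prod) (hv0 : ∀ x, 0 ≤ v x) (hv1 : ∀ x, v x ≤ 1) (hTC : T ∈ C)
    (hw : 2 * (C.length + 3) + 2 * N ≤ w) (h : Computes inp w ℓ (v :: C)) (i : ℕ) :
    Computes inp w (ℓ + i * (2 * Bs.length)) ((fun x => T x ^ i * v x) :: C) := by
  have hpR : (0 : ℝ) < Bs.prod := by exact_mod_cast List.prod_pos hpos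
  have hT0 : ∀ x, 0 ≤ T x := fun x => by rw [hT]; positivity
  have hT1 : ∀ x, T x ≤ 1 := fun x => by
    rw [hT, div_le_one hpR]; exact_mod_cast (hZ x).le
  induction i with
  | zero => simpa using h
  | succ i ih =>
    have := mul_left Bs hpos hN hZ hT
      (fun x => mul_nonneg (pow_nonneg (hT0 x) i) (hv0 x))
      (fun x => mul_le_one₀ (pow_le_one₀ (hT0 x) (hT1 x)) (hv0 x) (hv1 x)) hTC hw ih
    convert this using 1
    · ring
    · congr 1
      ext x
      ring

/-- The indicator of `n = q` is a combination of three thresholds. -/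
lemma ite_eq_relu (n q : ℕ) : (if n = q then (1 : ℝ) else 0) =
    max ((n : ℝ) - q + 1) 0 - 2 * max ((n : ℝ) - q) 0 + max ((n : ℝ) - q - 1) 0 := by
  rcases lt_trichotomy n q with h | rfl | h
  · have : (n : ℝ) + 1 ≤ q := by exact_mod_cast h
    rw [if_neg h.ne, max_eq_right (by linarith), max_eq_right (by linarith),
      max_eq_right (by linarith)]
    ring
  · simp
  · have : (q : ℝ) + 1 ≤ n := by exact_mod_cast h
    rw [if_neg h.ne', max_eq_left (by linarith), max_eq_left (by linarith),
      max_eq_left (by linarith)]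
    ring

/-- Adding `v` to the accumulator `acc` at the inputs with `c = q`. -/
lemma add_ite {v acc : X → ℝ} {c : X → ℕ} (q : ℕ) (hv0 : ∀ x, 0 ≤ v x) (hv1 : ∀ x, v x ≤ 1)
    (hw : 2 * (C.length + 2) + 3 ≤ w)
    (h : Computes inp w ℓ (v :: (fun x => (c x : ℝ)) :: acc :: C)) :
    Computes inp w (ℓ + 2) ((fun x => acc x + if c x = q then v x else 0) :: C) := by
  have hc : (fun x => (c x : ℝ)) ∈ affSpan (v :: (fun x => (c x : ℝ)) :: acc :: C) :=
    mem_affSpan (by simp)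
  have L1 := h.relu (C' := v :: acc :: C) (D := [fun x => (c x : ℝ) - q + 1,
    fun x => (c x : ℝ) - q, fun x => (c x : ℝ) - q - 1])
    (fun f hf => mem_affSpan (by simp only [List.mem_cons] at hf ⊢; tauto))
    (by
      intro f hf
      simp only [List.mem_cons, List.not_mem_nil, or_false] at hf
      rcases hf with rfl | rfl | rfl
      · exact affSpan_add (affSpan_sub hc (const_mem_affSpan _ _)) (const_mem_affSpan _ _)
      · exact affSpan_sub hc (const_mem_affSpan _ _)
      · exact affSpan_sub (affSpan_sub hc (const_mem_affSpan _ _)) (const_mem_affSpan _ _))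
    (by simp; omega)
  have L2 := L1.relu (C' := acc :: C) (D := [fun x => v x + ((if c x = q then (1 : ℝ) else 0) - 1)])
    (fun f hf => mem_affSpan (by simp only [List.mem_cons, List.mem_append] at hf ⊢; tauto))
    (by
      intro f hf
      simp only [List.mem_cons, List.not_mem_nil, or_false] at hf
      subst hf
      simp only [ite_eq_relu]
      exact affSpan_add (mem_affSpan (by simp)) (affSpan_sub (affSpan_add (affSpan_sub
        (mem_affSpan (by simp)) (affSpan_mul _ (mem_affSpan (by simp))))
        (mem_affSpan (by simp))) (const_mem_affSpan _ _)))
    (by simp; omega)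
  refine L2.aff fun f hf => ?_
  simp only [List.mem_cons] at hf
  rcases hf with rfl | hf
  · have : (fun x => acc x + if c x = q then v x else 0) = fun x => acc x +
        max (v x + ((if c x = q then (1 : ℝ) else 0) - 1)) 0 := by
      ext x
      have := hv0 x
      have := hv1 x
      split_ifs
      · rw [max_eq_left] <;> linarith
      · rw [max_eq_right]; linarith
    rw [this]
    exact affSpan_add (mem_affSpan (by simp)) (mem_affSpan (by simp))
  · exact mem_affSpan (by simp [hf])

/-- One-hot encoding of an integer. -/
lemma oneHot {a : X → ℕ} (N : ℕ) (hw : 2 * C.length + 3 * N ≤ w)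
    (h : Computes inp w ℓ ((fun x => (a x : ℝ)) :: C)) :
    Computes inp w (ℓ + 1)
      (((List.range N).map fun i x => if a x = i then (1 : ℝ) else 0) ++ C) := by
  have ha : (fun x => (a x : ℝ)) ∈ affSpan ((fun x => (a x : ℝ)) :: C) := mem_affSpan (by simp)
  have L1 := h.relu (C' := C) (D := ((List.range N).map fun i x => (a x : ℝ) - (i : ℕ) + 1) ++
    ((List.range N).map fun i x => (a x : ℝ) - (i : ℕ)) ++
    ((List.range N).map fun i x => (a x : ℝ) - (i : ℕ) - 1))
    (fun f hf => mem_affSpan (by simp [hf]))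
    (by
      intro f hf
      simp only [List.mem_append, List.mem_map] at hf
      rcases hf with (⟨i, -, rfl⟩ | ⟨i, -, rfl⟩) | ⟨i, -, rfl⟩
      · exact affSpan_add (affSpan_sub ha (const_mem_affSpan _ _)) (const_mem_affSpan _ _)
      · exact affSpan_sub ha (const_mem_affSpan _ _)
      · exact affSpan_sub (affSpan_sub ha (const_mem_affSpan _ _)) (const_mem_affSpan _ _))
    (by simp; omega)
  refine L1.aff fun f hf => ?_
  rcases List.mem_append.1 hf with hf | hf
  · obtain ⟨i, hi, rfl⟩ := List.mem_map.1 hf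
    simp only [ite_eq_relu]
    refine affSpan_add (affSpan_sub ?_ (affSpan_mul _ ?_)) ?_ <;>
    refine mem_affSpan (List.mem_append_right _ (List.mem_map.2 ⟨_, ?_, rfl⟩)) <;>
    simp only [List.mem_append, List.mem_map]
    · exact Or.inl (Or.inl ⟨i, hi, rfl⟩)
    · exact Or.inl (Or.inr ⟨i, hi, rfl⟩)
    · exact Or.inr ⟨i, hi, rfl⟩
  · exact mem_affSpan (by simp [hf])

/-- One layer selects an entry of an `N × N` matrix from one-hot encodings of row and column. -/
lemma matrix_entry {a b : X → ℕ} {N : ℕ} (V : ℕ → ℕ → ℝ) (hV0 : ∀ i j, 0 ≤ V i j)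
    (hV1 : ∀ i j, V i j ≤ 1) (ha : ∀ x, a x < N) (hb : ∀ x, b x < N)
    (haC : ∀ i < N, (fun x => if a x = i then (1 : ℝ) else 0) ∈ C)
    (hbC : ∀ i < N, (fun x => if b x = i then (1 : ℝ) else 0) ∈ C)
    (hw : 2 * C.length + N ≤ w) (h : Computes inp w ℓ C) :
    Computes inp w (ℓ + 1) ((fun x => V (a x) (b x)) :: C) := by
  have L1 := h.relu (C' := C) (D := (List.range N).map fun j x =>
    ∑ i ∈ Finset.range N, V i j * (if a x = i then (1 : ℝ) else 0) +
      ((if b x = j then (1 : ℝ) else 0) - 1)) (fun f hf => mem_affSpan hf)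
    (by
      intro f hf
      obtain ⟨j, hj, rfl⟩ := List.mem_map.1 hf
      exact affSpan_add (affSpan_sum fun i hi => affSpan_mul _
        (mem_affSpan (haC i (Finset.mem_range.1 hi)))) (affSpan_sub
        (mem_affSpan (hbC j (List.mem_range.1 hj))) (const_mem_affSpan _ _)))
    (by simpa using hw)
  refine L1.aff fun f hf => ?_
  rcases List.mem_cons.1 hf with rfl | hf
  · have : (fun x => V (a x) (b x)) = fun x => ∑ j ∈ Finset.range N,
        max (∑ i ∈ Finset.range N, V i j * (if a x = i then (1 : ℝ) else 0) +
          ((if b x = j then (1 : ℝ) else 0) - 1)) 0 := by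
      ext x
      have hs : ∀ j, ∑ i ∈ Finset.range N, V i j * (if a x = i then (1 : ℝ) else 0) = V (a x) j := by
        intro j
        simp [ha x]
      simp only [hs]
      rw [Finset.sum_eq_single (b x)]
      · simp [hV0]
      · intro j _ hj
        rw [if_neg (Ne.symm hj), max_eq_right]
        have := hV1 (a x) j
        linarith
      · intro hj
        exact absurd (Finset.mem_range.2 (hb x)) hj
    rw [this]
    exact affSpan_sum fun j hj => mem_affSpan (List.mem_append_right _
      (List.mem_map.2 ⟨_, List.mem_map.2 ⟨j, List.mem_range.2 (Finset.mem_range.1 hj), rfl⟩, rfl⟩))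
  · exact mem_affSpan (by simp [hf])

/-- Selecting one of `n` matrices, one after another. -/
lemma matrix_select {a b c : X → ℕ} {N : ℕ} (V : ℕ → ℕ → ℕ → ℝ) (hV0 : ∀ q i j, 0 ≤ V q i j)
    (hV1 : ∀ q i j, V q i j ≤ 1) (ha : ∀ x, a x < N) (hb : ∀ x, b x < N)
    (haC : ∀ i < N, (fun x => if a x = i then (1 : ℝ) else 0) ∈ C)
    (hbC : ∀ i < N, (fun x => if b x = i then (1 : ℝ) else 0) ∈ C)
    (hcC : (fun x => (c x : ℝ)) ∈ C)
    (hw : 2 * (C.length + 3) + N ≤ w) (hw' : 2 * (C.length + 2) + 3 ≤ w)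
    (h : Computes inp w ℓ C) (n : ℕ) :
    Computes inp w (ℓ + 3 * n) ((fun x => ∑ q ∈ Finset.range n,
      if c x = q then V q (a x) (b x) else 0) :: C) := by
  induction n with
  | zero =>
    refine h.aff fun f hf => ?_
    simp only [Finset.range_zero, Finset.sum_empty, List.mem_cons] at hf
    rcases hf with rfl | hf
    · exact const_mem_affSpan _ _
    · exact mem_affSpan hf
  | succ n ih =>
    set acc : X → ℝ := fun x => ∑ q ∈ Finset.range n, if c x = q then V q (a x) (b x) else 0
    have h1 := matrix_entry (C := acc :: C) (V n) (hV0 n) (hV1 n) ha hb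
      (fun i hi => List.mem_cons_of_mem _ (haC i hi))
      (fun i hi => List.mem_cons_of_mem _ (hbC i hi)) (by simp; omega) ih
    have h2 := add_ite (C := C) (v := fun x => V n (a x) (b x)) (acc := acc) (c := c) n
      (fun x => hV0 _ _ _) (fun x => hV1 _ _ _) hw'
      (h1.mono (by
        intro f hf
        simp only [List.mem_cons] at hf ⊢
        rcases hf with rfl | rfl | rfl | hf <;> simp [*]))
    simp only [Finset.sum_range_succ]
    exact h2

/-- Reading off one of the digits stored in a number. -/
lemma digit_select {l : X → ℕ} {N : ℕ} (Bs : List ℕ) (ξ : X → ℕ → ℕ) (L : ℕ)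
    (hpos : ∀ b ∈ Bs, 0 < b) (hN : ∀ b ∈ Bs, b ≤ N) (hξ : ∀ x k, ξ x k < Bs.prod)
    (hlC : (fun x => (l x : ℝ)) ∈ C) (hw : 2 * (C.length + 5) + 2 * N ≤ w)
    (hw' : 2 * (C.length + 3) + 3 ≤ w)
    (h : Computes inp w ℓ ((fun x => digitCode Bs.prod (ξ x) L) :: C)) :
    Computes inp w (ℓ + L * (2 * Bs.length + 2)) ((fun x => ∑ k ∈ Finset.range L,
      if l x = k then (ξ x k : ℝ) / Bs.prod else 0) :: C) := by
  have hP : 0 < Bs.prod := List.prod_pos hpos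
  have hPR : (0 : ℝ) < Bs.prod := by exact_mod_cast hP
  suffices H : ∀ t ≤ L, Computes inp w (ℓ + t * (2 * Bs.length + 2))
      ((fun x => ∑ k ∈ Finset.range t, if l x = k then (ξ x k : ℝ) / Bs.prod else 0) ::
        (fun x => digitCode Bs.prod (fun k => ξ x (t + k)) (L - t)) :: C) from
    (H L le_rfl).mono (by intro f hf; simp only [List.mem_cons] at hf ⊢; tauto)
  intro t
  induction t with
  | zero =>
    intro _
    simp only [zero_mul, add_zero, zero_add, Nat.sub_zero]
    refine h.aff fun f hf => ?_
    simp only [Finset.range_zero, Finset.sum_empty, List.mem_cons] at hf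
    rcases hf with rfl | hf
    · exact const_mem_affSpan _ _
    · exact mem_affSpan (by simpa using hf)
  | succ t ih =>
    intro ht
    set acc : X → ℝ := fun x => ∑ k ∈ Finset.range t,
      if l x = k then (ξ x k : ℝ) / Bs.prod else 0 with hacc
    set z : X → ℝ := fun x => digitCode Bs.prod (fun k => ξ x (t + k)) (L - t) with hz
    set z' : X → ℝ := fun x => digitCode Bs.prod (fun k => ξ x (t + 1 + k)) (L - (t + 1)) with hz'
    have hzz : ∀ x, z x = (ξ x t + z' x) / Bs.prod := by
      intro x
      have : L - t = (L - (t + 1)) + 1 := by omega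
      simp only [hz, hz', this, digitCode, add_zero]
      congr 3
      ext k
      congr 1
      omega
    have h1 : Computes inp w (ℓ + t * (2 * Bs.length + 2))
        (z :: (fun _ => 1) :: (fun _ => 0) :: z :: acc :: C) := by
      refine (ih (by omega)).aff fun f hf => ?_
      simp only [List.mem_cons] at hf
      rcases hf with rfl | rfl | rfl | hf
      · exact mem_affSpan (by simp)
      · exact const_mem_affSpan _ _
      · exact const_mem_affSpan _ _
      · exact mem_affSpan (by simp only [List.mem_cons]; tauto)
    have h2 := digits (δ := ((Bs.prod : ℝ) ^ L)⁻¹) (M := 1) (by positivity) (N := N)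
      (c := fun _ => 1) (C := z :: acc :: C) (r := z') (fun x => digitCode_nonneg _ _ _)
      (fun x => digitCode_le_of_le hP (Nat.sub_le _ _) _ (fun k => hξ _ _))
      (fun _ => zero_le_one) (fun _ => le_rfl) (by simp; omega) Bs _ z (fun _ => 0) 1
      (fun x => ξ x t) hpos hN (fun x => hξ x t) hzz h1
    have h3 := add_ite (C := z' :: C) (v := fun x => (ξ x t : ℝ) / Bs.prod) (acc := acc) (c := l) t
      (fun x => by positivity)
      (fun x => by rw [div_le_one hPR]; exact_mod_cast (hξ x t).le) (by simp; omega)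
      (h2.aff (by
        have hξmem : (fun x => (ξ x t : ℝ)) ∈ affSpan
            ((fun x => (0 : ℝ) + 1 * (ξ x t * 1)) :: z :: acc :: C) := by
          refine mem_affSpan ?_
          simp
        intro f hf
        simp only [List.mem_cons] at hf
        rcases hf with rfl | rfl | rfl | rfl | hf
        · have : (fun x => (ξ x t : ℝ) / Bs.prod) = fun x => (Bs.prod : ℝ)⁻¹ * ξ x t := by
            ext x; ring
          rw [this]
          exact affSpan_mul _ hξmem
        · exact mem_affSpan (by simp [hlC])
        · exact mem_affSpan (by simp)
        · have : z' = fun x => (Bs.prod : ℝ) * z x - ξ x t := by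
            ext x
            rw [hzz]
            field_simp
            ring
          rw [this]
          exact affSpan_sub (affSpan_mul _ (mem_affSpan (by simp))) hξmem
        · exact mem_affSpan (by simp [hf])))
    have e : ℓ + (t + 1) * (2 * Bs.length + 2) =
        ℓ + t * (2 * Bs.length + 2) + 2 * Bs.length + 2 := by ring
    rw [e]
    simp only [Finset.sum_range_succ]
    exact h3

/-- Lookup in a table with `N ^ 2 * L ^ 2` entries, by `O(N)` neurons in each of `O(L)` stages:
for each `c < L` the digits of a single number store the `L` entries at `(a, b, c)`. -/
lemma lookup {a b c l : X → ℕ} {N L : ℕ} (Bs : List ℕ) (tab : ℕ → ℕ → ℕ → ℕ → ℕ)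
    (hpos : ∀ b ∈ Bs, 0 < b) (hN : ∀ b ∈ Bs, b ≤ N) (htab : ∀ i j q k, tab i j q k < Bs.prod)
    (ha : ∀ x, a x < N) (hb : ∀ x, b x < N) (hc : ∀ x, c x < L) (hl : ∀ x, l x < L)
    (haC : (fun x => (a x : ℝ)) ∈ C) (hbC : (fun x => (b x : ℝ)) ∈ C)
    (hcC : (fun x => (c x : ℝ)) ∈ C) (hlC : (fun x => (l x : ℝ)) ∈ C)
    (hw : 2 * C.length + 5 * N + 10 ≤ w) (h : Computes inp w ℓ C) :
    Computes inp w (ℓ + (2 + 3 * L + L * (2 * Bs.length + 2)))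
      ((fun x => (tab (a x) (b x) (c x) (l x) : ℝ) / Bs.prod) :: C) := by
  have hP : 0 < Bs.prod := List.prod_pos hpos
  have h1 := oneHot (C := C) (a := a) N (by omega) (h.mono (by
    intro f hf; rcases List.mem_cons.1 hf with rfl | hf <;> assumption))
  have h2 := oneHot (C := ((List.range N).map fun i x => if a x = i then (1 : ℝ) else 0) ++ C)
    (a := b) N (by simp; omega) (h1.mono (by
      intro f hf
      rcases List.mem_cons.1 hf with rfl | hf
      · exact List.mem_append_right _ hbC
      · exact hf))
  set V : ℕ → ℕ → ℕ → ℝ := fun q i j => digitCode Bs.prod (fun k => tab i j q k) L with hV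
  have h3 := matrix_select (a := a) (b := b) (c := c) (N := N) V
    (fun q i j => digitCode_nonneg _ _ _)
    (fun q i j => (digitCode_le hP L _ (fun k => htab _ _ _ _)).trans (by
      rw [sub_le_self_iff]; positivity)) ha hb
    (fun i hi => List.mem_append_right _ (List.mem_append_left _
      (List.mem_map.2 ⟨i, List.mem_range.2 hi, rfl⟩)))
    (fun i hi => List.mem_append_left _ (List.mem_map.2 ⟨i, List.mem_range.2 hi, rfl⟩))
    (List.mem_append_right _ (List.mem_append_right _ hcC))
    (by simp; omega) (by simp; omega) h2 L
  have h4 : Computes inp w (ℓ + 1 + 1 + 3 * L) ((fun x => digitCode Bs.prod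
      (fun k => tab (a x) (b x) (c x) k) L) :: C) := by
    refine h3.mono ?_
    intro f hf
    rcases List.mem_cons.1 hf with rfl | hf
    · refine List.mem_cons.2 (Or.inl ?_)
      ext x
      simp [hc x, hV]
    · simp [hf]
  have h5 := digit_select (l := l) Bs (fun x k => tab (a x) (b x) (c x) k) L hpos hN
    (fun x k => htab _ _ _ _) hlC (by omega) (by omega) h4
  convert h5 using 1
  · ring
  · congr 1
    ext x
    simp [hl x]

end Computes

/-! ### Networks for piecewise polynomials -/

/-- The number of layers that look up a coefficient and multiply it by a monomial. -/
def termDepth (n L k : ℕ) : ℕ := 2 + 3 * L + L * (2 * k + 2) + 2 * (n * (2 * k))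

namespace Computes

variable {X : Type*} {m : ℕ} {inp : Fin m → X → ℝ} {w ℓ : ℕ} {C : List (X → ℝ)}

/-- Adding `κ` times a polynomial in `T` and `U` to the accumulator `acc`, one monomial after
another: its coefficient is looked up and then multiplied by the powers of `T` and `U`, which have
to be multiples of `1 / ∏ Bs`. -/
lemma monomial_sum {a b c l : X → ℕ} {N L n : ℕ} (Bs : List ℕ)
    (tab : ℕ → ℕ → ℕ → ℕ → ℕ × ℕ → ℕ) {T U : X → ℝ} {ZT ZU : X → ℕ}
    (hpos : ∀ b ∈ Bs, 0 < b) (hN : ∀ b ∈ Bs, b ≤ N) (htab : ∀ i j q k τ, tab i j q k τ < Bs.prod)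
    (ha : ∀ x, a x < N) (hb : ∀ x, b x < N) (hc : ∀ x, c x < L) (hl : ∀ x, l x < L)
    (haC : (fun x => (a x : ℝ)) ∈ C) (hbC : (fun x => (b x : ℝ)) ∈ C)
    (hcC : (fun x => (c x : ℝ)) ∈ C) (hlC : (fun x => (l x : ℝ)) ∈ C)
    (hZT : ∀ x, ZT x < Bs.prod) (hT : ∀ x, T x = ZT x / Bs.prod) (hTC : T ∈ C)
    (hZU : ∀ x, ZU x < Bs.prod) (hU : ∀ x, U x = ZU x / Bs.prod) (hUC : U ∈ C)
    (hw : 2 * C.length + 5 * N + 12 ≤ w) {acc : X → ℝ} (κ : ℝ)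
    (h : Computes inp w ℓ (acc :: C)) (S : Finset (ℕ × ℕ)) (hS : ∀ τ ∈ S, τ.1 ≤ n ∧ τ.2 ≤ n) :
    Computes inp w (ℓ + S.card * termDepth n L Bs.length) ((fun x => acc x + κ * ∑ τ ∈ S,
      (tab (a x) (b x) (c x) (l x) τ / Bs.prod : ℝ) * (T x ^ τ.1 * U x ^ τ.2)) :: C) := by
  classical
  have hPR : (0 : ℝ) < Bs.prod := by exact_mod_cast List.prod_pos hpos
  have hT0 : ∀ x, 0 ≤ T x := fun x => by rw [hT]; positivity
  have hT1 : ∀ x, T x ≤ 1 := fun x => by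
    rw [hT, div_le_one hPR]; exact_mod_cast (hZT x).le
  induction S using Finset.induction_on with
  | empty => simpa using h
  | insert τ S hτ ih =>
    have ih := ih fun σ hσ => hS σ (Finset.mem_insert_of_mem hσ)
    set acc' : X → ℝ := fun x => acc x + κ * ∑ τ ∈ S,
      (tab (a x) (b x) (c x) (l x) τ / Bs.prod : ℝ) * (T x ^ τ.1 * U x ^ τ.2) with hacc'
    have hτn := hS τ (Finset.mem_insert_self _ _)
    have h1 := lookup (C := acc' :: C) Bs (fun i j q k => tab i j q k τ) hpos hN
      (fun i j q k => htab i j q k τ) ha hb hc hl (List.mem_cons_of_mem _ haC)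
      (List.mem_cons_of_mem _ hbC) (List.mem_cons_of_mem _ hcC) (List.mem_cons_of_mem _ hlC)
      (by simp; omega) ih
    set v : X → ℝ := fun x => (tab (a x) (b x) (c x) (l x) τ : ℝ) / Bs.prod
    have hv0 : ∀ x, 0 ≤ v x := fun x => by positivity
    have hv1 : ∀ x, v x ≤ 1 := fun x => by
      rw [div_le_one hPR]; exact_mod_cast (htab _ _ _ _ τ).le
    have h2 := pow_mul_left Bs hpos hN hZT hT hv0 hv1 (List.mem_cons_of_mem _ hTC)
      (by simp; omega) h1 τ.1
    have h3 := pow_mul_left Bs hpos hN hZU hU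
      (fun x => mul_nonneg (pow_nonneg (hT0 x) τ.1) (hv0 x))
      (fun x => mul_le_one₀ (pow_le_one₀ (hT0 x) (hT1 x)) (hv0 x) (hv1 x))
      (List.mem_cons_of_mem _ hUC) (by simp; omega) h2 τ.2
    have h4 := h3.pad (by simp; omega) ((n - τ.1) * (2 * Bs.length) + (n - τ.2) * (2 * Bs.length))
    have e : ℓ + (insert τ S).card * termDepth n L Bs.length =
        ℓ + S.card * termDepth n L Bs.length + (2 + 3 * L + L * (2 * Bs.length + 2)) +
        τ.1 * (2 * Bs.length) + τ.2 * (2 * Bs.length) +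
        ((n - τ.1) * (2 * Bs.length) + (n - τ.2) * (2 * Bs.length)) := by
      rw [Finset.card_insert_of_notMem hτ, termDepth]
      obtain ⟨p, hp⟩ := Nat.exists_eq_add_of_le hτn.1
      obtain ⟨q, hq⟩ := Nat.exists_eq_add_of_le hτn.2
      rw [show n - τ.1 = p by omega, show n - τ.2 = q by omega]
      have e1 : n * (2 * Bs.length) = τ.1 * (2 * Bs.length) + p * (2 * Bs.length) := by
        rw [hp]; ring
      have e2 : n * (2 * Bs.length) = τ.2 * (2 * Bs.length) + q * (2 * Bs.length) := by
        rw [hq]; ring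
      linarith
    rw [e]
    refine h4.aff fun f hf => ?_
    rcases List.mem_cons.1 hf with rfl | hf
    · have : (fun x => acc x + κ * ∑ τ ∈ insert τ S,
          (tab (a x) (b x) (c x) (l x) τ / Bs.prod : ℝ) * (T x ^ τ.1 * U x ^ τ.2)) =
          fun x => acc' x + κ * (U x ^ τ.2 * (T x ^ τ.1 * v x)) := by
        ext x
        rw [Finset.sum_insert hτ]
        simp only [hacc', v]
        ring
      rw [this]
      exact affSpan_add (mem_affSpan (by simp)) (affSpan_mul _ (mem_affSpan (by simp)))
    · exact mem_affSpan (by simp [hf])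

end Computes

/-- The numerator of the positive part of `c / M`, rounded down to a multiple of `1 / P`. -/
def quant (P : ℕ) (M c : ℝ) : ℕ := ⌊P * (max c 0 / M)⌋₊

lemma quant_lt {P : ℕ} (hP : 0 < P) {M c : ℝ} (hM : 0 < M) (hc : |c| < M) : quant P M c < P := by
  rw [quant, Nat.floor_lt (by positivity)]
  have : max c 0 / M < 1 := by
    rw [div_lt_one hM]; exact max_lt ((le_abs_self c).trans_lt hc) hM
  have hP' : (0 : ℝ) < P := by exact_mod_cast hP
  nlinarith

lemma abs_sub_quant_le {P : ℕ} (hP : 0 < P) {M c : ℝ} (hM : 0 < M) :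
    |M * (quant P M c / P) - M * (quant P M (-c) / P) - c| ≤ M / P := by
  have hP' : (0 : ℝ) < P := by exact_mod_cast hP
  have key : ∀ c : ℝ, 0 ≤ c → |M * (quant P M c / P) - M * (quant P M (-c) / P) - c| ≤ M / P := by
    intro c hc
    have h0 : quant P M (-c) = 0 := by simp [quant, max_eq_right (neg_nonpos.2 hc)]
    have h1 := Nat.floor_le (show (0 : ℝ) ≤ P * (c / M) by positivity)
    have h2 := Nat.lt_floor_add_one (P * (c / M))
    have hq : (quant P M c : ℝ) = ⌊P * (c / M)⌋₊ := by rw [quant, max_eq_left hc]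
    rw [h0, Nat.cast_zero, zero_div, mul_zero, sub_zero, hq, abs_le]
    set q : ℝ := (⌊P * (c / M)⌋₊ : ℝ)
    have e : c = M / P * (P * (c / M)) := by field_simp
    have e' : M * (q / P) = M / P * q := by ring
    have hMP : 0 < M / P := by positivity
    rw [e']
    constructor
    · have : M / P * (P * (c / M)) ≤ M / P * (q + 1) := by gcongr
      linarith
    · have : M / P * q ≤ M / P * (P * (c / M)) := by gcongr
      linarith
  rcases le_total 0 c with h | h
  · exact key c h
  · have := key (-c) (by linarith)
    rw [neg_neg] at this
    rw [← abs_neg]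
    convert this using 2
    ring

lemma abs_quant_le {P : ℕ} (hP : 0 < P) {M c : ℝ} (hM : 0 < M) (hc : |c| < M) :
    |M * (quant P M c / P) - M * (quant P M (-c) / P)| ≤ M := by
  have hP' : (0 : ℝ) < P := by exact_mod_cast hP
  have key : ∀ c : ℝ, |c| < M → M * (quant P M c / P) ≤ M := by
    intro c hc
    have : (quant P M c : ℝ) / P ≤ 1 := by
      rw [div_le_one hP']; exact_mod_cast (quant_lt hP hM hc).le
    nlinarith
  have h1 := key c hc
  have h2 := key (-c) (by rwa [abs_neg])
  have h3 : 0 ≤ M * (quant P M c / P : ℝ) := by positivity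
  have h4 : 0 ≤ M * (quant P M (-c) / P : ℝ) := by positivity
  rw [abs_le]
  constructor <;> linarith

lemma abs_pow_sub_pow_le_of_mem_unit {t T e : ℝ} (ht0 : 0 ≤ t) (ht1 : t ≤ 1) (hT0 : 0 ≤ T)
    (hT1 : T ≤ 1) (h : |t - T| ≤ e) (i : ℕ) : |t ^ i - T ^ i| ≤ i * e := by
  induction i with
  | zero => simp
  | succ i ih =>
    have e1 : t ^ (i + 1) - T ^ (i + 1) = t * (t ^ i - T ^ i) + (t - T) * T ^ i := by ring
    rw [e1]
    refine (abs_add_le _ _).trans ?_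
    rw [abs_mul, abs_mul, abs_of_nonneg ht0, abs_of_nonneg (pow_nonneg hT0 i)]
    have h1 : t * |t ^ i - T ^ i| ≤ 1 * (i * e) := by gcongr
    have h2 : |t - T| * T ^ i ≤ e * 1 := by
      gcongr
      · exact (abs_nonneg _).trans h
      · exact pow_le_one₀ hT0 hT1
    push_cast
    linarith

/-- Replacing the coefficient and the variables of a monomial by nearby values. -/
lemma abs_monomial_sub_le {c c' t u T U M e : ℝ} {n i j : ℕ} (ht0 : 0 ≤ t) (ht1 : t ≤ 1)
    (hu0 : 0 ≤ u) (hu1 : u ≤ 1) (hT0 : 0 ≤ T) (hT1 : T ≤ 1) (hU0 : 0 ≤ U) (hU1 : U ≤ 1)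
    (hM : 0 ≤ M) (ht : |t - T| ≤ e) (hu : |u - U| ≤ e) (hc : |c' - c| ≤ M * e) (hc' : |c| ≤ M)
    (hi : i ≤ n) (hj : j ≤ n) :
    |c' * (T ^ i * U ^ j) - c * (t ^ i * u ^ j)| ≤ (2 * n + 1) * M * e := by
  have he : 0 ≤ e := (abs_nonneg _).trans ht
  have h1 := abs_pow_sub_pow_le_of_mem_unit ht0 ht1 hT0 hT1 ht i
  have h2 := abs_pow_sub_pow_le_of_mem_unit hu0 hu1 hU0 hU1 hu j
  have hi' : (i : ℝ) * e ≤ n * e := by gcongr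
  have hj' : (j : ℝ) * e ≤ n * e := by gcongr
  have e1 : c' * (T ^ i * U ^ j) - c * (t ^ i * u ^ j) = (c' - c) * (T ^ i * U ^ j) +
      (-c) * ((t ^ i - T ^ i) * U ^ j + t ^ i * (u ^ j - U ^ j)) := by ring
  have b1 : |(c' - c) * (T ^ i * U ^ j)| ≤ M * e * 1 := by
    rw [abs_mul, abs_of_nonneg (by positivity : 0 ≤ T ^ i * U ^ j)]
    gcongr
    exact mul_le_one₀ (pow_le_one₀ hT0 hT1) (by positivity) (pow_le_one₀ hU0 hU1)
  have b2 : |(t ^ i - T ^ i) * U ^ j| ≤ (n * e) * 1 := by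
    rw [abs_mul, abs_of_nonneg (by positivity : 0 ≤ U ^ j)]
    gcongr
    · exact h1.trans hi'
    · exact pow_le_one₀ hU0 hU1
  have b3 : |t ^ i * (u ^ j - U ^ j)| ≤ 1 * (n * e) := by
    rw [abs_mul, abs_of_nonneg (by positivity : 0 ≤ t ^ i)]
    gcongr
    · exact pow_le_one₀ ht0 ht1
    · exact h2.trans hj'
  have b4 : |(-c) * ((t ^ i - T ^ i) * U ^ j + t ^ i * (u ^ j - U ^ j))| ≤
      M * ((n * e) * 1 + 1 * (n * e)) := by
    rw [abs_mul, abs_neg]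
    gcongr
    exact (abs_add_le _ _).trans (add_le_add b2 b3)
  rw [e1]
  refine (abs_add_le _ _).trans ((add_le_add b1 b4).trans (le_of_eq ?_))
  ring

namespace Computes

variable {X : Type*} {m : ℕ} {inp : Fin m → X → ℝ} {w ℓ : ℕ} {C : List (X → ℝ)}

/-- A polynomial in `T` and `U` whose coefficients depend on the indices `a, b, c, l`, computed
with coefficients rounded to the precision of `T` and `U`. -/
lemma polynomial {a b c l : X → ℕ} {N L n : ℕ} (Bs : List ℕ) {M : ℝ} (hM : 0 < M)
    (cf : ℕ → ℕ → ℕ → ℕ → ℕ × ℕ → ℝ) (hcf : ∀ i j q k τ, |cf i j q k τ| < M) {T U : X → ℝ}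
    {ZT ZU : X → ℕ} (hpos : ∀ b ∈ Bs, 0 < b) (hN : ∀ b ∈ Bs, b ≤ N)
    (ha : ∀ x, a x < N) (hb : ∀ x, b x < N) (hc : ∀ x, c x < L) (hl : ∀ x, l x < L)
    (haC : (fun x => (a x : ℝ)) ∈ C) (hbC : (fun x => (b x : ℝ)) ∈ C)
    (hcC : (fun x => (c x : ℝ)) ∈ C) (hlC : (fun x => (l x : ℝ)) ∈ C)
    (hZT : ∀ x, ZT x < Bs.prod) (hT : ∀ x, T x = ZT x / Bs.prod) (hTC : T ∈ C)
    (hZU : ∀ x, ZU x < Bs.prod) (hU : ∀ x, U x = ZU x / Bs.prod) (hUC : U ∈ C)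
    (hw : 2 * C.length + 5 * N + 12 ≤ w)
    (h : Computes inp w ℓ C) (S : Finset (ℕ × ℕ)) (hS : ∀ τ ∈ S, τ.1 ≤ n ∧ τ.2 ≤ n) :
    ∃ g : X → ℝ, Computes inp w (ℓ + 2 * (S.card * termDepth n L Bs.length)) [g] ∧
      (∀ x, |g x| ≤ S.card * M) ∧
      ∀ x t u, 0 ≤ t → t ≤ 1 → 0 ≤ u → u ≤ 1 → |t - T x| ≤ 1 / Bs.prod → |u - U x| ≤ 1 / Bs.prod →
        |g x - ∑ τ ∈ S, cf (a x) (b x) (c x) (l x) τ * (t ^ τ.1 * u ^ τ.2)| ≤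
          S.card * ((2 * n + 1) * M * (1 / Bs.prod)) := by
  have hP : 0 < Bs.prod := List.prod_pos hpos
  set P := Bs.prod with hPdef
  have hPR : (0 : ℝ) < P := by exact_mod_cast hP
  have hT0 : ∀ x, 0 ≤ T x := fun x => by rw [hT]; positivity
  have hT1 : ∀ x, T x ≤ 1 := fun x => by
    rw [hT, div_le_one hPR]; exact_mod_cast (hZT x).le
  have hU0 : ∀ x, 0 ≤ U x := fun x => by rw [hU]; positivity
  have hU1 : ∀ x, U x ≤ 1 := fun x => by
    rw [hU, div_le_one hPR]; exact_mod_cast (hZU x).le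
  have h0 : Computes inp w ℓ ((fun _ => 0) :: C) := h.aff fun f hf => by
    rcases List.mem_cons.1 hf with rfl | hf
    exacts [const_mem_affSpan _ _, mem_affSpan hf]
  have h1 := monomial_sum Bs (fun i j q k τ => quant P M (cf i j q k τ)) hpos hN
    (fun i j q k τ => quant_lt hP hM (hcf _ _ _ _ _)) ha hb hc hl haC hbC hcC hlC hZT hT hTC
    hZU hU hUC hw M h0 S hS
  have h2 := monomial_sum Bs (fun i j q k τ => quant P M (-cf i j q k τ)) hpos hN
    (fun i j q k τ => quant_lt hP hM (by rw [abs_neg]; exact hcf _ _ _ _ _)) ha hb hc hl haC hbC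
    hcC hlC hZT hT hTC hZU hU hUC hw (-M) h1 S hS
  set cq : X → ℕ × ℕ → ℝ := fun x τ => M * (quant P M (cf (a x) (b x) (c x) (l x) τ) / P) -
    M * (quant P M (-cf (a x) (b x) (c x) (l x) τ) / P) with hcq
  refine ⟨fun x => ∑ τ ∈ S, cq x τ * (T x ^ τ.1 * U x ^ τ.2), ?_, fun x => ?_, ?_⟩
  · rw [two_mul, ← add_assoc]
    refine h2.mono fun f hf => ?_
    rw [List.mem_singleton] at hf
    subst hf
    refine List.mem_cons.2 (Or.inl ?_)
    ext x
    simp only [hcq, sub_mul, Finset.sum_sub_distrib, Finset.mul_sum, ← hPdef]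
    simp only [neg_mul, Finset.sum_neg_distrib, mul_assoc]
    ring
  · refine (Finset.abs_sum_le_sum_abs _ _).trans ?_
    rw [← nsmul_eq_mul]
    refine Finset.sum_le_card_nsmul _ _ _ fun τ _ => ?_
    have h3 : 0 ≤ T x ^ τ.1 * U x ^ τ.2 :=
      mul_nonneg (pow_nonneg (hT0 x) _) (pow_nonneg (hU0 x) _)
    rw [abs_mul, abs_of_nonneg h3]
    have h4 : T x ^ τ.1 * U x ^ τ.2 ≤ 1 := mul_le_one₀ (pow_le_one₀ (hT0 x) (hT1 x))
      (pow_nonneg (hU0 x) _) (pow_le_one₀ (hU0 x) (hU1 x))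
    have h5 := abs_quant_le hP hM (hcf (a x) (b x) (c x) (l x) τ)
    calc _ ≤ M * 1 := by gcongr
      _ = M := mul_one M
  · intro x t u ht0 ht1 hu0 hu1 ht hu
    rw [← Finset.sum_sub_distrib]
    refine (Finset.abs_sum_le_sum_abs _ _).trans ?_
    rw [← nsmul_eq_mul]
    refine Finset.sum_le_card_nsmul _ _ _ fun τ hτ => ?_
    refine abs_monomial_sub_le ht0 ht1 hu0 hu1 (hT0 x) (hT1 x) (hU0 x) (hU1 x) hM.le ht hu ?_
      (hcf _ _ _ _ _).le (hS τ hτ).1 (hS τ hτ).2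
    rw [mul_one_div]
    exact abs_sub_quant_le hP hM

end Computes

/-- `x` lies in `[0, 1)` and, in the grid of mesh `1 / R`, in the left part of proportion `1 - δ`
of its cell. -/
def AvoidsGrid (R : ℕ) (δ x : ℝ) : Prop :=
  ∃ (Z : ℕ) (r : ℝ), Z < R ∧ 0 ≤ r ∧ r ≤ 1 - δ ∧ x = (Z + r) / R

/-- The function which on the `k`-th of the `K` subintervals of `[0, 1)` of equal length is the
polynomial with coefficients `cf k` in the local coordinate. -/
def piecewisePoly₁ (n K : ℕ) (cf : ℕ → ℕ → ℝ) (x : ℝ) : ℝ :=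
  ∑ i ∈ Finset.range (n + 1), cf ⌊K * x⌋₊ i * Int.fract (K * x) ^ i

/-- The function which on the cell `(a, b)` of the `K × K` grid on `[0, 1)²` is the polynomial, of
degree at most `n` in each variable, with coefficients `cf a b` in the local coordinates. -/
def piecewisePoly₂ (n K : ℕ) (cf : ℕ → ℕ → ℕ × ℕ → ℝ) (x y : ℝ) : ℝ :=
  ∑ τ ∈ Finset.range (n + 1) ×ˢ Finset.range (n + 1), cf ⌊K * x⌋₊ ⌊K * y⌋₊ τ *
    (Int.fract (K * x) ^ τ.1 * Int.fract (K * y) ^ τ.2)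

lemma floor_mul_of_eq {K P Z : ℕ} {r x : ℝ} (hK : 0 < K) (hP : 0 < P) (hr0 : 0 ≤ r) (hr1 : r < 1)
    (hx : x = (Z + r) / (K * P : ℕ)) :
    ⌊K * x⌋₊ = Z / P ∧ Int.fract (K * x) = ((Z % P : ℕ) + r) / P := by
  have hK' : (0 : ℝ) < K := by exact_mod_cast hK
  have hP' : (0 : ℝ) < P := by exact_mod_cast hP
  have hmod : (Z : ℝ) = P * (Z / P : ℕ) + (Z % P : ℕ) := by
    exact_mod_cast (Nat.div_add_mod Z P).symm
  have hlt : ((Z % P : ℕ) : ℝ) + 1 ≤ P := by exact_mod_cast Nat.mod_lt Z hP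
  have e : K * x = (Z / P : ℕ) + ((Z % P : ℕ) + r) / P := by
    rw [hx, Nat.cast_mul, hmod]
    field_simp
    ring
  have h0 : 0 ≤ ((Z % P : ℕ) + r) / P := by positivity
  have h1 : ((Z % P : ℕ) + r) / P < 1 := by rw [div_lt_one hP']; linarith
  have hf : ⌊K * x⌋₊ = Z / P := by
    rw [Nat.floor_eq_iff (by rw [e]; positivity), e]
    constructor <;> linarith
  refine ⟨hf, ?_⟩
  rw [e, Int.fract_natCast_add, Int.fract_eq_self.2 ⟨h0, h1⟩]

namespace Computes

variable {X : Type*} {m : ℕ} {inp : Fin m → X → ℝ} {w ℓ : ℕ} {C : List (X → ℝ)}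

/-- The form of `split` which can be iterated: it consumes one block of digits of `Z` and leaves
the rest in front of the list. -/
lemma peel {δ : ℝ} (hδ : 0 < δ) {N : ℕ} (Bs : List ℕ) (Q : ℕ) (hQ : 0 < Q) {r z : X → ℝ}
    {Z : X → ℕ} (hr0 : ∀ x, 0 ≤ r x) (hr1 : ∀ x, r x ≤ 1 - δ)
    (hpos : ∀ b ∈ Bs, 0 < b) (hN : ∀ b ∈ Bs, b ≤ N) (hw : 2 * (C.length + 4) + 2 * N ≤ w)
    (hz : ∀ x, z x = ((Z x % (Bs.prod * Q) : ℕ) + r x) / (Bs.prod * Q : ℕ))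
    (h : Computes inp w ℓ (z :: C)) :
    Computes inp w (ℓ + 2 * Bs.length)
      ((fun x => ((Z x % Q : ℕ) + r x) / Q) :: (fun x => ((Z x / Q % Bs.prod : ℕ) : ℝ)) :: C) := by
  have h1 := split hδ Bs Q hQ hr0 hr1 hw hpos hN
    (fun x => Nat.mod_lt _ (Nat.mul_pos (List.prod_pos hpos) hQ)) hz h
  simp only [Nat.mod_mul_left_div_self, Nat.mod_mul_left_mod] at h1
  refine h1.mono fun f hf => ?_
  simp only [List.mem_cons] at hf ⊢
  tauto

variable {δ : ℝ} {N l : ℕ} {Bs : List ℕ} {r z : X → ℝ} {Z : X → ℕ}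

/-- The cell of the grid with `N * 2 ^ l` cells which contains `z`, and the truncated local
coordinate. The index `Z / ∏ Bs` of the cell is given by its quotient and remainder modulo `2 ^ l`,
the form in which `lookup` reads it. -/
lemma cell (hδ : 0 < δ) (hN2 : 2 ≤ N) (hr0 : ∀ x, 0 ≤ r x) (hr1 : ∀ x, r x ≤ 1 - δ)
    (hpos : ∀ b ∈ Bs, 0 < b) (hN : ∀ b ∈ Bs, b ≤ N) (hw : 2 * (C.length + 6) + 2 * N ≤ w)
    (hZ : ∀ x, Z x < N * 2 ^ l * Bs.prod)
    (hz : ∀ x, z x = (Z x + r x) / (N * 2 ^ l * Bs.prod : ℕ)) (h : Computes inp w ℓ (z :: C)) :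
    Computes inp w (ℓ + 2 * (1 + l + Bs.length))
      ((fun x => ((Z x / Bs.prod / 2 ^ l : ℕ) : ℝ)) :: (fun x => ((Z x / Bs.prod % 2 ^ l : ℕ) : ℝ)) ::
        (fun x => ((Z x % Bs.prod : ℕ) : ℝ) / Bs.prod) :: C) := by
  have hP : 0 < Bs.prod := List.prod_pos hpos
  have h2l : 0 < 2 ^ l := by positivity
  have hdig : ∀ b ∈ List.replicate l 2, b = 2 := fun b hb => List.eq_of_mem_replicate hb
  have hpr : (List.replicate l 2).prod = 2 ^ l := by simp
  have h1 := peel hδ [N] (2 ^ l * Bs.prod) (by positivity) (N := N) (C := C) (Z := Z) hr0 hr1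
    (by simp; omega) (by simp) (by omega) (fun x => by
      rw [List.prod_singleton, ← mul_assoc, Nat.mod_eq_of_lt (hZ x)]; exact hz x) h
  have h2 := peel hδ (List.replicate l 2) Bs.prod hP (N := N) hr0 hr1
    (fun b hb => by rw [hdig b hb]; norm_num) (fun b hb => by rw [hdig b hb]; exact hN2)
    (by simp; omega) (fun x => by rw [hpr]) h1
  have h3 := peel hδ Bs 1 one_pos (N := N) hr0 hr1 hpos hN (by simp; omega)
    (fun x => by rw [mul_one]) h2
  have e : ℓ + 2 * (1 + l + Bs.length) = ℓ + 2 * [N].length + 2 * (List.replicate l 2).length +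
      2 * Bs.length := by simp; ring
  rw [e]
  refine h3.aff fun f hf => ?_
  have hZN : ∀ x, Z x / (2 ^ l * Bs.prod) % N = Z x / Bs.prod / 2 ^ l := fun x => by
    rw [Nat.div_div_eq_div_mul, mul_comm (Bs.prod), Nat.mod_eq_of_lt]
    rw [Nat.div_lt_iff_lt_mul (by positivity), ← mul_assoc]
    exact hZ x
  simp only [hpr, List.prod_singleton, hZN, Nat.div_one]
  simp only [List.mem_cons] at hf
  rcases hf with rfl | rfl | rfl | hf
  · exact mem_affSpan (by simp)
  · exact mem_affSpan (by simp)
  · have : (fun x => ((Z x % Bs.prod : ℕ) : ℝ) / Bs.prod) =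
        fun x => (Bs.prod : ℝ)⁻¹ * ((Z x % Bs.prod : ℕ) : ℝ) := by ext x; ring
    rw [this]
    exact affSpan_mul _ (mem_affSpan (by simp))
  · exact mem_affSpan (by simp [hf])

/-- The cell of the grid with `N ^ 2 * (2 ^ l) ^ 2` cells which contains `z`, and the truncated
local coordinate. -/
lemma cell_sq (hδ : 0 < δ) (hN2 : 2 ≤ N) (hr0 : ∀ x, 0 ≤ r x) (hr1 : ∀ x, r x ≤ 1 - δ)
    (hpos : ∀ b ∈ Bs, 0 < b) (hN : ∀ b ∈ Bs, b ≤ N) (hw : 2 * (C.length + 8) + 2 * N ≤ w)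
    (hZ : ∀ x, Z x < N * (N * (2 ^ l * (2 ^ l))) * Bs.prod)
    (hz : ∀ x, z x = (Z x + r x) / (N * (N * (2 ^ l * (2 ^ l))) * Bs.prod : ℕ))
    (h : Computes inp w ℓ (z :: C)) :
    Computes inp w (ℓ + 2 * (2 + 2 * l + Bs.length))
      ((fun x => ((Z x / Bs.prod / 2 ^ l / 2 ^ l / N : ℕ) : ℝ)) ::
        (fun x => ((Z x / Bs.prod / 2 ^ l / 2 ^ l % N : ℕ) : ℝ)) ::
        (fun x => ((Z x / Bs.prod / 2 ^ l % 2 ^ l : ℕ) : ℝ)) ::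
        (fun x => ((Z x / Bs.prod % 2 ^ l : ℕ) : ℝ)) ::
        (fun x => ((Z x % Bs.prod : ℕ) : ℝ) / Bs.prod) :: C) := by
  have hP : 0 < Bs.prod := List.prod_pos hpos
  have h2l : 0 < 2 ^ l := by positivity
  have hN0 : 0 < N := by omega
  have hdig : ∀ b ∈ List.replicate l 2, b = 2 := fun b hb => List.eq_of_mem_replicate hb
  have hpr : (List.replicate l 2).prod = 2 ^ l := by simp
  have h1 := peel hδ [N] (N * (2 ^ l * (2 ^ l * Bs.prod))) (by positivity) (N := N) (C := C)
    (Z := Z) hr0 hr1 (by simp; omega) (by simp) (by omega) (fun x => by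
      have e : N * (N * (2 ^ l * (2 ^ l * Bs.prod))) = N * (N * (2 ^ l * (2 ^ l))) * Bs.prod := by
        ring
      rw [List.prod_singleton, e, Nat.mod_eq_of_lt (hZ x)]
      exact hz x) h
  have h2 := peel hδ [N] (2 ^ l * (2 ^ l * Bs.prod)) (by positivity) (N := N) hr0 hr1
    (by simp; omega) (by simp) (by simp; omega) (fun x => by rw [List.prod_singleton]) h1
  have h3 := peel hδ (List.replicate l 2) (2 ^ l * Bs.prod) (by positivity) (N := N) hr0 hr1
    (fun b hb => by rw [hdig b hb]; norm_num) (fun b hb => by rw [hdig b hb]; exact hN2)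
    (by simp; omega) (fun x => by rw [hpr]) h2
  have h4 := peel hδ (List.replicate l 2) Bs.prod hP (N := N) hr0 hr1
    (fun b hb => by rw [hdig b hb]; norm_num) (fun b hb => by rw [hdig b hb]; exact hN2)
    (by simp; omega) (fun x => by rw [hpr]) h3
  have h5 := peel hδ Bs 1 one_pos (N := N) hr0 hr1 hpos hN (by simp; omega)
    (fun x => by rw [mul_one]) h4
  have e : ℓ + 2 * (2 + 2 * l + Bs.length) = ℓ + 2 * [N].length + 2 * [N].length +
      2 * (List.replicate l 2).length + 2 * (List.replicate l 2).length + 2 * Bs.length := by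
    simp; ring
  rw [e]
  refine h5.aff fun f hf => ?_
  have hZ1 : ∀ x, Z x / (N * (2 ^ l * (2 ^ l * Bs.prod))) % N =
      Z x / Bs.prod / 2 ^ l / 2 ^ l / N := fun x => by
    rw [Nat.mod_eq_of_lt]
    · simp only [Nat.div_div_eq_div_mul]
      congr 1
      ring
    · rw [Nat.div_lt_iff_lt_mul (by positivity)]
      refine (hZ x).trans_eq (by ring)
  have hZ2 : ∀ x, Z x / (2 ^ l * (2 ^ l * Bs.prod)) = Z x / Bs.prod / 2 ^ l / 2 ^ l := fun x => by
    simp only [Nat.div_div_eq_div_mul]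
    congr 1
    ring
  have hZ3 : ∀ x, Z x / (2 ^ l * Bs.prod) = Z x / Bs.prod / 2 ^ l := fun x => by
    simp only [Nat.div_div_eq_div_mul]
    congr 1
    ring
  simp only [hpr, List.prod_singleton, hZ1, hZ2, hZ3, Nat.div_one]
  simp only [List.mem_cons] at hf
  rcases hf with rfl | rfl | rfl | rfl | rfl | hf
  · exact mem_affSpan (by simp)
  · exact mem_affSpan (by simp)
  · exact mem_affSpan (by simp)
  · exact mem_affSpan (by simp)
  · have : (fun x => ((Z x % Bs.prod : ℕ) : ℝ) / Bs.prod) =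
        fun x => (Bs.prod : ℝ)⁻¹ * ((Z x % Bs.prod : ℕ) : ℝ) := by ext x; ring
    rw [this]
    exact affSpan_mul _ (mem_affSpan (by simp))
  · exact mem_affSpan (by simp [hf])

end Computes

/-- The constant in the bounds on width and depth of networks for piecewise polynomials of degree
`n` with precision `(N * 2 ^ l) ^ (-s)`: it counts the layers, and its last summand leaves room
for the neurons which hold intermediate results. -/
def netConst (n s : ℕ) : ℕ := 4 * (1 + s) + 2 * ((n + 1) ^ 2 * (7 + 2 * s + 4 * (n * s))) + 41

lemma termDepth_le (n s l : ℕ) :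
    termDepth n (2 ^ l) (s + s * l) ≤ (7 + 2 * s + 4 * (n * s)) * (2 ^ l * (l + 1)) := by
  have h1 : 1 ≤ 2 ^ l := Nat.one_le_two_pow
  have h2 : l + 1 ≤ 2 ^ l * (l + 1) := Nat.le_mul_of_pos_left _ (by positivity)
  have h3 : 2 ^ l ≤ 2 ^ l * (l + 1) := Nat.le_mul_of_pos_right _ (by positivity)
  have e : termDepth n (2 ^ l) (s + s * l) =
      2 + 5 * 2 ^ l + 2 * s * (2 ^ l * (l + 1)) + 4 * (n * s) * (l + 1) := by
    unfold termDepth; ring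
  rw [e]
  have h4 : 4 * (n * s) * (l + 1) ≤ 4 * (n * s) * (2 ^ l * (l + 1)) := Nat.mul_le_mul_left _ h2
  have e2 : (7 + 2 * s + 4 * (n * s)) * (2 ^ l * (l + 1)) = 7 * (2 ^ l * (l + 1)) +
    2 * s * (2 ^ l * (l + 1)) + 4 * (n * s) * (2 ^ l * (l + 1)) := by ring
  rw [e2]
  omega

lemma depth_bound (n s l k : ℕ) (hk : k ≤ (n + 1) ^ 2) :
    4 * (1 + l + (s + s * l)) + 2 * (k * termDepth n (2 ^ l) (s + s * l)) + 1 ≤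
      netConst n s * (2 ^ l * (l + 1)) := by
  have h2 : l + 1 ≤ 2 ^ l * (l + 1) := Nat.le_mul_of_pos_left _ (by positivity)
  have h3 := Nat.mul_le_mul hk (termDepth_le n s l)
  have h4 : 4 * (1 + l + (s + s * l)) ≤ 4 * (1 + s) * (2 ^ l * (l + 1)) := by
    calc 4 * (1 + l + (s + s * l)) = 4 * (1 + s) * (l + 1) := by ring
      _ ≤ _ := Nat.mul_le_mul_left _ h2
  have e : netConst n s * (2 ^ l * (l + 1)) = 4 * (1 + s) * (2 ^ l * (l + 1)) +
      2 * ((n + 1) ^ 2 * ((7 + 2 * s + 4 * (n * s)) * (2 ^ l * (l + 1)))) +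
      41 * (2 ^ l * (l + 1)) := by unfold netConst; ring
  rw [e]
  omega

/-- The bases for the digits of the local coordinates. -/
def coordBases (N l s : ℕ) : List ℕ := List.replicate s N ++ List.replicate (s * l) 2

lemma coordBases_prod (N l s : ℕ) : (coordBases N l s).prod = (N * 2 ^ l) ^ s := by
  simp [coordBases, mul_pow, ← pow_mul, mul_comm]

lemma coordBases_length (N l s : ℕ) : (coordBases N l s).length = s + s * l := by
  simp [coordBases]

lemma coordBases_bounds {N l s : ℕ} (hN : 2 ≤ N) : ∀ b ∈ coordBases N l s, 0 < b ∧ b ≤ N := by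
  intro b hb
  simp only [coordBases, List.mem_append, List.mem_replicate] at hb
  omega

/-- Rounding the local coordinate changes it by at most `1 / P`. -/
lemma local_coord_bounds {P Z : ℕ} {r : ℝ} (hP : 0 < P) (hr0 : 0 ≤ r) (hr1 : r ≤ 1) :
    0 ≤ ((Z % P : ℕ) + r) / P ∧ ((Z % P : ℕ) + r) / P ≤ 1 ∧
      |((Z % P : ℕ) + r) / P - (Z % P : ℕ) / P| ≤ 1 / P := by
  have hP' : (0 : ℝ) < P := by exact_mod_cast hP
  have hlt : ((Z % P : ℕ) : ℝ) + 1 ≤ P := by exact_mod_cast Nat.mod_lt Z hP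
  refine ⟨by positivity, ?_, ?_⟩
  · rw [div_le_one hP']; linarith
  · rw [← sub_div, add_sub_cancel_left, abs_of_nonneg (by positivity)]
    gcongr

/-- A network computes a piecewise polynomial on `(N * 2 ^ l) ^ 2` cells with precision
`(N * 2 ^ l) ^ (-s)`, except close to the grid, where it merely is bounded. Its depth depends only
on `n`, `s` and `l`, so that such networks can be run side by side. -/
theorem exists_net_piecewisePoly₁ (n s N l : ℕ) (hN : 2 ≤ N) {M δ : ℝ} (hM : 0 < M) (hδ : 0 < δ)
    (cf : ℕ → ℕ → ℝ) (hcf : ∀ k i, |cf k i| < M) :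
    ∃ net : ReLUNet 1 1, net.width ≤ netConst n s * N ∧
      net.depth = netConst n s * (2 ^ l * (l + 1)) ∧
      (∀ z, |net.eval z 0| ≤ (n + 1) ^ 2 * M) ∧
      ∀ x, AvoidsGrid ((N * 2 ^ l) ^ 2 * (N * 2 ^ l) ^ s) δ x →
        |net.eval ![x] 0 - piecewisePoly₁ n ((N * 2 ^ l) ^ 2) cf x| ≤
          (n + 1) ^ 2 * ((2 * n + 1) * M * (1 / ((N * 2 ^ l : ℕ) : ℝ) ^ s)) := by
  set Bs := coordBases N l s with hBs
  have hprod : Bs.prod = (N * 2 ^ l) ^ s := coordBases_prod N l s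
  have hlen : Bs.length = s + s * l := coordBases_length N l s
  have hpos : ∀ b ∈ Bs, 0 < b := fun b hb => (coordBases_bounds hN b hb).1
  have hle : ∀ b ∈ Bs, b ≤ N := fun b hb => (coordBases_bounds hN b hb).2
  have hP : 0 < Bs.prod := List.prod_pos hpos
  have hprodR : (Bs.prod : ℝ) = ((N * 2 ^ l : ℕ) : ℝ) ^ s := by rw [hprod, Nat.cast_pow]
  set P := Bs.prod with hPdef
  have hK : (N * 2 ^ l) ^ 2 = N * (N * (2 ^ l * 2 ^ l)) := by ring
  have hK0 : 0 < (N * 2 ^ l) ^ 2 := by positivity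
  rw [← hprod]
  set K := (N * 2 ^ l) ^ 2 with hKdef
  -- the network is only controlled on the inputs that avoid the grid
  let X := {x : ℝ // AvoidsGrid (K * P) δ x}
  choose Z r hZ hr0 hr1 hx using fun x : X => x.2
  have hr1' : ∀ x, r x < 1 := fun x => by have := hr1 x; linarith
  set w := netConst n s * N with hw
  have hw' : 41 * N ≤ w := Nat.mul_le_mul_right _ (by unfold netConst; omega)
  let inp : Fin 1 → X → ℝ := fun _ x => x
  have h0 : Computes inp w 0 [fun x : X => (x : ℝ)] := Computes.base (by
    intro f hf
    rw [List.mem_singleton] at hf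
    subst hf
    exact mem_affSpan (by simp [inp]))
  have h1 := Computes.cell_sq (C := []) (Bs := Bs) (l := l) (N := N) hδ hN hr0 hr1 hpos hle
    (by simp; omega) (fun x => by rw [← hK]; exact hZ x) (fun x => by rw [← hK]; exact hx x) h0
  have h2 : Computes inp w (0 + 2 * (2 + 2 * l + Bs.length)) ((fun _ => 0) :: _) :=
    h1.aff (D := (fun _ => 0) :: _) (fun f hf => by
      rcases List.mem_cons.1 hf with rfl | hf
      exacts [const_mem_affSpan _ _, mem_affSpan hf])
  -- there is no second variable: it is set to `0` and only occurs with exponent `0`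
  set S : Finset (ℕ × ℕ) := Finset.range (n + 1) ×ˢ {0} with hS
  have hScard : S.card = n + 1 := by simp [hS]
  have hcard : S.card ≤ (n + 1) ^ 2 := by
    rw [hScard]; exact Nat.le_self_pow (by norm_num) _
  obtain ⟨g, hg, hgM, hgerr⟩ := Computes.polynomial (n := n) (N := N) (L := 2 ^ l)
    (a := fun x => Z x / Bs.prod / 2 ^ l / 2 ^ l / N)
    (b := fun x => Z x / Bs.prod / 2 ^ l / 2 ^ l % N)
    (c := fun x => Z x / Bs.prod / 2 ^ l % 2 ^ l) (l := fun x => Z x / Bs.prod % 2 ^ l)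
    Bs hM (fun a b c d τ => cf (((a * N + b) * 2 ^ l + c) * 2 ^ l + d) τ.1)
    (fun _ _ _ _ _ => hcf _ _) (ZT := fun x => Z x % Bs.prod) (ZU := fun _ => 0)
    (T := fun x => ((Z x % Bs.prod : ℕ) : ℝ) / Bs.prod) (U := fun _ => 0) hpos hle
    (fun x => by
      simp only [Nat.div_div_eq_div_mul]
      rw [Nat.div_lt_iff_lt_mul (by positivity)]
      refine (hZ x).trans_eq ?_
      rw [hK]; ring)
    (fun x => Nat.mod_lt _ (by omega)) (fun x => Nat.mod_lt _ (by positivity))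
    (fun x => Nat.mod_lt _ (by positivity)) (by simp) (by simp) (by simp) (by simp)
    (fun x => Nat.mod_lt _ hP) (fun x => rfl) (by simp) (fun _ => hP) (fun _ => by simp)
    (by simp) (by simp; omega) h2 S (fun τ hτ => by
      simp only [hS, Finset.mem_product, Finset.mem_range, Finset.mem_singleton] at hτ
      omega)
  have hdep := depth_bound n s l S.card hcard
  rw [← hlen] at hdep
  have hdep' : 4 * (1 + l + Bs.length) = 2 * (2 + 2 * l + Bs.length) + 2 * Bs.length := by ring
  obtain ⟨k, hk⟩ := Nat.exists_eq_add_of_le (show 0 + 2 * (2 + 2 * l + Bs.length) +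
    2 * (S.card * termDepth n (2 ^ l) Bs.length) + 1 ≤ netConst n s * (2 ^ l * (l + 1)) by omega)
  -- `k` more layers bring the depth to the prescribed value; one more is used for clipping
  obtain ⟨net, hn1, hn2, hn3⟩ := (hg.pad (by simp; omega) k).exists_net
  obtain ⟨net', hn1', hn2', hn3', hn4'⟩ := net.exists_clip (B := (n + 1) ^ 2 * M) (by positivity)
  refine ⟨net', ?_, ?_, hn3', fun x hx' => ?_⟩
  · refine hn2'.trans (max_le hn1 (by omega))
  · omega
  · have hev := hn3 ⟨x, hx'⟩
    have hinp : (fun i => inp i ⟨x, hx'⟩) = ![x] := by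
      ext i; fin_cases i; rfl
    rw [hinp] at hev
    have hcR : (S.card : ℝ) ≤ (n + 1) ^ 2 := by exact_mod_cast hcard
    rw [hn4' _ (by
      rw [hev]
      refine (hgM _).trans ?_
      gcongr), hev]
    obtain ⟨hf1, hf2⟩ := floor_mul_of_eq (x := x) hK0 hP (hr0 ⟨x, hx'⟩) (hr1' ⟨x, hx'⟩) (hx ⟨x, hx'⟩)
    obtain ⟨b1, b2, b3⟩ := local_coord_bounds (Z := Z ⟨x, hx'⟩) hP (hr0 ⟨x, hx'⟩) (hr1' ⟨x, hx'⟩).le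
    have herr := hgerr ⟨x, hx'⟩ _ 0 b1 b2 le_rfl zero_le_one b3
      (by rw [sub_zero, abs_zero]; positivity)
    have hpp : piecewisePoly₁ n K cf x = ∑ τ ∈ S, cf (Z ⟨x, hx'⟩ / P) τ.1 *
        ((((Z ⟨x, hx'⟩ % P : ℕ) + r ⟨x, hx'⟩) / P) ^ τ.1 * (0 : ℝ) ^ τ.2) := by
      rw [piecewisePoly₁, hS, Finset.sum_product, hf2, hf1]
      simp
    simp only [Nat.div_add_mod'] at herr
    rw [hpp]
    refine herr.trans ?_
    rw [hprodR]
    gcongr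

/-- A network computes a piecewise polynomial with `N * 2 ^ l` cells per axis with precision
`(N * 2 ^ l) ^ (-s)`, except close to the grid, where it merely is bounded. -/
theorem exists_net_piecewisePoly₂ (n s N l : ℕ) (hN : 2 ≤ N) {M δ : ℝ} (hM : 0 < M) (hδ : 0 < δ)
    (cf : ℕ → ℕ → ℕ × ℕ → ℝ) (hcf : ∀ a b τ, |cf a b τ| < M) :
    ∃ net : ReLUNet 1 2, net.width ≤ netConst n s * N ∧
      net.depth = netConst n s * (2 ^ l * (l + 1)) ∧
      (∀ z, |net.eval z 0| ≤ (n + 1) ^ 2 * M) ∧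
      ∀ x y, AvoidsGrid (N * 2 ^ l * (N * 2 ^ l) ^ s) δ x →
        AvoidsGrid (N * 2 ^ l * (N * 2 ^ l) ^ s) δ y →
        |net.eval ![x, y] 0 - piecewisePoly₂ n (N * 2 ^ l) cf x y| ≤
          (n + 1) ^ 2 * ((2 * n + 1) * M * (1 / ((N * 2 ^ l : ℕ) : ℝ) ^ s)) := by
  set Bs := coordBases N l s with hBs
  have hprod : Bs.prod = (N * 2 ^ l) ^ s := coordBases_prod N l s
  have hlen : Bs.length = s + s * l := coordBases_length N l s
  have hpos : ∀ b ∈ Bs, 0 < b := fun b hb => (coordBases_bounds hN b hb).1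
  have hle : ∀ b ∈ Bs, b ≤ N := fun b hb => (coordBases_bounds hN b hb).2
  have hP : 0 < Bs.prod := List.prod_pos hpos
  have hprodR : (Bs.prod : ℝ) = ((N * 2 ^ l : ℕ) : ℝ) ^ s := by rw [hprod, Nat.cast_pow]
  set P := Bs.prod with hPdef
  have hK0 : 0 < N * 2 ^ l := by positivity
  rw [← hprod]
  -- the network is only controlled on the inputs that avoid the grid
  let X := {x : ℝ // AvoidsGrid (N * 2 ^ l * P) δ x} × {x : ℝ // AvoidsGrid (N * 2 ^ l * P) δ x}
  choose Z r hZ hr0 hr1 hx using fun x : {x : ℝ // AvoidsGrid (N * 2 ^ l * P) δ x} => x.2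
  have hr1' : ∀ x, r x < 1 := fun x => by have := hr1 x; linarith
  set w := netConst n s * N with hw
  have hw' : 41 * N ≤ w := Nat.mul_le_mul_right _ (by unfold netConst; omega)
  let inp : Fin 2 → X → ℝ := fun i x => ![(x.1 : ℝ), (x.2 : ℝ)] i
  have h0 : Computes inp w 0 [fun x : X => (x.1 : ℝ), fun x : X => (x.2 : ℝ)] :=
    Computes.base (by
      intro f hf
      simp only [List.mem_cons, List.not_mem_nil, or_false] at hf
      rcases hf with rfl | rfl
      · exact mem_affSpan (List.mem_ofFn.2 ⟨0, rfl⟩)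
      · exact mem_affSpan (List.mem_ofFn.2 ⟨1, rfl⟩))
  have h1 := Computes.cell (Bs := Bs) (l := l) (N := N) (Z := fun x : X => Z x.1)
    (r := fun x : X => r x.1) hδ hN (fun x => hr0 x.1) (fun x => hr1 x.1) hpos hle
    (by simp; omega) (fun x => hZ x.1) (fun x => hx x.1) h0
  have h1' := h1.mono (D := (fun x : X => (x.2 : ℝ)) :: _) (by
    intro f hf
    rcases List.mem_cons.1 hf with rfl | hf
    · simp
    · exact hf)
  have h2 := Computes.cell (Bs := Bs) (l := l) (N := N) (Z := fun x : X => Z x.2)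
    (r := fun x : X => r x.2) hδ hN (fun x => hr0 x.2) (fun x => hr1 x.2) hpos hle
    (by simp; omega) (fun x => hZ x.2) (fun x => hx x.2) h1'
  set S : Finset (ℕ × ℕ) := Finset.range (n + 1) ×ˢ Finset.range (n + 1) with hS
  have hcard : S.card = (n + 1) ^ 2 := by simp [hS, sq]
  have hZN : ∀ x, Z x / Bs.prod / 2 ^ l < N := fun x => by
    rw [Nat.div_div_eq_div_mul, Nat.div_lt_iff_lt_mul (by positivity)]
    refine (hZ x).trans_eq ?_
    ring
  obtain ⟨g, hg, hgM, hgerr⟩ := Computes.polynomial (n := n) (N := N) (L := 2 ^ l)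
    (a := fun x : X => Z x.1 / Bs.prod / 2 ^ l) (b := fun x : X => Z x.2 / Bs.prod / 2 ^ l)
    (c := fun x : X => Z x.1 / Bs.prod % 2 ^ l) (l := fun x : X => Z x.2 / Bs.prod % 2 ^ l)
    Bs hM (fun a b c d τ => cf (a * 2 ^ l + c) (b * 2 ^ l + d) τ)
    (fun _ _ _ _ _ => hcf _ _ _) (ZT := fun x : X => Z x.1 % Bs.prod)
    (ZU := fun x : X => Z x.2 % Bs.prod)
    (T := fun x : X => ((Z x.1 % Bs.prod : ℕ) : ℝ) / Bs.prod)
    (U := fun x : X => ((Z x.2 % Bs.prod : ℕ) : ℝ) / Bs.prod) hpos hle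
    (fun x => hZN x.1) (fun x => hZN x.2) (fun x => Nat.mod_lt _ (by positivity))
    (fun x => Nat.mod_lt _ (by positivity)) (by simp) (by simp) (by simp) (by simp)
    (fun x => Nat.mod_lt _ hP) (fun x => rfl) (by simp) (fun x => Nat.mod_lt _ hP)
    (fun x => rfl) (by simp) (by simp; omega) h2 S (fun τ hτ => by
      simp only [hS, Finset.mem_product, Finset.mem_range] at hτ
      omega)
  have hdep := depth_bound n s l S.card hcard.le
  rw [← hlen] at hdep
  obtain ⟨k, hk⟩ := Nat.exists_eq_add_of_le (show 0 + 2 * (1 + l + Bs.length) +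
    2 * (1 + l + Bs.length) +
    2 * (S.card * termDepth n (2 ^ l) Bs.length) + 1 ≤ netConst n s * (2 ^ l * (l + 1)) by omega)
  -- `k` more layers bring the depth to the prescribed value; one more is used for clipping
  obtain ⟨net, hn1, hn2, hn3⟩ := (hg.pad (by simp; omega) k).exists_net
  obtain ⟨net', hn1', hn2', hn3', hn4'⟩ := net.exists_clip (B := (n + 1) ^ 2 * M) (by positivity)
  have hcR : (S.card : ℝ) = (n + 1) ^ 2 := by rw [hcard]; push_cast; rfl
  refine ⟨net', ?_, ?_, hn3', fun x y hx' hy' => ?_⟩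
  · refine hn2'.trans (max_le hn1 (by omega))
  · omega
  · have hev := hn3 (⟨x, hx'⟩, ⟨y, hy'⟩)
    have hinp : (fun i => inp i (⟨x, hx'⟩, ⟨y, hy'⟩)) = ![x, y] := by
      ext i; fin_cases i <;> rfl
    rw [hinp] at hev
    rw [hn4' _ (by rw [hev, ← hcR]; exact hgM _), hev]
    obtain ⟨hf1, hf2⟩ := floor_mul_of_eq (x := x) hK0 hP (hr0 ⟨x, hx'⟩) (hr1' ⟨x, hx'⟩) (hx ⟨x, hx'⟩)
    obtain ⟨hg1, hg2⟩ := floor_mul_of_eq (x := y) hK0 hP (hr0 ⟨y, hy'⟩) (hr1' ⟨y, hy'⟩) (hx ⟨y, hy'⟩)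
    obtain ⟨b1, b2, b3⟩ := local_coord_bounds (Z := Z ⟨x, hx'⟩) hP (hr0 ⟨x, hx'⟩) (hr1' ⟨x, hx'⟩).le
    obtain ⟨b4, b5, b6⟩ := local_coord_bounds (Z := Z ⟨y, hy'⟩) hP (hr0 ⟨y, hy'⟩) (hr1' ⟨y, hy'⟩).le
    have herr := hgerr (⟨x, hx'⟩, ⟨y, hy'⟩) _ _ b1 b2 b4 b5 b3 b6
    have hpp : piecewisePoly₂ n (N * 2 ^ l) cf x y = ∑ τ ∈ S,
        cf (Z ⟨x, hx'⟩ / P) (Z ⟨y, hy'⟩ / P) τ *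
        ((((Z ⟨x, hx'⟩ % P : ℕ) + r ⟨x, hx'⟩) / P) ^ τ.1 *
        (((Z ⟨y, hy'⟩ % P : ℕ) + r ⟨y, hy'⟩) / P) ^ τ.2) := by
      rw [piecewisePoly₂, hf2, hg2, hf1, hg1]
    simp only [Nat.div_add_mod'] at herr
    rw [hpp]
    refine herr.trans ?_
    rw [hprodR, hcR]

/-! ### Local polynomial approximation of Hölder smooth functions -/

/-- Taylor's formula for a function given with its chain of derivatives `a 0, a 1, …, a k`, the
last of which oscillates by at most `M`. -/
lemma abs_sub_taylor_le {M : ℝ} (k : ℕ) : ∀ (a : ℕ → ℝ → ℝ),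
    (∀ m < k, ∀ t ∈ Set.Icc (0 : ℝ) 1, HasDerivWithinAt (a m) (a (m + 1) t) (Set.Icc 0 1) t) →
    (∀ t ∈ Set.Icc (0 : ℝ) 1, |a k t - a k 0| ≤ M) → ∀ t ∈ Set.Icc (0 : ℝ) 1,
      |a 0 t - ∑ m ∈ Finset.range (k + 1), a m 0 * (t ^ m / m.factorial)| ≤ M := by
  induction k with
  | zero =>
    intro a _ h t ht
    simpa using h t ht
  | succ k ih =>
    intro a hd h t ht
    have hM : 0 ≤ M := (abs_nonneg _).trans (h t ht)
    have h1 := ih (fun m => a (m + 1)) (fun m hm => hd (m + 1) (by omega)) h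
    set F : ℝ → ℝ := fun t => a 0 t - ∑ m ∈ Finset.range (k + 1 + 1), a m 0 * (t ^ m / m.factorial)
      with hF
    have hF' : ∀ t ∈ Set.Icc (0 : ℝ) 1, HasDerivWithinAt F
        (a 1 t - ∑ m ∈ Finset.range (k + 1), a (m + 1) 0 * (t ^ m / m.factorial))
        (Set.Icc 0 1) t := by
      intro t ht
      refine (hd 0 (by omega) t ht).sub ?_
      simp only [Finset.sum_range_succ' _ (k + 1)]
      have h2 : HasDerivWithinAt (fun t : ℝ => ∑ m ∈ Finset.range (k + 1),
          a (m + 1) 0 * (t ^ (m + 1) / (m + 1).factorial))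
          (∑ m ∈ Finset.range (k + 1), a (m + 1) 0 * (t ^ m / m.factorial)) (Set.Icc 0 1) t := by
        refine HasDerivWithinAt.fun_sum fun m _ => ?_
        refine HasDerivWithinAt.const_mul _ ?_
        have h3 := ((hasDerivWithinAt_pow (s := Set.Icc (0 : ℝ) 1) (m + 1) t).div_const
          ((m + 1).factorial : ℝ))
        convert h3 using 1
        rw [Nat.factorial_succ]
        have : (m.factorial : ℝ) ≠ 0 := by exact_mod_cast m.factorial_ne_zero
        push_cast
        field_simp
      simpa only [pow_zero] using h2.add_const (a 0 0 * (1 / (Nat.factorial 0 : ℕ)))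
    have h0 : F 0 = 0 := by
      simp [hF, Finset.sum_range_succ' _ (k + 1)]
    have := (convex_Icc (0 : ℝ) 1).norm_image_sub_le_of_norm_hasDerivWithin_le (f := F)
      (C := M) hF' (fun t ht => by rw [Real.norm_eq_abs]; exact h1 t ht)
      (x := 0) (y := t) (by simp) ht
    rw [h0, sub_zero, sub_zero, Real.norm_eq_abs, Real.norm_eq_abs, abs_of_nonneg ht.1] at this
    refine this.trans ?_
    nlinarith [ht.2]

/-- The Taylor polynomial of a Hölder smooth function on a convex set. -/
lemma HolderSmoothOn.abs_sub_taylor_le {E : Type*} [NormedAddCommGroup E] [NormedSpace ℝ E]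
    {β H : ℝ} {f : E → ℝ} {s : Set E} (hf : HolderSmoothOn β H f s) (hβ : 0 < β)
    (hs : Convex ℝ s) {x₀ x : E} (hx₀ : x₀ ∈ s) (hx : x ∈ s) :
    |f x - ∑ m ∈ Finset.range (⌊β⌋₊ + 1),
      iteratedFDerivWithin ℝ m f s x₀ (fun _ => x - x₀) * (m.factorial : ℝ)⁻¹| ≤
      |H| * ‖x - x₀‖ ^ β := by
  set v := x - x₀ with hv
  set k := ⌊β⌋₊ with hk
  have hline : ∀ t ∈ Set.Icc (0 : ℝ) 1, x₀ + t • v ∈ s := fun t ht =>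
    hs.add_smul_sub_mem hx₀ hx ht
  set a : ℕ → ℝ → ℝ := fun m t => iteratedFDerivWithin ℝ m f s (x₀ + t • v) (fun _ => v) with ha
  have hkβ : (k : ℝ) ≤ β := Nat.floor_le hβ.le
  have key := _root_.abs_sub_taylor_le (M := |H| * ‖v‖ ^ β) k a ?_ ?_ 1 (by simp)
  · simpa [ha, hv, div_eq_mul_inv] using key
  · intro m hm t ht
    have h1 := ((hf.1 m hm) _ (hline t ht)).hasFDerivWithinAt
    have h2 : HasDerivWithinAt (fun t : ℝ => x₀ + t • v) v (Set.Icc 0 1) t := by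
      simpa using ((hasDerivWithinAt_id t (Set.Icc (0 : ℝ) 1)).smul_const v).const_add x₀
    have h3 := h1.comp_hasDerivWithinAt t h2 (fun t ht => hline t ht)
    have h4 := ((ContinuousMultilinearMap.apply ℝ (fun _ : Fin m => E) ℝ
      (fun _ => v)).hasFDerivAt.comp_hasDerivWithinAt t h3)
    simp only [ha]
    rw [iteratedFDerivWithin_succ_apply_left]
    exact h4
  · intro t ht
    have h1 := hf.2 _ (hline t ht) _ (hline 0 (by simp))
    have h2 : |a k t - a k 0| ≤ ‖iteratedFDerivWithin ℝ k f s (x₀ + t • v) -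
        iteratedFDerivWithin ℝ k f s (x₀ + (0 : ℝ) • v)‖ * ‖v‖ ^ k := by
      have := (iteratedFDerivWithin ℝ k f s (x₀ + t • v) -
        iteratedFDerivWithin ℝ k f s (x₀ + (0 : ℝ) • v)).le_opNorm (fun _ => v)
      simpa [ha] using this
    have h3 : ‖x₀ + t • v - (x₀ + (0 : ℝ) • v)‖ ≤ ‖v‖ := by
      rw [zero_smul, add_zero, add_sub_cancel_left, norm_smul, Real.norm_eq_abs,
        abs_of_nonneg ht.1]
      exact mul_le_of_le_one_left (norm_nonneg _) ht.2
    have h4 : 0 ≤ β - k := by linarith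
    calc |a k t - a k 0| ≤ (H * ‖x₀ + t • v - (x₀ + (0 : ℝ) • v)‖ ^ (β - k)) * ‖v‖ ^ k := by
          refine h2.trans ?_
          gcongr
      _ ≤ (|H| * ‖v‖ ^ (β - k)) * ‖v‖ ^ k := by
          gcongr
          exact le_abs_self H
      _ = |H| * ‖v‖ ^ β := by
          rw [mul_assoc, ← Real.rpow_natCast, ← Real.rpow_add_of_nonneg (norm_nonneg _) h4
            (Nat.cast_nonneg _)]
          congr 2
          ring

/-- Polynomial functions of two variables, of degree at most `n` in each. -/
def IsPolyFun (n : ℕ) (F : ℝ → ℝ → ℝ) : Prop :=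
  ∃ c : ℕ × ℕ → ℝ, ∀ t u, F t u = ∑ τ ∈ Finset.range (n + 1) ×ˢ Finset.range (n + 1),
    c τ * (t ^ τ.1 * u ^ τ.2)

namespace IsPolyFun

variable {n : ℕ}

lemma monomial {i j : ℕ} (hi : i ≤ n) (hj : j ≤ n) (b : ℝ) :
    IsPolyFun n fun t u => b * (t ^ i * u ^ j) := by
  refine ⟨fun τ => if τ = (i, j) then b else 0, fun t u => ?_⟩
  rw [Finset.sum_eq_single (i, j)]
  · simp
  · intro τ _ hτ
    simp [hτ]
  · intro h
    exact absurd (by simp; omega) h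

lemma mul_const {F : ℝ → ℝ → ℝ} (hF : IsPolyFun n F) (b : ℝ) :
    IsPolyFun n fun t u => F t u * b := by
  obtain ⟨c, hc⟩ := hF
  refine ⟨fun τ => c τ * b, fun t u => ?_⟩
  dsimp only
  rw [hc, Finset.sum_mul]
  exact Finset.sum_congr rfl fun _ _ => by ring

lemma sum {ι : Type*} {s : Finset ι} {F : ι → ℝ → ℝ → ℝ} (hF : ∀ i ∈ s, IsPolyFun n (F i)) :
    IsPolyFun n fun t u => ∑ i ∈ s, F i t u := by
  choose! c hc using hF
  refine ⟨fun τ => ∑ i ∈ s, c i τ, fun t u => ?_⟩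
  dsimp only
  rw [Finset.sum_congr rfl fun i hi => hc i hi t u, Finset.sum_comm]
  exact Finset.sum_congr rfl fun _ _ => by rw [Finset.sum_mul]

/-- A multilinear form on the diagonal of a plane is polynomial in the coordinates of the plane. -/
lemma multilinear {E : Type*} [NormedAddCommGroup E] [NormedSpace ℝ E] {m : ℕ} (hm : m ≤ n)
    (D : E [×m]→L[ℝ] ℝ) (e₁ e₂ : E) : IsPolyFun n fun t u => D fun _ => t • e₁ + u • e₂ := by
  classical
  have : (fun t u : ℝ => D fun _ => t • e₁ + u • e₂) = fun t u => ∑ S : Finset (Fin m),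
      D (S.piecewise (fun _ => e₁) fun _ => e₂) * (t ^ S.card * u ^ (m - S.card)) := by
    ext t u
    have h1 := D.toMultilinearMap.map_add_univ (fun _ => t • e₁) (fun _ => u • e₂)
    refine h1.trans (Finset.sum_congr rfl fun S _ => ?_)
    have h2 : S.piecewise (fun _ => t • e₁) (fun _ => u • e₂) = fun i =>
        (S.piecewise (fun _ => t) (fun _ => u) i) • S.piecewise (fun _ => e₁) (fun _ => e₂) i := by
      ext i
      by_cases hi : i ∈ S <;> simp [hi]
    rw [h2, D.toMultilinearMap.map_smul_univ, Finset.prod_piecewise, smul_eq_mul, mul_comm]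
    simp [Finset.card_sdiff, Finset.prod_const]
  rw [this]
  refine sum fun S _ => monomial ?_ (by omega) _
  have := S.card_le_univ
  simp at this
  omega

end IsPolyFun

/-- Coefficients of a polynomial of degree at most `n` are controlled by its values on `[0, 1)`, by
inversion of the Vandermonde matrix of `n + 1` points. -/
lemma exists_coeff_bound (n : ℕ) : ∃ Λ : ℝ, 1 ≤ Λ ∧ ∀ (c : ℕ → ℝ) (M : ℝ), 0 ≤ M →
    (∀ t ∈ Set.Ico (0 : ℝ) 1, |∑ i ∈ Finset.range (n + 1), c i * t ^ i| ≤ M) →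
    ∀ i ∈ Finset.range (n + 1), |c i| ≤ Λ * M := by
  set v : Fin (n + 1) → ℝ := fun j => (j : ℝ) / (n + 1) with hv
  have hvinj : Function.Injective v := by
    intro i j hij
    have hn : (n + 1 : ℝ) ≠ 0 := by positivity
    simp only [hv] at hij
    rw [div_left_inj' hn] at hij
    exact Fin.ext (by exact_mod_cast hij)
  set V := Matrix.vandermonde v with hV
  have hdet : IsUnit V.det := (Matrix.det_vandermonde_ne_zero_iff.2 hvinj).isUnit
  refine ⟨1 + ∑ i, ∑ j, |V⁻¹ i j|, le_add_of_nonneg_right (by positivity), ?_⟩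
  intro c M hM h i hi
  rw [Finset.mem_range] at hi
  set c' : Fin (n + 1) → ℝ := fun i => c i
  have hval : ∀ j, |(V.mulVec c') j| ≤ M := by
    intro j
    have hmem : v j ∈ Set.Ico (0 : ℝ) 1 := by
      refine ⟨by positivity, ?_⟩
      rw [div_lt_one (by positivity)]
      exact_mod_cast j.2
    convert h _ hmem using 2
    rw [Finset.sum_range]
    simp only [Matrix.mulVec, dotProduct, hV, Matrix.vandermonde_apply, c']
    exact Finset.sum_congr rfl fun _ _ => mul_comm _ _
  have hc : c' = V⁻¹.mulVec (V.mulVec c') := by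
    rw [Matrix.mulVec_mulVec, Matrix.nonsing_inv_mul _ hdet, Matrix.one_mulVec]
  have : c i = (V⁻¹.mulVec (V.mulVec c')) ⟨i, hi⟩ := by rw [← hc]
  rw [this, Matrix.mulVec, dotProduct]
  calc |∑ j, V⁻¹ ⟨i, hi⟩ j * (V.mulVec c') j| ≤ ∑ j, |V⁻¹ ⟨i, hi⟩ j| * M := by
        refine (Finset.abs_sum_le_sum_abs _ _).trans (Finset.sum_le_sum fun j _ => ?_)
        rw [abs_mul]
        gcongr
        exact hval j
    _ = (∑ j, |V⁻¹ ⟨i, hi⟩ j|) * M := by rw [Finset.sum_mul]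
    _ ≤ (1 + ∑ i, ∑ j, |V⁻¹ i j|) * M := by
        gcongr
        have := Finset.single_le_sum (f := fun i => ∑ j, |V⁻¹ i j|)
          (fun _ _ => Finset.sum_nonneg fun _ _ => abs_nonneg _) (Finset.mem_univ ⟨i, hi⟩)
        linarith

/-- The bound for two variables follows by viewing the coefficients of the powers of `t` as
polynomials in `u`. -/
lemma exists_coeff_bound₂ (n : ℕ) : ∃ Λ : ℝ, 1 ≤ Λ ∧ ∀ (c : ℕ × ℕ → ℝ) (M : ℝ), 0 ≤ M →
    (∀ t ∈ Set.Ico (0 : ℝ) 1, ∀ u ∈ Set.Ico (0 : ℝ) 1,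
      |∑ τ ∈ Finset.range (n + 1) ×ˢ Finset.range (n + 1), c τ * (t ^ τ.1 * u ^ τ.2)| ≤ M) →
    ∀ τ ∈ Finset.range (n + 1) ×ˢ Finset.range (n + 1), |c τ| ≤ Λ * M := by
  obtain ⟨Λ, hΛ, h⟩ := exists_coeff_bound n
  refine ⟨Λ * Λ, one_le_mul_of_one_le_of_one_le hΛ hΛ, fun c M hM hc τ hτ => ?_⟩
  obtain ⟨h1, h2⟩ := Finset.mem_product.1 hτ
  rw [mul_assoc]
  refine h (fun j => c (τ.1, j)) (Λ * M) (by positivity) (fun u hu => ?_) τ.2 h2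
  refine h (fun i => ∑ j ∈ Finset.range (n + 1), c (i, j) * u ^ j) M hM (fun t ht => ?_) τ.1 h1
  convert hc t ht u hu using 2
  rw [Finset.sum_product]
  refine Finset.sum_congr rfl fun i _ => ?_
  rw [Finset.sum_mul]
  exact Finset.sum_congr rfl fun j _ => by ring

/-- The position of `x` in its cell of the grid of mesh `1 / K`. -/
lemma grid_cell {K : ℕ} (hK : 0 < K) {x : ℝ} (hx : x ∈ Set.Ico (0 : ℝ) 1) :
    ⌊K * x⌋₊ < K ∧ Int.fract (K * x) ∈ Set.Ico (0 : ℝ) 1 ∧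
      (⌊K * x⌋₊ + Int.fract (K * x)) / K = x := by
  have hK' : (0 : ℝ) < K := by exact_mod_cast hK
  have h0 : 0 ≤ K * x := mul_nonneg hK'.le hx.1
  refine ⟨(Nat.floor_lt h0).2 (by nlinarith [hx.2]), ⟨Int.fract_nonneg _, Int.fract_lt_one _⟩, ?_⟩
  rw [natCast_floor_eq_intCast_floor h0, Int.floor_add_fract, mul_div_cancel_left₀ _ hK'.ne']

lemma mem_Icc_of_cell {K a : ℕ} (hK : 0 < K) (ha : a < K) {t : ℝ} (ht : t ∈ Set.Ico (0 : ℝ) 1) :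
    (a + t) / K ∈ Set.Icc (0 : ℝ) 1 := by
  have hK' : (0 : ℝ) < K := by exact_mod_cast hK
  have : (a : ℝ) + 1 ≤ K := by exact_mod_cast ha
  exact ⟨div_nonneg (by linarith [ht.1, (Nat.cast_nonneg a : (0 : ℝ) ≤ a)]) hK'.le,
    (div_le_one hK').2 (by linarith [ht.2])⟩

/-- The Taylor polynomials at the left end points of the cells. Their coefficients are bounded in
terms of the values of `f`, as there is no bound on the derivatives of lower order. -/
theorem exists_piecewisePoly₁ {β : ℝ} (hβ : 0 < β) : ∃ Λ : ℝ, 1 ≤ Λ ∧ ∀ (H B : ℝ) (f : ℝ → ℝ),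
    0 ≤ B → HolderSmoothOn β H f (Set.Icc 0 1) → (∀ x ∈ Set.Icc (0 : ℝ) 1, |f x| ≤ B) →
    ∀ K : ℕ, 0 < K → ∃ cf : ℕ → ℕ → ℝ, (∀ k i, |cf k i| ≤ Λ * (B + |H|)) ∧
      ∀ x ∈ Set.Ico (0 : ℝ) 1, |f x - piecewisePoly₁ ⌊β⌋₊ K cf x| ≤ |H| * (1 / K : ℝ) ^ β := by
  obtain ⟨Λ, hΛ, hΛb⟩ := exists_coeff_bound ⌊β⌋₊
  refine ⟨Λ, hΛ, fun H B f hB hf hfB K hK => ?_⟩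
  have hK' : (0 : ℝ) < K := by exact_mod_cast hK
  have hK1 : (1 / K : ℝ) ≤ 1 := by rw [div_le_one hK']; exact_mod_cast hK
  have hT : ∀ a < K, ∃ c : ℕ → ℝ, ∀ t ∈ Set.Ico (0 : ℝ) 1,
      |f ((a + t) / K) - ∑ i ∈ Finset.range (⌊β⌋₊ + 1), c i * t ^ i| ≤ |H| * (1 / K : ℝ) ^ β := by
    intro a ha
    refine ⟨fun m => iteratedFDerivWithin ℝ m f (Set.Icc 0 1) ((a + 0) / K) (fun _ => 1 / K) *
      (m.factorial : ℝ)⁻¹, fun t ht => ?_⟩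
    have h1 := hf.abs_sub_taylor_le hβ (convex_Icc 0 1)
      (mem_Icc_of_cell hK ha (t := 0) (by simp)) (mem_Icc_of_cell hK ha ht)
    have e : ((a : ℝ) + t) / K - (a + 0) / K = t • (1 / K : ℝ) := by
      rw [smul_eq_mul]; ring
    rw [e] at h1
    have h2 : ‖t • (1 / K : ℝ)‖ ≤ 1 / K := by
      rw [norm_smul, Real.norm_eq_abs, Real.norm_eq_abs, abs_of_nonneg ht.1,
        abs_of_nonneg (by positivity : (0 : ℝ) ≤ 1 / K)]
      exact mul_le_of_le_one_left (by positivity) ht.2.le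
    refine le_trans (le_of_eq ?_) (h1.trans (by gcongr))
    congr 2
    refine Finset.sum_congr rfl fun m _ => ?_
    have := (iteratedFDerivWithin ℝ m f (Set.Icc 0 1) (((a : ℝ) + 0) / K)).map_smul_univ
      (fun _ => t) (fun _ => (1 / K : ℝ))
    simp only [Finset.prod_const, Finset.card_univ, Fintype.card_fin] at this
    rw [this, smul_eq_mul]
    ring
  choose! c hc using hT
  refine ⟨fun k i => if k < K ∧ i ∈ Finset.range (⌊β⌋₊ + 1) then c k i else 0,
    fun k i => ?_, fun x hx => ?_⟩
  · dsimp only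
    split_ifs with h
    · refine hΛb (c k) (B + |H|) (by positivity) (fun t ht => ?_) i h.2
      have h1 := hc k h.1 t ht
      have h2 := hfB _ (mem_Icc_of_cell hK h.1 ht)
      have h3 : |H| * (1 / K : ℝ) ^ β ≤ |H| * 1 := by
        gcongr
        exact Real.rpow_le_one (by positivity) hK1 hβ.le
      rw [abs_le] at h1 h2 ⊢
      constructor <;> linarith [h1.1, h1.2, h2.1, h2.2]
    · rw [abs_zero]; positivity
  · obtain ⟨h1, h2, e⟩ := grid_cell hK hx
    have h3 := hc _ h1 _ h2
    rw [e] at h3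
    convert h3 using 3
    rw [piecewisePoly₁]
    refine Finset.sum_congr rfl fun i hi => ?_
    rw [if_pos ⟨h1, hi⟩]

/-- The Taylor polynomials at the lower left corners of the cells. In both variables their degree
is at most `⌊β⌋₊`, the bound on their total degree. -/
theorem exists_piecewisePoly₂ {β : ℝ} (hβ : 0 < β) : ∃ Λ : ℝ, 1 ≤ Λ ∧
    ∀ (H B : ℝ) (g : ℝ → ℝ → ℝ), 0 ≤ B →
    HolderSmoothOn β H (fun z : ℝ × ℝ => g z.1 z.2) (Set.Icc 0 1 ×ˢ Set.Icc 0 1) →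
    (∀ x ∈ Set.Icc (0 : ℝ) 1, ∀ y ∈ Set.Icc (0 : ℝ) 1, |g x y| ≤ B) →
    ∀ K : ℕ, 0 < K → ∃ cf : ℕ → ℕ → ℕ × ℕ → ℝ, (∀ a b τ, |cf a b τ| ≤ Λ * (B + |H|)) ∧
      ∀ x ∈ Set.Ico (0 : ℝ) 1, ∀ y ∈ Set.Ico (0 : ℝ) 1,
        |g x y - piecewisePoly₂ ⌊β⌋₊ K cf x y| ≤ |H| * (1 / K : ℝ) ^ β := by
  obtain ⟨Λ, hΛ, hΛb⟩ := exists_coeff_bound₂ ⌊β⌋₊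
  refine ⟨Λ, hΛ, fun H B g hB hg hgB K hK => ?_⟩
  have hK' : (0 : ℝ) < K := by exact_mod_cast hK
  have hK1 : (1 / K : ℝ) ≤ 1 := by rw [div_le_one hK']; exact_mod_cast hK
  have hT : ∀ a b : ℕ, a < K → b < K → ∃ c : ℕ × ℕ → ℝ, ∀ t ∈ Set.Ico (0 : ℝ) 1,
      ∀ u ∈ Set.Ico (0 : ℝ) 1, |g ((a + t) / K) ((b + u) / K) -
        ∑ τ ∈ Finset.range (⌊β⌋₊ + 1) ×ˢ Finset.range (⌊β⌋₊ + 1), c τ * (t ^ τ.1 * u ^ τ.2)| ≤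
          |H| * (1 / K : ℝ) ^ β := by
    intro a b ha hb
    set x₀ : ℝ × ℝ := ((a + 0) / K, (b + 0) / K) with hx₀
    have hpoly : IsPolyFun ⌊β⌋₊ fun t u => ∑ m ∈ Finset.range (⌊β⌋₊ + 1),
        iteratedFDerivWithin ℝ m (fun z : ℝ × ℝ => g z.1 z.2) (Set.Icc 0 1 ×ˢ Set.Icc 0 1) x₀
          (fun _ => t • ((1 / K, 0) : ℝ × ℝ) + u • ((0, 1 / K) : ℝ × ℝ)) *
          (m.factorial : ℝ)⁻¹ :=
      IsPolyFun.sum fun m hm => (IsPolyFun.multilinear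
        (by have := Finset.mem_range.1 hm; omega) _ _ _).mul_const _
    obtain ⟨c, hc⟩ := hpoly
    refine ⟨c, fun t ht u hu => ?_⟩
    have hx₀mem : x₀ ∈ Set.Icc (0 : ℝ) 1 ×ˢ Set.Icc (0 : ℝ) 1 :=
      ⟨mem_Icc_of_cell hK ha (t := 0) (by simp), mem_Icc_of_cell hK hb (t := 0) (by simp)⟩
    have hxmem : (((a + t) / K, (b + u) / K) : ℝ × ℝ) ∈ Set.Icc (0 : ℝ) 1 ×ˢ Set.Icc (0 : ℝ) 1 :=
      ⟨mem_Icc_of_cell hK ha ht, mem_Icc_of_cell hK hb hu⟩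
    have h1 := hg.abs_sub_taylor_le hβ ((convex_Icc 0 1).prod (convex_Icc 0 1)) hx₀mem hxmem
    have e : (((a + t) / K, (b + u) / K) : ℝ × ℝ) - x₀ =
        t • ((1 / K, 0) : ℝ × ℝ) + u • ((0, 1 / K) : ℝ × ℝ) := by
      ext <;> simp [hx₀] <;> ring
    have h2 : ‖t • ((1 / K, 0) : ℝ × ℝ) + u • ((0, 1 / K) : ℝ × ℝ)‖ ≤ 1 / K := by
      rw [Prod.norm_def]
      have hKi : (0 : ℝ) ≤ (K : ℝ)⁻¹ := by positivity
      simp only [Prod.fst_add, Prod.smul_fst, Prod.snd_add, Prod.smul_snd, smul_eq_mul, mul_zero,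
        add_zero, zero_add, Real.norm_eq_abs, abs_mul, abs_of_nonneg ht.1, abs_of_nonneg hu.1,
        one_div, abs_of_nonneg hKi]
      exact max_le (mul_le_of_le_one_left hKi ht.2.le) (mul_le_of_le_one_left hKi hu.2.le)
    rw [e] at h1
    rw [← hc]
    exact h1.trans (by gcongr)
  choose! c hc using hT
  refine ⟨fun a b τ => if (a < K ∧ b < K) ∧
    τ ∈ Finset.range (⌊β⌋₊ + 1) ×ˢ Finset.range (⌊β⌋₊ + 1) then c a b τ else 0,
    fun a b τ => ?_, fun x hx y hy => ?_⟩
  · dsimp only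
    split_ifs with h
    · refine hΛb (c a b) (B + |H|) (by positivity) (fun t ht u hu => ?_) τ h.2
      have h1 := hc a b h.1.1 h.1.2 t ht u hu
      have h2 := hgB _ (mem_Icc_of_cell hK h.1.1 ht) _ (mem_Icc_of_cell hK h.1.2 hu)
      have h3 : |H| * (1 / K : ℝ) ^ β ≤ |H| * 1 := by
        gcongr
        exact Real.rpow_le_one (by positivity) hK1 hβ.le
      rw [abs_le] at h1 h2 ⊢
      constructor <;> linarith [h1.1, h1.2, h2.1, h2.2]
    · rw [abs_zero]; positivity
  · obtain ⟨h1, h2, e⟩ := grid_cell hK hx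
    obtain ⟨h1', h2', e'⟩ := grid_cell hK hy
    have h3 := hc _ _ h1 h1' _ h2 _ h2'
    rw [e, e'] at h3
    convert h3 using 3
    rw [piecewisePoly₂]
    refine Finset.sum_congr rfl fun τ hτ => ?_
    rw [if_pos ⟨⟨h1, h1'⟩, hτ⟩]

/-! ### The uniform distribution on the cube and its orthogonal decompositions -/

/-- The uniform distribution on the unit interval. It is restricted to `[0, 1)`, on which the cells
of a grid are half-open. -/
def unif : Measure ℝ := volume.restrict (Set.Ico 0 1)

instance : IsProbabilityMeasure unif := ⟨by simp [unif]⟩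

lemma ae_unif_mem : ∀ᵐ x ∂unif, x ∈ Set.Ico (0 : ℝ) 1 := ae_restrict_mem measurableSet_Ico

lemma unif_eq_restrict_Icc : unif = volume.restrict (Set.Icc 0 1) :=
  Measure.restrict_congr_set Ico_ae_eq_Icc

lemma intervalIntegral_eq_unif (f : ℝ → ℝ) : ∫ x in (0 : ℝ)..1, f x = ∫ x, f x ∂unif := by
  rw [intervalIntegral.integral_of_le zero_le_one, unif_eq_restrict_Icc,
    Measure.restrict_congr_set Ioc_ae_eq_Icc]

/-- The uniform distribution on the cube. -/
def cubeUnif (d : ℕ) : Measure (Fin d → ℝ) := Measure.pi fun _ => unif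

instance (d : ℕ) : IsProbabilityMeasure (cubeUnif d) := by unfold cubeUnif; infer_instance

lemma restrict_unitCube (d : ℕ) : volume.restrict (unitCube d) = cubeUnif d := by
  have h : unitCube d = Set.univ.pi fun _ => Set.Icc (0 : ℝ) 1 := by
    rw [Set.pi_univ_Icc]; rfl
  rw [h, cubeUnif, unif_eq_restrict_Icc, volume_pi, Measure.restrict_pi_pi]

variable {d : ℕ}

lemma ae_cubeUnif_of_ae_unif {p : ℝ → Prop} (h : ∀ᵐ t ∂unif, p t) (j : Fin d) :
    ∀ᵐ x ∂cubeUnif d, p (x j) :=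
  (measurePreserving_eval (fun _ : Fin d => unif) j).quasiMeasurePreserving.ae h

lemma ae_cubeUnif_mem (j : Fin d) : ∀ᵐ x ∂cubeUnif d, x j ∈ Set.Ico (0 : ℝ) 1 :=
  ae_cubeUnif_of_ae_unif ae_unif_mem j

lemma measurable_update_prod (k : Fin d) :
    Measurable fun p : (Fin d → ℝ) × ℝ => Function.update p.1 k p.2 := by
  refine measurable_pi_iff.2 fun i => ?_
  by_cases h : i = k
  · subst h
    simpa using measurable_snd
  · simp only [Function.update_of_ne h]
    exact (measurable_pi_apply i).comp measurable_fst

/-- Resampling one coordinate preserves the uniform distribution. -/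
lemma map_update_cubeUnif (k : Fin d) :
    ((cubeUnif d).prod unif).map (fun p => Function.update p.1 k p.2) = cubeUnif d := by
  have hm := measurable_update_prod k
  refine (Measure.pi_eq fun s hs => ?_).symm
  rw [Measure.map_apply hm (MeasurableSet.univ_pi hs)]
  have : (fun p : (Fin d → ℝ) × ℝ => Function.update p.1 k p.2) ⁻¹' Set.univ.pi s =
      (Set.univ.pi (Function.update s k Set.univ)) ×ˢ s k := by
    ext ⟨x, t⟩
    simp only [Set.mem_preimage, Set.mem_univ_pi, Set.mem_prod]
    constructor
    · intro h
      refine ⟨fun i => ?_, by simpa using h k⟩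
      by_cases hi : i = k
      · subst hi; simp
      · simpa [Function.update_of_ne hi] using h i
    · rintro ⟨h1, h2⟩ i
      by_cases hi : i = k
      · subst hi; simpa using h2
      · simpa [Function.update_of_ne hi] using h1 i
  rw [this, Measure.prod_prod, cubeUnif, Measure.pi_pi,
    ← Finset.prod_erase_mul _ _ (Finset.mem_univ k), ← Finset.prod_erase_mul _ _ (Finset.mem_univ k)]
  simp only [Function.update_self, measure_univ, mul_one]
  congr 1
  refine Finset.prod_congr rfl fun i hi => ?_
  rw [Function.update_of_ne (Finset.ne_of_mem_erase hi)]

/-- A function whose mean in one coordinate always vanishes has integral zero. -/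
lemma integral_cubeUnif_eq_zero {F : (Fin d → ℝ) → ℝ} (k : Fin d)
    (h : ∀ x, ∫ t, F (Function.update x k t) ∂unif = 0) : ∫ x, F x ∂cubeUnif d = 0 := by
  by_cases hF : Integrable F (cubeUnif d)
  · have hm := measurable_update_prod k
    rw [← map_update_cubeUnif k] at hF
    rw [← map_update_cubeUnif k, integral_map hm.aemeasurable hF.aestronglyMeasurable,
      integral_prod]
    · simp [h]
    · exact (integrable_map_measure hF.aestronglyMeasurable hm.aemeasurable).1 hF
  -- the integral of a function that is not integrable is zero by convention
  · exact integral_undef hF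

/-- Bounded measurable functions. -/
def BddMeasurable {α : Type*} [MeasurableSpace α] (u : α → ℝ) : Prop :=
  Measurable u ∧ ∃ C, ∀ x, |u x| ≤ C

namespace BddMeasurable

variable {α γ : Type*} [MeasurableSpace α] [MeasurableSpace γ] {u v : α → ℝ}

lemma integrable {μ : Measure α} [IsFiniteMeasure μ] (h : BddMeasurable u) : Integrable u μ := by
  obtain ⟨hm, C, hC⟩ := h
  exact Integrable.of_bound hm.aestronglyMeasurable C (Filter.Eventually.of_forall hC)

lemma add (hu : BddMeasurable u) (hv : BddMeasurable v) : BddMeasurable fun x => u x + v x := by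
  obtain ⟨hm, C, hC⟩ := hu
  obtain ⟨hm', C', hC'⟩ := hv
  exact ⟨hm.add hm', C + C', fun x => (abs_add_le _ _).trans (add_le_add (hC x) (hC' x))⟩

lemma sub (hu : BddMeasurable u) (hv : BddMeasurable v) : BddMeasurable fun x => u x - v x := by
  obtain ⟨hm, C, hC⟩ := hu
  obtain ⟨hm', C', hC'⟩ := hv
  exact ⟨hm.sub hm', C + C', fun x => (abs_sub _ _).trans (add_le_add (hC x) (hC' x))⟩

lemma mul (hu : BddMeasurable u) (hv : BddMeasurable v) : BddMeasurable fun x => u x * v x := by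
  obtain ⟨hm, C, hC⟩ := hu
  obtain ⟨hm', C', hC'⟩ := hv
  refine ⟨hm.mul hm', C * C', fun x => ?_⟩
  rw [abs_mul]
  exact mul_le_mul (hC x) (hC' x) (abs_nonneg _) ((abs_nonneg _).trans (hC x))

lemma const (a : ℝ) : BddMeasurable fun _ : α => a := ⟨measurable_const, |a|, fun _ => le_rfl⟩

lemma sum {ι : Type*} {S : Finset ι} {u : ι → α → ℝ} (h : ∀ i ∈ S, BddMeasurable (u i)) :
    BddMeasurable fun x => ∑ i ∈ S, u i x := by
  classical
  induction S using Finset.induction_on with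
  | empty => simpa using const 0
  | insert i S hi ih =>
    simp only [Finset.sum_insert hi]
    exact (h i (Finset.mem_insert_self _ _)).add
      (ih fun j hj => h j (Finset.mem_insert_of_mem hj))

lemma comp (hu : BddMeasurable u) {φ : γ → α} (hφ : Measurable φ) :
    BddMeasurable fun x => u (φ x) := by
  obtain ⟨hm, C, hC⟩ := hu
  exact ⟨hm.comp hφ, C, fun x => hC _⟩

end BddMeasurable

lemma integral_sq_sum_of_orthogonal {α ι : Type*} [MeasurableSpace α] {μ : Measure α}
    [IsFiniteMeasure μ] (S : Finset ι) (u : ι → α → ℝ) (hu : ∀ i ∈ S, BddMeasurable (u i))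
    (h : ∀ i ∈ S, ∀ j ∈ S, i ≠ j → ∫ x, u i x * u j x ∂μ = 0) :
    ∫ x, (∑ i ∈ S, u i x) ^ 2 ∂μ = ∑ i ∈ S, ∫ x, u i x ^ 2 ∂μ := by
  simp only [sq, Finset.sum_mul_sum]
  rw [integral_finsetSum _ fun i hi => (BddMeasurable.sum fun j hj =>
    (hu i hi).mul (hu j hj)).integrable]
  refine Finset.sum_congr rfl fun i hi => ?_
  rw [integral_finsetSum _ fun j hj => ((hu i hi).mul (hu j hj)).integrable,
    Finset.sum_eq_single i (fun j hj hji => h i hi j hj (Ne.symm hji)) (fun h => absurd hi h)]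

/-- Centered functions of single coordinates are orthogonal. -/
lemma integral_sq_sum_univariate (e : Fin d → ℝ → ℝ) (he : ∀ j, BddMeasurable (e j))
    (h0 : ∀ j, ∫ t, e j t ∂unif = 0) :
    ∫ x, (∑ j, e j (x j)) ^ 2 ∂cubeUnif d = ∑ j, ∫ x, e j (x j) ^ 2 ∂cubeUnif d := by
  refine integral_sq_sum_of_orthogonal _ (fun j (x : Fin d → ℝ) => e j (x j))
    (fun j _ => (he j).comp (measurable_pi_apply j)) fun i _ j _ hij => ?_
  refine integral_cubeUnif_eq_zero i fun x => ?_
  simp only [Function.update_self, Function.update_of_ne hij.symm]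
  rw [integral_mul_const, h0, zero_mul]

/-- The pairs `j < k` of coordinates. -/
def pairs (d : ℕ) : Finset (Fin d × Fin d) := Finset.univ.filter fun p => p.1 < p.2

lemma mem_pairs {p : Fin d × Fin d} : p ∈ pairs d ↔ p.1 < p.2 := by simp [pairs]

lemma sum_pairs {M : Type*} [AddCommMonoid M] (F : Fin d → Fin d → M) :
    ∑ j, ∑ k ∈ Finset.Ioi j, F j k = ∑ p ∈ pairs d, F p.1 p.2 := by
  rw [pairs, Finset.sum_filter, ← Finset.univ_product_univ, Finset.sum_product]
  refine Finset.sum_congr rfl fun j _ => ?_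
  rw [← Finset.sum_filter]
  refine Finset.sum_congr ?_ fun _ _ => rfl
  ext k
  simp

lemma card_pairs (d : ℕ) : (pairs d).card = d.choose 2 := by
  have h1 := sum_pairs (d := d) (fun _ _ => 1)
  rw [Finset.card_eq_sum_ones, ← h1]
  simp only [Finset.sum_const, smul_eq_mul, mul_one, Fin.card_Ioi]
  rw [Fin.sum_univ_eq_sum_range (fun j => d - 1 - j), Finset.sum_range_reflect (fun j => j) d,
    Finset.sum_range_id, Nat.choose_two_right]

/-- A function of the coordinates `i` and `k` without marginals has mean zero in each of the two. -/
lemma integral_pair_update {G : ℝ → ℝ → ℝ} (h1 : ∀ y, ∫ x, G x y ∂unif = 0)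
    (h2 : ∀ x, ∫ y, G x y ∂unif = 0) {i k m : Fin d} (hik : i ≠ k) (hm : m = i ∨ m = k)
    (x : Fin d → ℝ) :
    ∫ t, G (Function.update x m t i) (Function.update x m t k) ∂unif = 0 := by
  rcases hm with rfl | rfl
  · simp only [Function.update_self, Function.update_of_ne hik.symm]
    exact h1 _
  · simp only [Function.update_self, Function.update_of_ne hik]
    exact h2 _

/-- Functions of pairs of coordinates with vanishing marginals are orthogonal. -/
lemma integral_sq_sum_bivariate (e : Fin d → Fin d → ℝ → ℝ → ℝ)
    (he : ∀ j k, j < k → BddMeasurable fun z : ℝ × ℝ => e j k z.1 z.2)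
    (h1 : ∀ j k, j < k → ∀ y, ∫ x, e j k x y ∂unif = 0)
    (h2 : ∀ j k, j < k → ∀ x, ∫ y, e j k x y ∂unif = 0) :
    ∫ x, (∑ p ∈ pairs d, e p.1 p.2 (x p.1) (x p.2)) ^ 2 ∂cubeUnif d =
      ∑ p ∈ pairs d, ∫ x, e p.1 p.2 (x p.1) (x p.2) ^ 2 ∂cubeUnif d := by
  refine integral_sq_sum_of_orthogonal _ (fun (p : Fin d × Fin d)
    (x : Fin d → ℝ) => e p.1 p.2 (x p.1) (x p.2))
    (fun p hp => (he _ _ (mem_pairs.1 hp)).comp (φ := fun x : Fin d → ℝ => (x p.1, x p.2))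
      ((measurable_pi_apply p.1).prodMk (measurable_pi_apply p.2))) fun p hp q hq hpq => ?_
  rw [mem_pairs] at hp hq
  -- some coordinate of `p` does not occur in `q`
  obtain ⟨m, hm, hm1, hm2⟩ : ∃ m, (m = p.1 ∨ m = p.2) ∧ m ≠ q.1 ∧ m ≠ q.2 := by
    by_contra! hcon
    have a1 := hcon p.1 (Or.inl rfl)
    have a2 := hcon p.2 (Or.inr rfl)
    apply hpq
    by_cases b1 : p.1 = q.1
    · by_cases b2 : p.2 = q.1
      · rw [b1, b2] at hp; exact absurd hp (lt_irrefl _)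
      · exact Prod.ext b1 (a2 b2)
    · have c1 := a1 b1
      by_cases b2 : p.2 = q.1
      · rw [c1, b2] at hp; exact absurd (hp.trans hq) (lt_irrefl _)
      · rw [c1, a2 b2] at hp; exact absurd hp (lt_irrefl _)
  refine integral_cubeUnif_eq_zero m fun x => ?_
  simp only [Function.update_of_ne hm1.symm, Function.update_of_ne hm2.symm]
  rw [integral_mul_const, integral_pair_update (h1 _ _ hp) (h2 _ _ hp) hp.ne hm, zero_mul]

/-- Averaging the mean function over all coordinates outside `J` leaves the components on `J`. -/
lemma integral_interactionMean_ite {f : Fin d → ℝ → ℝ} {g : Fin d → Fin d → ℝ → ℝ → ℝ}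
    (hf : ∀ j, BddMeasurable (f j))
    (hg : ∀ j k, j < k → BddMeasurable fun z : ℝ × ℝ => g j k z.1 z.2)
    (hf0 : ∀ j, ∫ t, f j t ∂unif = 0) (h1 : ∀ j k, j < k → ∀ y, ∫ x, g j k x y ∂unif = 0)
    (h2 : ∀ j k, j < k → ∀ x, ∫ y, g j k x y ∂unif = 0) (J : Finset (Fin d)) (A : Fin d → ℝ) :
    ∫ x, interactionMean f g (fun i => if i ∈ J then A i else x i) ∂cubeUnif d =
      (∑ j, if j ∈ J then f j (A j) else 0) +
        ∑ p ∈ pairs d, if p.1 ∈ J ∧ p.2 ∈ J then g p.1 p.2 (A p.1) (A p.2) else 0 := by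
  have hY : ∀ i, Measurable fun x : Fin d → ℝ => if i ∈ J then A i else x i := fun i => by
    by_cases hi : i ∈ J
    · simp [hi]
    · simpa [hi] using measurable_pi_apply i
  have b1 : ∀ j, BddMeasurable fun x : Fin d → ℝ => f j (if j ∈ J then A j else x j) :=
    fun j => (hf j).comp (hY j)
  have b2 : ∀ p ∈ pairs d, BddMeasurable fun x : Fin d → ℝ =>
      g p.1 p.2 (if p.1 ∈ J then A p.1 else x p.1) (if p.2 ∈ J then A p.2 else x p.2) :=
    fun p hp => (hg _ _ (mem_pairs.1 hp)).comp ((hY p.1).prodMk (hY p.2))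
  simp only [interactionMean, sum_pairs]
  rw [integral_add (BddMeasurable.sum fun j _ => b1 j).integrable
    (BddMeasurable.sum b2).integrable, integral_finsetSum _ fun j _ => (b1 j).integrable,
    integral_finsetSum _ fun p hp => (b2 p hp).integrable]
  congr 1
  · refine Finset.sum_congr rfl fun j _ => ?_
    split_ifs with hj
    · simp
    · refine integral_cubeUnif_eq_zero j fun x => ?_
      simpa using hf0 j
  · refine Finset.sum_congr rfl fun p hp => ?_
    rw [mem_pairs] at hp
    by_cases hp1 : p.1 ∈ J <;> by_cases hp2 : p.2 ∈ J
    · simp [hp1, hp2]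
    · simp only [hp1, hp2, if_true, if_false, and_false]
      refine integral_cubeUnif_eq_zero p.2 fun x => ?_
      simpa using h2 _ _ hp _
    · simp only [hp1, hp2, if_true, if_false, false_and]
      refine integral_cubeUnif_eq_zero p.1 fun x => ?_
      simpa using h1 _ _ hp _
    · simp only [hp1, hp2, if_false, false_and]
      exact integral_cubeUnif_eq_zero p.1 fun x =>
        integral_pair_update (h1 _ _ hp) (h2 _ _ hp) hp.ne (Or.inl rfl) x

/-- The components of a bounded mean function are bounded: `f j` is the average of the mean function
over all coordinates except `j`, and `g j k` is an average up to the contribution of `f j` and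
`f k`. -/
lemma abs_component_le {f : Fin d → ℝ → ℝ} {g : Fin d → Fin d → ℝ → ℝ → ℝ} {B : ℝ}
    (hf : ∀ j, BddMeasurable (f j))
    (hg : ∀ j k, j < k → BddMeasurable fun z : ℝ × ℝ => g j k z.1 z.2)
    (hf0 : ∀ j, ∫ t, f j t ∂unif = 0) (h1 : ∀ j k, j < k → ∀ y, ∫ x, g j k x y ∂unif = 0)
    (h2 : ∀ j k, j < k → ∀ x, ∫ y, g j k x y ∂unif = 0)
    (hB : ∀ x, |interactionMean f g x| ≤ B) :
    (∀ j a, |f j a| ≤ B) ∧ ∀ j k, j < k → ∀ a b, |g j k a b| ≤ 3 * B := by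
  classical
  have key : ∀ (J : Finset (Fin d)) (A : Fin d → ℝ), |(∑ j, if j ∈ J then f j (A j) else 0) +
      ∑ p ∈ pairs d, if p.1 ∈ J ∧ p.2 ∈ J then g p.1 p.2 (A p.1) (A p.2) else 0| ≤ B := by
    intro J A
    rw [← integral_interactionMean_ite hf hg hf0 h1 h2 J A]
    have := norm_integral_le_of_norm_le_const (μ := cubeUnif d) (C := B)
      (f := fun x => interactionMean f g (fun i => if i ∈ J then A i else x i))
      (Filter.Eventually.of_forall fun x => hB _)
    simpa using this
  have hf' : ∀ j a, |f j a| ≤ B := by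
    intro j a
    have := key {j} fun _ => a
    rw [Finset.sum_eq_zero (s := pairs d)] at this
    · simpa using this
    · intro p hp
      rw [mem_pairs] at hp
      rw [if_neg]
      simp only [Finset.mem_singleton]
      rintro ⟨h, h'⟩
      rw [h, h'] at hp
      exact lt_irrefl _ hp
  refine ⟨hf', fun j k hjk a b => ?_⟩
  have := key {j, k} fun i => if i = j then a else b
  rw [Finset.sum_eq_single (s := pairs d) (j, k)] at this
  · rw [← Finset.sum_filter] at this
    have hfil : Finset.univ.filter (fun i => i ∈ ({j, k} : Finset (Fin d))) = {j, k} := by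
      ext; simp
    rw [hfil, Finset.sum_pair hjk.ne] at this
    simp only [if_true, hjk.ne', if_false, Finset.mem_insert, Finset.mem_singleton, true_or,
      or_true, and_self] at this
    have a1 := hf' j a
    have a2 := hf' k b
    rw [abs_le] at *
    constructor <;> linarith [this.1, this.2, a1.1, a1.2, a2.1, a2.2]
  · intro p hp hpne
    rw [mem_pairs] at hp
    rw [if_neg]
    simp only [Finset.mem_insert, Finset.mem_singleton]
    rintro ⟨h | h, h' | h'⟩
    · rw [h, h'] at hp; exact lt_irrefl _ hp
    · exact hpne (Prod.ext h h')
    · rw [h, h'] at hp; exact lt_irrefl _ (hp.trans hjk)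
    · rw [h, h'] at hp; exact lt_irrefl _ hp
  · intro h
    exact absurd (mem_pairs.2 hjk) h

/-! ### Removing the marginals of a function of two variables -/

/-- The pure interaction part of a function on the square: its marginals are removed. -/
def interactionPart (G : ℝ → ℝ → ℝ) (x y : ℝ) : ℝ :=
  G x y - ∫ y', G x y' ∂unif - ∫ x', G x' y ∂unif + ∫ x', ∫ y', G x' y' ∂unif ∂unif

section InteractionPart

variable {G G₁ G₂ : ℝ → ℝ → ℝ}

lemma BddMeasurable.left (hG : BddMeasurable fun z : ℝ × ℝ => G z.1 z.2) (y : ℝ) :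
    BddMeasurable fun x => G x y :=
  hG.comp (φ := fun x => (x, y)) (by fun_prop)

lemma BddMeasurable.right (hG : BddMeasurable fun z : ℝ × ℝ => G z.1 z.2) (x : ℝ) :
    BddMeasurable fun y => G x y :=
  hG.comp (φ := fun y => (x, y)) (by fun_prop)

lemma abs_integral_unif_le {u : ℝ → ℝ} {C : ℝ} (h : ∀ x ∈ Set.Ico (0 : ℝ) 1, |u x| ≤ C) :
    |∫ x, u x ∂unif| ≤ C := by
  have := norm_integral_le_of_norm_le_const (μ := unif) (C := C) (f := u)
    (by filter_upwards [ae_unif_mem] with x hx using h x hx)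
  simpa using this

lemma BddMeasurable.integral_right (hG : BddMeasurable fun z : ℝ × ℝ => G z.1 z.2) :
    BddMeasurable fun x => ∫ y, G x y ∂unif := by
  obtain ⟨hm, C, hC⟩ := hG
  exact ⟨(hm.stronglyMeasurable.integral_prod_right (ν := unif)).measurable, C, fun x =>
    abs_integral_unif_le fun y _ => hC (x, y)⟩

lemma BddMeasurable.swap (hG : BddMeasurable fun z : ℝ × ℝ => G z.1 z.2) :
    BddMeasurable fun z : ℝ × ℝ => G z.2 z.1 :=
  hG.comp measurable_swap

lemma BddMeasurable.integral_left (hG : BddMeasurable fun z : ℝ × ℝ => G z.1 z.2) :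
    BddMeasurable fun y => ∫ x, G x y ∂unif :=
  BddMeasurable.integral_right (G := fun y x => G x y) hG.swap

lemma integral_interactionPart_right (hG : BddMeasurable fun z : ℝ × ℝ => G z.1 z.2) (x : ℝ) :
    ∫ y, interactionPart G x y ∂unif = 0 := by
  have h1 := hG.right x
  have h2 := hG.integral_left
  have hswap : ∫ x', ∫ y', G x' y' ∂unif ∂unif = ∫ y', ∫ x', G x' y' ∂unif ∂unif :=
    integral_integral_swap (hG.integrable (μ := unif.prod unif))
  simp only [interactionPart]
  rw [integral_add ((h1.sub (.const _)).sub h2).integrable (integrable_const _),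
    integral_sub (h1.sub (.const _)).integrable h2.integrable,
    integral_sub h1.integrable (integrable_const _), hswap]
  simp

lemma integral_interactionPart_left (hG : BddMeasurable fun z : ℝ × ℝ => G z.1 z.2) (y : ℝ) :
    ∫ x, interactionPart G x y ∂unif = 0 := by
  have h1 := hG.left y
  have h2 := hG.integral_right
  simp only [interactionPart]
  rw [integral_add ((h1.sub h2).sub (.const _)).integrable (integrable_const _),
    integral_sub (h1.sub h2).integrable (integrable_const _),
    integral_sub h1.integrable h2.integrable]
  simp

/-- For a function `G₁` without marginals, the interaction part of `G₂` approximates `G₁` as well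
as `G₂` does, up to a factor `4`. -/
lemma abs_sub_interactionPart_le (h₁ : BddMeasurable fun z : ℝ × ℝ => G₁ z.1 z.2)
    (h₂ : BddMeasurable fun z : ℝ × ℝ => G₂ z.1 z.2) (hl : ∀ y, ∫ x, G₁ x y ∂unif = 0)
    (hr : ∀ x, ∫ y, G₁ x y ∂unif = 0) {ε : ℝ}
    (hε : ∀ x ∈ Set.Ico (0 : ℝ) 1, ∀ y ∈ Set.Ico (0 : ℝ) 1, |G₁ x y - G₂ x y| ≤ ε) :
    ∀ x ∈ Set.Ico (0 : ℝ) 1, ∀ y ∈ Set.Ico (0 : ℝ) 1,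
      |G₁ x y - interactionPart G₂ x y| ≤ 4 * ε := by
  intro x hx y hy
  have e1 : ∀ x, ∫ y, (G₁ x y - G₂ x y) ∂unif = -∫ y, G₂ x y ∂unif := fun x => by
    rw [integral_sub (h₁.right x).integrable (h₂.right x).integrable, hr, zero_sub]
  have e2 : ∫ x, (G₁ x y - G₂ x y) ∂unif = -∫ x, G₂ x y ∂unif := by
    rw [integral_sub (h₁.left y).integrable (h₂.left y).integrable, hl, zero_sub]
  have e3 : ∫ x, ∫ y, (G₁ x y - G₂ x y) ∂unif ∂unif = -∫ x, ∫ y, G₂ x y ∂unif ∂unif := by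
    simp only [e1, integral_neg]
  have b1 := abs_integral_unif_le fun y hy => hε x hx y hy
  have b2 := abs_integral_unif_le fun x hx => hε x hx y hy
  have b3 := abs_integral_unif_le fun x hx => abs_integral_unif_le fun y hy => hε x hx y hy
  rw [e1] at b1
  rw [e2] at b2
  rw [e3] at b3
  have b0 := hε x hx y hy
  unfold interactionPart
  rw [abs_le] at *
  constructor <;> linarith [b0.1, b0.2, b1.1, b1.2, b2.1, b2.2, b3.1, b3.2]

end InteractionPart

lemma abs_piecewisePoly_summand_le {c M X Y : ℝ} {i j : ℕ} (hM : 0 ≤ M) (hc : |c| ≤ M) :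
    |c * (Int.fract X ^ i * Int.fract Y ^ j)| ≤ M := by
  have h1 : Int.fract X ^ i ≤ 1 := pow_le_one₀ (Int.fract_nonneg _) (Int.fract_lt_one _).le
  have h2 : Int.fract Y ^ j ≤ 1 := pow_le_one₀ (Int.fract_nonneg _) (Int.fract_lt_one _).le
  have h3 : 0 ≤ Int.fract X ^ i := pow_nonneg (Int.fract_nonneg _) _
  have h4 : 0 ≤ Int.fract Y ^ j := pow_nonneg (Int.fract_nonneg _) _
  rw [abs_mul, abs_of_nonneg (mul_nonneg h3 h4)]
  calc |c| * (Int.fract X ^ i * Int.fract Y ^ j) ≤ M * 1 := by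
        gcongr
        exact mul_le_one₀ h1 h4 h2
    _ = M := mul_one M

lemma bddMeasurable_summand {K : ℕ} {M : ℝ} {cf : ℕ → ℕ → ℕ × ℕ → ℝ} (hM : 0 ≤ M)
    (hcf : ∀ a b τ, |cf a b τ| ≤ M) (τ : ℕ × ℕ) :
    BddMeasurable fun z : ℝ × ℝ => cf ⌊K * z.1⌋₊ ⌊K * z.2⌋₊ τ *
      (Int.fract (K * z.1) ^ τ.1 * Int.fract (K * z.2) ^ τ.2) := by
  refine ⟨?_, M, fun z => abs_piecewisePoly_summand_le hM (hcf _ _ _)⟩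
  refine Measurable.mul ?_ (by fun_prop)
  have h : Measurable fun q : ℕ × ℕ => cf q.1 q.2 τ := .of_discrete
  exact h.comp ((Nat.measurable_floor.comp (by fun_prop)).prodMk
    (Nat.measurable_floor.comp (by fun_prop)))

lemma abs_piecewisePoly₂_le {n K : ℕ} {M : ℝ} {cf : ℕ → ℕ → ℕ × ℕ → ℝ} (hM : 0 ≤ M)
    (hcf : ∀ a b τ, |cf a b τ| ≤ M) (x y : ℝ) : |piecewisePoly₂ n K cf x y| ≤ (n + 1) ^ 2 * M := by
  refine (Finset.abs_sum_le_sum_abs _ _).trans ?_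
  refine (Finset.sum_le_card_nsmul _ _ M fun τ _ =>
    abs_piecewisePoly_summand_le hM (hcf _ _ _)).trans (le_of_eq ?_)
  simp [sq]

lemma bddMeasurable_piecewisePoly₂ {n K : ℕ} {M : ℝ} {cf : ℕ → ℕ → ℕ × ℕ → ℝ} (hM : 0 ≤ M)
    (hcf : ∀ a b τ, |cf a b τ| ≤ M) :
    BddMeasurable fun z : ℝ × ℝ => piecewisePoly₂ n K cf z.1 z.2 :=
  BddMeasurable.sum fun τ _ => bddMeasurable_summand hM hcf τ

/-- Integrating out the second variable of a piecewise polynomial gives one in the first variable: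
its coefficients are the mean values below. -/
lemma integral_piecewisePoly₂_right {n K : ℕ} {M : ℝ} {cf : ℕ → ℕ → ℕ × ℕ → ℝ} (hM : 0 ≤ M)
    (hcf : ∀ a b τ, |cf a b τ| ≤ M) (x : ℝ) :
    ∫ y, piecewisePoly₂ n K cf x y ∂unif = ∑ i ∈ Finset.range (n + 1),
      (∑ j ∈ Finset.range (n + 1), ∫ y, cf ⌊K * x⌋₊ ⌊K * y⌋₊ (i, j) * Int.fract (K * y) ^ j ∂unif) *
        Int.fract (K * x) ^ i := by
  simp only [piecewisePoly₂]
  have hint : ∀ τ, BddMeasurable fun y : ℝ => cf ⌊K * x⌋₊ ⌊K * y⌋₊ τ *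
      (Int.fract (K * x) ^ τ.1 * Int.fract (K * y) ^ τ.2) := fun τ =>
    (bddMeasurable_summand hM hcf τ).comp (φ := fun y : ℝ => (x, y)) (by fun_prop)
  rw [integral_finsetSum _ fun τ _ => (hint τ).integrable, Finset.sum_product]
  refine Finset.sum_congr rfl fun i _ => ?_
  rw [Finset.sum_mul]
  refine Finset.sum_congr rfl fun j _ => ?_
  rw [← integral_mul_const]
  congr 1
  ext y
  ring

lemma integral_piecewisePoly₂_left {n K : ℕ} {M : ℝ} {cf : ℕ → ℕ → ℕ × ℕ → ℝ} (hM : 0 ≤ M)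
    (hcf : ∀ a b τ, |cf a b τ| ≤ M) (y : ℝ) :
    ∫ x, piecewisePoly₂ n K cf x y ∂unif = ∑ j ∈ Finset.range (n + 1),
      (∑ i ∈ Finset.range (n + 1), ∫ x, cf ⌊K * x⌋₊ ⌊K * y⌋₊ (i, j) * Int.fract (K * x) ^ i ∂unif) *
        Int.fract (K * y) ^ j := by
  simp only [piecewisePoly₂]
  have hint : ∀ τ, BddMeasurable fun x : ℝ => cf ⌊K * x⌋₊ ⌊K * y⌋₊ τ *
      (Int.fract (K * x) ^ τ.1 * Int.fract (K * y) ^ τ.2) := fun τ =>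
    (bddMeasurable_summand hM hcf τ).comp (φ := fun x => (x, y)) (by fun_prop)
  rw [integral_finsetSum _ fun τ _ => (hint τ).integrable, Finset.sum_product_right]
  refine Finset.sum_congr rfl fun i _ => ?_
  rw [Finset.sum_mul]
  refine Finset.sum_congr rfl fun j _ => ?_
  rw [← integral_mul_const]
  congr 1
  ext x
  ring

/-- The interaction part of a piecewise polynomial is a piecewise polynomial on the same grid. -/
lemma exists_interactionPart_eq {n K : ℕ} {M : ℝ} {cf : ℕ → ℕ → ℕ × ℕ → ℝ} (hM : 0 ≤ M)
    (hcf : ∀ a b τ, |cf a b τ| ≤ M) : ∃ cf' : ℕ → ℕ → ℕ × ℕ → ℝ,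
      (∀ a b τ, |cf' a b τ| ≤ 4 * (n + 1) ^ 2 * M) ∧
      ∀ x y, interactionPart (piecewisePoly₂ n K cf) x y = piecewisePoly₂ n K cf' x y := by
  set m₁ : ℕ → ℕ → ℝ := fun a i => ∑ j ∈ Finset.range (n + 1),
    ∫ y, cf a ⌊K * y⌋₊ (i, j) * Int.fract (K * y) ^ j ∂unif with hm₁
  set m₂ : ℕ → ℕ → ℝ := fun b j => ∑ i ∈ Finset.range (n + 1),
    ∫ x, cf ⌊K * x⌋₊ b (i, j) * Int.fract (K * x) ^ i ∂unif with hm₂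
  set m₀ : ℝ := ∫ x, ∫ y, piecewisePoly₂ n K cf x y ∂unif ∂unif with hm₀
  have hb : ∀ (u : ℝ → ℝ) (j : ℕ), (∀ y, |u y| ≤ M) →
      |∫ y, u y * Int.fract (K * y) ^ j ∂unif| ≤ M := fun u j hu => by
    refine abs_integral_unif_le fun y _ => ?_
    have := abs_piecewisePoly_summand_le (X := K * y) (Y := 0) (i := j) (j := 0) hM (hu y)
    simpa using this
  have hs : ∀ (u : ℕ → ℝ), (∀ j, |u j| ≤ M) → |∑ j ∈ Finset.range (n + 1), u j| ≤ (n + 1) * M :=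
    fun u hu => by
      refine (Finset.abs_sum_le_sum_abs _ _).trans ?_
      refine (Finset.sum_le_card_nsmul _ _ M fun j _ => hu j).trans (le_of_eq ?_)
      simp
  have b1 : ∀ a i, |m₁ a i| ≤ (n + 1) * M := fun a i => hs _ fun j => hb _ j fun y => hcf _ _ _
  have b2 : ∀ b j, |m₂ b j| ≤ (n + 1) * M := fun b j => hs _ fun i => hb _ i fun x => hcf _ _ _
  have b0 : |m₀| ≤ (n + 1) ^ 2 * M := abs_integral_unif_le fun x _ => abs_integral_unif_le
    fun y _ => abs_piecewisePoly₂_le hM hcf x y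
  refine ⟨fun a b τ => cf a b τ - (if τ.2 = 0 then m₁ a τ.1 else 0) -
    (if τ.1 = 0 then m₂ b τ.2 else 0) + (if τ = (0, 0) then m₀ else 0), fun a b τ => ?_,
    fun x y => ?_⟩
  · have h0 : (0 : ℝ) ≤ n := Nat.cast_nonneg n
    have hnM : 0 ≤ n * M := by positivity
    have hnM2 : 0 ≤ n * (n * M) := by positivity
    have c1 : |if τ.2 = 0 then m₁ a τ.1 else 0| ≤ (n + 1) * M := by
      split_ifs
      · exact b1 _ _
      · rw [abs_zero]; positivity
    have c2 : |if τ.1 = 0 then m₂ b τ.2 else 0| ≤ (n + 1) * M := by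
      split_ifs
      · exact b2 _ _
      · rw [abs_zero]; positivity
    have c0 : |if τ = (0, 0) then m₀ else 0| ≤ (n + 1) ^ 2 * M := by
      split_ifs
      · exact b0
      · rw [abs_zero]; positivity
    have c := hcf a b τ
    rw [abs_le] at *
    constructor <;> nlinarith [c.1, c.2, c1.1, c1.2, c2.1, c2.2, c0.1, c0.2]
  · have e1 : ∑ τ ∈ Finset.range (n + 1) ×ˢ Finset.range (n + 1),
        (if τ.2 = 0 then m₁ ⌊K * x⌋₊ τ.1 else 0) * (Int.fract (K * x) ^ τ.1 *
          Int.fract (K * y) ^ τ.2) = ∑ i ∈ Finset.range (n + 1),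
          m₁ ⌊K * x⌋₊ i * Int.fract (K * x) ^ i := by
      rw [Finset.sum_product]
      refine Finset.sum_congr rfl fun i _ => ?_
      rw [Finset.sum_eq_single 0]
      · simp
      · intro j _ hj; simp [hj]
      · simp
    have e2 : ∑ τ ∈ Finset.range (n + 1) ×ˢ Finset.range (n + 1),
        (if τ.1 = 0 then m₂ ⌊K * y⌋₊ τ.2 else 0) * (Int.fract (K * x) ^ τ.1 *
          Int.fract (K * y) ^ τ.2) = ∑ j ∈ Finset.range (n + 1),
          m₂ ⌊K * y⌋₊ j * Int.fract (K * y) ^ j := by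
      rw [Finset.sum_product_right]
      refine Finset.sum_congr rfl fun i _ => ?_
      rw [Finset.sum_eq_single 0]
      · simp
      · intro j _ hj; simp [hj]
      · simp
    have e0 : ∑ τ ∈ Finset.range (n + 1) ×ˢ Finset.range (n + 1),
        (if τ = (0, 0) then m₀ else 0) * (Int.fract (K * x) ^ τ.1 *
          Int.fract (K * y) ^ τ.2) = m₀ := by
      rw [Finset.sum_eq_single (0, 0)]
      · simp
      · intro τ _ hτ; simp [hτ]
      · simp
    rw [interactionPart, integral_piecewisePoly₂_right hM hcf, integral_piecewisePoly₂_left hM hcf]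
    conv_rhs => rw [piecewisePoly₂]
    simp only [add_mul, sub_mul, Finset.sum_add_distrib, Finset.sum_sub_distrib]
    rw [e1, e2, e0]
    rfl

/-! ### Exceptional sets of small measure -/

/-- All points outside a set of small measure avoid the grid. -/
lemma exists_avoidsGrid (R : ℕ) (hR : 0 < R) {τ : ℝ} (hτ : 0 < τ) :
    ∃ δ : ℝ, 0 < δ ∧ ∃ bad : Set ℝ, MeasurableSet bad ∧ unif.real bad ≤ τ ∧
      ∀ x ∈ Set.Ico (0 : ℝ) 1, x ∉ bad → AvoidsGrid R δ x := by
  set s : ℕ → Set ℝ := fun m => {x | 1 - 1 / ((m : ℝ) + 1) < Int.fract (R * x)} with hs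
  have hsm : ∀ m, MeasurableSet (s m) := fun m =>
    measurableSet_lt measurable_const (by fun_prop)
  have hanti : Antitone s := by
    intro m m' hmm x hx
    have : 1 / ((m' : ℝ) + 1) ≤ 1 / ((m : ℝ) + 1) := by gcongr
    simp only [hs, Set.mem_ofPred_eq] at hx ⊢
    linarith
  have hempty : ⋂ m, s m = ∅ := by
    refine Set.eq_empty_iff_forall_notMem.2 fun x hx => ?_
    obtain ⟨m, hm⟩ := exists_nat_one_div_lt (sub_pos.2 (Int.fract_lt_one ((R : ℝ) * x)))
    have := Set.mem_iInter.1 hx m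
    simp only [hs, Set.mem_ofPred_eq] at this
    linarith
  have hlim := tendsto_measure_iInter_atTop (μ := unif) (s := s)
    (fun m => (hsm m).nullMeasurableSet) hanti ⟨0, measure_ne_top _ _⟩
  rw [hempty, measure_empty] at hlim
  obtain ⟨m, hm⟩ := (hlim.eventually (gt_mem_nhds (ENNReal.ofReal_pos.2 hτ))).exists
  refine ⟨1 / ((m : ℝ) + 1), by positivity, s m, hsm m, ?_, fun x hx hxb => ?_⟩
  · exact ENNReal.toReal_le_of_le_ofReal hτ.le hm.le
  · obtain ⟨h1, h2, h3⟩ := grid_cell hR hx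
    refine ⟨⌊R * x⌋₊, Int.fract (R * x), h1, h2.1, ?_, h3.symm⟩
    simpa [hs] using hxb

/-- A function which is at most `ε` off a small set and bounded on it is small in `L²`. -/
lemma integral_sq_le_of_bad {α : Type*} [MeasurableSpace α] {μ : Measure α}
    [IsProbabilityMeasure μ] {u : α → ℝ} (hu : BddMeasurable u) {bad : Set α}
    (hbad : MeasurableSet bad) {ε M : ℝ} (hM : ∀ᵐ x ∂μ, |u x| ≤ M)
    (hε : ∀ᵐ x ∂μ, x ∉ bad → |u x| ≤ ε) :
    ∫ x, u x ^ 2 ∂μ ≤ ε ^ 2 + M ^ 2 * μ.real bad := by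
  have h1 : ∫ x, u x ^ 2 ∂μ ≤ ∫ x, (ε ^ 2 + bad.indicator (fun _ => M ^ 2) x) ∂μ := by
    refine integral_mono_ae ?_ ?_ ?_
    · simpa only [sq] using (hu.mul hu).integrable
    · exact (integrable_const _).add ((integrable_const _).indicator hbad)
    · filter_upwards [hM, hε] with x h1 h2
      by_cases hx : x ∈ bad
      · rw [Set.indicator_of_mem hx]
        have := sq_le_sq' (abs_le.1 h1).1 (abs_le.1 h1).2
        nlinarith [sq_nonneg ε]
      · rw [Set.indicator_of_notMem hx, add_zero]
        have h3 := h2 hx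
        exact sq_le_sq' (abs_le.1 h3).1 (abs_le.1 h3).2
  refine h1.trans (le_of_eq ?_)
  rw [integral_add (integrable_const _) ((integrable_const _).indicator hbad),
    integral_indicator_const _ hbad]
  simp [mul_comm]

lemma ReLUNet.continuous_eval {o : ℕ} : ∀ {m : ℕ} (net : ReLUNet o m), Continuous net.eval
  | _, .output A b => by
    have : (ReLUNet.output A b).eval = fun x => A.mulVec x + b := funext fun x => by rw [eval]
    rw [this]
    fun_prop
  | _, .hidden A b rest => by
    have h := continuous_eval rest
    have : (ReLUNet.hidden A b rest).eval =
        fun x => rest.eval (fun i => max ((A.mulVec x + b) i) 0) := funext fun x => by rw [eval]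
    rw [this]
    fun_prop

/-! ### Approximation of the components -/

lemma one_div_pow_le_rpow {q α : ℝ} (hq : 1 ≤ q) {s : ℕ} (hs : α ≤ s) :
    1 / q ^ s ≤ q ^ (-α) := by
  rw [one_div, ← Real.rpow_natCast, ← Real.rpow_neg (by linarith)]
  exact Real.rpow_le_rpow_of_exponent_le hq (by linarith)

lemma one_le_gridSize {N : ℕ} (hN : 2 ≤ N) (l : ℕ) : (1 : ℝ) ≤ (N * 2 ^ l : ℕ) := by
  have : 1 ≤ N * 2 ^ l := Nat.one_le_iff_ne_zero.2 (by positivity)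
  exact_mod_cast this

/-- Networks approximate a univariate Hölder smooth function in `L²` at the rate of a grid with
`(N * 2 ^ l) ^ 2` cells. -/
theorem exists_univariate_net {β : ℝ} (hβ : 0 < β) : ∃ n s : ℕ, ∀ H B : ℝ, 0 ≤ B →
    ∃ C : ℝ, 0 ≤ C ∧ ∀ N l : ℕ, 2 ≤ N → ∀ f F : ℝ → ℝ, HolderSmoothOn β H f (Set.Icc 0 1) →
      BddMeasurable F → (∀ x ∈ Set.Icc (0 : ℝ) 1, F x = f x) → (∀ x, |F x| ≤ B) →
      ∃ net : ReLUNet 1 1, net.width ≤ netConst n s * N ∧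
        net.depth = netConst n s * (2 ^ l * (l + 1)) ∧
        (BddMeasurable fun t => net.eval ![t] 0) ∧
        ∫ t, (F t - net.eval ![t] 0) ^ 2 ∂unif ≤ C * ((N * 2 ^ l : ℕ) : ℝ) ^ (-4 * β) := by
  obtain ⟨Λ, hΛ, hpoly⟩ := exists_piecewisePoly₁ hβ
  set n := ⌊β⌋₊ with hn
  -- with `s ≥ 2 * β` digits, rounding errors are of the order of `(N * 2 ^ l) ^ (-2 * β)`
  refine ⟨n, ⌈2 * β⌉₊, fun H B hB => ?_⟩
  set s := ⌈2 * β⌉₊ with hs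
  have hs' : 2 * β ≤ s := Nat.le_ceil _
  set M : ℝ := Λ * (B + |H|) + 1 with hM
  have hMpos : 0 < M := by positivity
  set E : ℝ := |H| + (n + 1) ^ 2 * ((2 * n + 1) * M) with hE
  have hE0 : 0 ≤ E := by positivity
  refine ⟨E ^ 2 + 1, by positivity, fun N l hN f F hf hFm hFf hFB => ?_⟩
  have hq := one_le_gridSize hN l
  set q : ℝ := ((N * 2 ^ l : ℕ) : ℝ) with hqdef
  have hq0 : 0 < q := by linarith
  have hK : 0 < (N * 2 ^ l) ^ 2 := by positivity
  obtain ⟨cf, hcf, happ⟩ := hpoly H B f hB hf (fun x hx => by rw [← hFf x hx]; exact hFB x) _ hK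
  set ε : ℝ := q ^ (-(2 * β)) with hε
  have hεpos : 0 < ε := Real.rpow_pos_of_pos hq0 _
  have hε2 : ε ^ 2 = q ^ (-4 * β) := by
    rw [hε, ← Real.rpow_natCast, ← Real.rpow_mul hq0.le]
    congr 1
    push_cast
    ring
  have hKε : (1 / (((N * 2 ^ l) ^ 2 : ℕ) : ℝ)) ^ β = ε := by
    rw [Nat.cast_pow, ← hqdef, one_div, ← Real.rpow_natCast, ← Real.rpow_neg hq0.le,
      ← Real.rpow_mul hq0.le, hε]
    congr 1
    push_cast
    ring
  -- the error is at most `M'` everywhere, and at most `E * ε` off a set of measure `ε ^ 2 / M' ^ 2`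
  set M' : ℝ := B + (n + 1) ^ 2 * M with hM'
  have hM'0 : 0 < M' := by positivity
  obtain ⟨δ, hδ, bad, hbadm, hbad, havoid⟩ := exists_avoidsGrid
    ((N * 2 ^ l) ^ 2 * (N * 2 ^ l) ^ s) (by positivity) (τ := ε ^ 2 / M' ^ 2) (by positivity)
  obtain ⟨net, hw, hd, hbdd, herr⟩ := exists_net_piecewisePoly₁ n s N l hN hMpos hδ cf
    (fun k i => (hcf k i).trans_lt (by rw [hM]; linarith))
  have hnetm : BddMeasurable fun t : ℝ => net.eval ![t] 0 := by
    refine ⟨?_, _, fun t => hbdd _⟩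
    have := net.continuous_eval
    have h2 : Continuous fun t : ℝ => (![t] : Fin 1 → ℝ) := by fun_prop
    exact ((continuous_apply 0).comp (this.comp h2)).measurable
  refine ⟨net, hw, hd, hnetm, ?_⟩
  have h1 : ∫ t, (F t - net.eval ![t] 0) ^ 2 ∂unif ≤ (E * ε) ^ 2 + M' ^ 2 * unif.real bad := by
    refine integral_sq_le_of_bad (hFm.sub hnetm) hbadm (Filter.Eventually.of_forall fun t => ?_) ?_
    · exact (abs_sub _ _).trans (add_le_add (hFB t) (hbdd _))
    · filter_upwards [ae_unif_mem] with t ht htb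
      have a1 := happ t ht
      have a2 := herr t (havoid t ht htb)
      rw [hKε] at a1
      rw [abs_sub_comm] at a2
      rw [← hFf t ⟨ht.1, ht.2.le⟩] at a1
      have a3 : (n + 1 : ℝ) ^ 2 * ((2 * n + 1) * M * (1 / q ^ s)) ≤
          (n + 1) ^ 2 * ((2 * n + 1) * M * ε) := by
        gcongr
        exact one_div_pow_le_rpow hq hs'
      have a4 := abs_sub_le (F t) (piecewisePoly₁ n ((N * 2 ^ l) ^ 2) cf t) (net.eval ![t] 0)
      calc _ ≤ |H| * ε + (n + 1) ^ 2 * ((2 * n + 1) * M * ε) := by linarith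
        _ = E * ε := by rw [hE]; ring
  refine h1.trans ?_
  have h2 : M' ^ 2 * unif.real bad ≤ ε ^ 2 := by
    calc M' ^ 2 * unif.real bad ≤ M' ^ 2 * (ε ^ 2 / M' ^ 2) := by gcongr
      _ = ε ^ 2 := by field_simp
  rw [← hε2]
  have e : (E ^ 2 + 1) * ε ^ 2 = (E * ε) ^ 2 + ε ^ 2 := by ring
  linarith

/-- A bivariate Hölder smooth function without marginals is approximated, at the rate of a grid
with `N * 2 ^ l` cells per axis, by a function `p` without marginals, which networks approximate
at the fourth power of this rate in mean square. -/
theorem exists_bivariate_net {β : ℝ} (hβ : 0 < β) : ∃ n s : ℕ, ∀ H B : ℝ, 0 ≤ B →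
    ∃ C : ℝ, 0 ≤ C ∧ ∀ N l : ℕ, 2 ≤ N → ∀ g G : ℝ → ℝ → ℝ,
      HolderSmoothOn β H (fun z : ℝ × ℝ => g z.1 z.2) (Set.Icc 0 1 ×ˢ Set.Icc 0 1) →
      (BddMeasurable fun z : ℝ × ℝ => G z.1 z.2) →
      (∀ x ∈ Set.Icc (0 : ℝ) 1, ∀ y ∈ Set.Icc (0 : ℝ) 1, G x y = g x y) →
      (∀ x y, |G x y| ≤ B) → (∀ y, ∫ x, G x y ∂unif = 0) → (∀ x, ∫ y, G x y ∂unif = 0) →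
      ∃ (p : ℝ → ℝ → ℝ) (net : ReLUNet 1 2), (BddMeasurable fun z : ℝ × ℝ => p z.1 z.2) ∧
        (∀ y, ∫ x, p x y ∂unif = 0) ∧ (∀ x, ∫ y, p x y ∂unif = 0) ∧
        (∀ x ∈ Set.Ico (0 : ℝ) 1, ∀ y ∈ Set.Ico (0 : ℝ) 1,
          |G x y - p x y| ≤ C * ((N * 2 ^ l : ℕ) : ℝ) ^ (-β)) ∧
        net.width ≤ netConst n s * N ∧ net.depth = netConst n s * (2 ^ l * (l + 1)) ∧
        (BddMeasurable fun z : ℝ × ℝ => net.eval ![z.1, z.2] 0) ∧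
        ∀ (d : ℕ) (j k : Fin d), ∫ x, (p (x j) (x k) - net.eval ![x j, x k] 0) ^ 2 ∂cubeUnif d ≤
          C * ((N * 2 ^ l : ℕ) : ℝ) ^ (-4 * β) := by
  obtain ⟨Λ, hΛ, hpoly⟩ := exists_piecewisePoly₂ hβ
  set n := ⌊β⌋₊ with hn
  -- with `s ≥ 2 * β` digits, rounding errors are of the order of `(N * 2 ^ l) ^ (-2 * β)`
  refine ⟨n, ⌈2 * β⌉₊, fun H B hB => ?_⟩
  set s := ⌈2 * β⌉₊ with hs
  have hs' : 2 * β ≤ s := Nat.le_ceil _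
  set M₀ : ℝ := Λ * (B + |H|) with hM₀
  have hM₀0 : 0 ≤ M₀ := by positivity
  set M : ℝ := 4 * (n + 1) ^ 2 * M₀ + 1 with hM
  have hMpos : 0 < M := by positivity
  set E : ℝ := (n + 1) ^ 2 * ((2 * n + 1) * M) with hE
  have hE0 : 0 ≤ E := by positivity
  refine ⟨4 * |H| + (E ^ 2 + 2), by positivity, fun N l hN g G hg hGm hGg hGB hGl hGr => ?_⟩
  have hq := one_le_gridSize hN l
  set q : ℝ := ((N * 2 ^ l : ℕ) : ℝ) with hqdef
  have hq0 : 0 < q := by linarith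
  have hK : 0 < N * 2 ^ l := by positivity
  obtain ⟨cf₀, hcf₀, happ⟩ := hpoly H B g hB hg
    (fun x hx y hy => by rw [← hGg x hx y hy]; exact hGB x y) _ hK
  -- `p` is the interaction part of the piecewise Taylor polynomial
  obtain ⟨cf, hcf, hint⟩ := exists_interactionPart_eq (n := n) (K := N * 2 ^ l) hM₀0 hcf₀
  have hQm := bddMeasurable_piecewisePoly₂ (n := n) (K := N * 2 ^ l) hM₀0 hcf₀
  have hMM : ∀ a b τ, |cf a b τ| < M := fun a b τ => (hcf a b τ).trans_lt (by rw [hM]; linarith)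
  set ε : ℝ := q ^ (-(2 * β)) with hε
  have hεpos : 0 < ε := Real.rpow_pos_of_pos hq0 _
  have hε2 : ε ^ 2 = q ^ (-4 * β) := by
    rw [hε, ← Real.rpow_natCast, ← Real.rpow_mul hq0.le]
    congr 1
    push_cast
    ring
  have hqβ : 0 < q ^ (-β) := Real.rpow_pos_of_pos hq0 _
  -- the error is at most `M'` everywhere, and at most `E * ε` unless one of the two coordinates
  -- lies in a set of measure `ε ^ 2 / M' ^ 2`
  set M' : ℝ := (n + 1) ^ 2 * M + (n + 1) ^ 2 * M with hM'
  have hM'0 : 0 < M' := by positivity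
  obtain ⟨δ, hδ, bad, hbadm, hbad, havoid⟩ := exists_avoidsGrid
    (N * 2 ^ l * (N * 2 ^ l) ^ s) (by positivity) (τ := ε ^ 2 / M' ^ 2) (by positivity)
  obtain ⟨net, hw, hd, hbdd, herr⟩ := exists_net_piecewisePoly₂ n s N l hN hMpos hδ cf hMM
  have hnetm : BddMeasurable fun z : ℝ × ℝ => net.eval ![z.1, z.2] 0 := by
    refine ⟨?_, _, fun t => hbdd _⟩
    have := net.continuous_eval
    have h2 : Continuous fun z : ℝ × ℝ => (![z.1, z.2] : Fin 2 → ℝ) := by fun_prop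
    exact ((continuous_apply 0).comp (this.comp h2)).measurable
  have hpm : BddMeasurable fun z : ℝ × ℝ => piecewisePoly₂ n (N * 2 ^ l) cf z.1 z.2 :=
    bddMeasurable_piecewisePoly₂ hMpos.le fun a b τ => (hMM a b τ).le
  refine ⟨piecewisePoly₂ n (N * 2 ^ l) cf, net, hpm, fun y => ?_, fun x => ?_, ?_, hw, hd, hnetm, ?_⟩
  · simp only [← hint]
    exact integral_interactionPart_left hQm y
  · simp only [← hint]
    exact integral_interactionPart_right hQm x
  · intro x hx y hy
    rw [← hint]
    refine (abs_sub_interactionPart_le hGm hQm hGl hGr (ε := |H| * q ^ (-β))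
      (fun x hx y hy => ?_) x hx y hy).trans ?_
    · have a1 := happ x hx y hy
      rw [← hGg x ⟨hx.1, hx.2.le⟩ y ⟨hy.1, hy.2.le⟩] at a1
      rwa [one_div, ← hqdef, Real.inv_rpow hq0.le, ← Real.rpow_neg hq0.le] at a1
    · have : 0 ≤ (E ^ 2 + 2) * q ^ (-β) := by positivity
      linarith
  · intro d j k
    have hm2 : Measurable fun x : Fin d → ℝ => (x j, x k) :=
      (measurable_pi_apply j).prodMk (measurable_pi_apply k)
    set bad₂ : Set (Fin d → ℝ) := (fun x => x j) ⁻¹' bad ∪ (fun x => x k) ⁻¹' bad with hbad₂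
    have hmeas : ∀ i : Fin d, (cubeUnif d).real ((fun x => x i) ⁻¹' bad) = unif.real bad := fun i =>
      (measurePreserving_eval (fun _ : Fin d => unif) i).measureReal_preimage
        hbadm.nullMeasurableSet
    have hbad₂m : (cubeUnif d).real bad₂ ≤ 2 * (ε ^ 2 / M' ^ 2) := by
      refine (measureReal_union_le _ _).trans ?_
      rw [hmeas, hmeas]
      linarith
    have h1 : ∫ x, (piecewisePoly₂ n (N * 2 ^ l) cf (x j) (x k) - net.eval ![x j, x k] 0) ^ 2
        ∂cubeUnif d ≤ (E * ε) ^ 2 + M' ^ 2 * (cubeUnif d).real bad₂ := by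
      refine integral_sq_le_of_bad ((hpm.sub hnetm).comp hm2)
        ((measurable_pi_apply j hbadm).union (measurable_pi_apply k hbadm))
        (Filter.Eventually.of_forall fun x => ?_) ?_
      · exact (abs_sub _ _).trans (add_le_add
          (abs_piecewisePoly₂_le hMpos.le (fun a b τ => (hMM a b τ).le) _ _) (hbdd _))
      · filter_upwards [ae_cubeUnif_mem j, ae_cubeUnif_mem k] with x hxj hxk hxb
        rw [Set.mem_union, not_or] at hxb
        have a2 := herr _ _ (havoid _ hxj hxb.1) (havoid _ hxk hxb.2)
        rw [abs_sub_comm] at a2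
        refine a2.trans ?_
        calc (n + 1 : ℝ) ^ 2 * ((2 * n + 1) * M * (1 / q ^ s)) ≤
            (n + 1) ^ 2 * ((2 * n + 1) * M * ε) := by
              gcongr
              exact one_div_pow_le_rpow hq hs'
          _ = E * ε := by rw [hE]; ring
    refine h1.trans ?_
    have h2 : M' ^ 2 * (cubeUnif d).real bad₂ ≤ 2 * ε ^ 2 := by
      calc M' ^ 2 * (cubeUnif d).real bad₂ ≤ M' ^ 2 * (2 * (ε ^ 2 / M' ^ 2)) := by gcongr
        _ = 2 * ε ^ 2 := by field_simp
    rw [← hε2]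
    have : 0 ≤ 4 * |H| * ε ^ 2 := by positivity
    have e : (4 * |H| + (E ^ 2 + 2)) * ε ^ 2 = 4 * |H| * ε ^ 2 + ((E * ε) ^ 2 + 2 * ε ^ 2) := by
      ring
    linarith

/-! ### Components on the whole line -/

/-- A Hölder smooth function is continuous, being close to its Taylor polynomials. -/
lemma HolderSmoothOn.continuousOn {E : Type*} [NormedAddCommGroup E] [NormedSpace ℝ E]
    {β H : ℝ} {f : E → ℝ} {s : Set E} (hf : HolderSmoothOn β H f s) (hβ : 0 < β)
    (hs : Convex ℝ s) : ContinuousOn f s := by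
  intro x₀ hx₀
  set T : E → ℝ := fun x => ∑ m ∈ Finset.range (⌊β⌋₊ + 1),
    iteratedFDerivWithin ℝ m f s x₀ (fun _ => x - x₀) * (m.factorial : ℝ)⁻¹ with hT
  have hTc : Continuous T := by
    refine continuous_finsetSum _ fun m _ => Continuous.mul ?_ continuous_const
    exact (iteratedFDerivWithin ℝ m f s x₀).cont.comp (by fun_prop)
  have hb : ∀ x ∈ s, |f x - T x| ≤ |H| * ‖x - x₀‖ ^ β := fun x hx =>
    hf.abs_sub_taylor_le hβ hs hx₀ hx
  have h0 : T x₀ = f x₀ := by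
    have := hb x₀ hx₀
    rw [sub_self, norm_zero, Real.zero_rpow hβ.ne', mul_zero] at this
    have := abs_nonpos_iff.1 this
    linarith
  have h1 : Filter.Tendsto (fun x => f x - T x) (nhdsWithin x₀ s) (nhds 0) := by
    have h2 : Filter.Tendsto (fun x => |H| * ‖x - x₀‖ ^ β) (nhdsWithin x₀ s) (nhds 0) := by
      have h3 : Continuous fun x : E => |H| * ‖x - x₀‖ ^ β :=
        continuous_const.mul ((by fun_prop : Continuous fun x : E => ‖x - x₀‖).rpow_const
          fun _ => Or.inr hβ.le)
      have := (h3.tendsto x₀).mono_left (nhdsWithin_le_nhds (s := s))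
      simpa [Real.zero_rpow hβ.ne'] using this
    refine squeeze_zero_norm' ?_ h2
    filter_upwards [self_mem_nhdsWithin] with x hx using hb x hx
  have h4 := h1.add ((hTc.tendsto x₀).mono_left (nhdsWithin_le_nhds (s := s)))
  simpa [ContinuousWithinAt, h0] using h4

/-- The point of the unit interval nearest to `t`. -/
def unitClamp (t : ℝ) : ℝ := max 0 (min 1 t)

lemma continuous_unitClamp : Continuous unitClamp := by unfold unitClamp; fun_prop

lemma unitClamp_mem (t : ℝ) : unitClamp t ∈ Set.Icc (0 : ℝ) 1 :=
  ⟨le_max_left _ _, max_le zero_le_one (min_le_left _ _)⟩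

lemma unitClamp_of_mem {t : ℝ} (ht : t ∈ Set.Icc (0 : ℝ) 1) : unitClamp t = t := by
  rw [unitClamp, min_eq_right ht.2, max_eq_right ht.1]

lemma bddMeasurable_comp_of_continuousOn {α E : Type*} [TopologicalSpace α] [MeasurableSpace α]
    [OpensMeasurableSpace α] [TopologicalSpace E] {f : E → ℝ} {s : Set E} (hs : IsCompact s)
    (hf : ContinuousOn f s) {φ : α → E} (hφ : Continuous φ) (hφs : ∀ a, φ a ∈ s) :
    BddMeasurable fun a => f (φ a) := by
  obtain ⟨C, hC⟩ := hs.exists_bound_of_continuousOn hf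
  exact ⟨(hf.comp_continuous hφ hφs).measurable, C, fun a => hC _ (hφs a)⟩

lemma integral_comp_unitClamp (u : ℝ → ℝ) :
    ∫ t, u (unitClamp t) ∂unif = ∫ t in (0 : ℝ)..1, u t := by
  rw [intervalIntegral_eq_unif]
  refine integral_congr_ae ?_
  filter_upwards [ae_unif_mem] with t ht
  simp only [unitClamp_of_mem ⟨ht.1, ht.2.le⟩]

/-- The components of an interaction model extend to bounded measurable functions on the line and
the plane, which keep the vanishing integrals and inherit a bound from the mean function. -/
lemma InteractionModel.exists_extension {β₁ β₂ H B : ℝ} (hβ₁ : 0 < β₁) (hβ₂ : 0 < β₂) {d : ℕ}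
    {f : Fin d → ℝ → ℝ} {g : Fin d → Fin d → ℝ → ℝ → ℝ} (h : InteractionModel β₁ β₂ H B f g) :
    ∃ (F : Fin d → ℝ → ℝ) (G : Fin d → Fin d → ℝ → ℝ → ℝ),
      (∀ j, BddMeasurable (F j)) ∧
      (∀ j k, j < k → BddMeasurable fun z : ℝ × ℝ => G j k z.1 z.2) ∧
      (∀ j, ∀ x ∈ Set.Icc (0 : ℝ) 1, F j x = f j x) ∧
      (∀ j k, ∀ x ∈ Set.Icc (0 : ℝ) 1, ∀ y ∈ Set.Icc (0 : ℝ) 1, G j k x y = g j k x y) ∧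
      (∀ j, ∫ t, F j t ∂unif = 0) ∧
      (∀ j k, j < k → ∀ y, ∫ x, G j k x y ∂unif = 0) ∧
      (∀ j k, j < k → ∀ x, ∫ y, G j k x y ∂unif = 0) ∧
      (∀ j t, |F j t| ≤ B) ∧ ∀ j k, j < k → ∀ x y, |G j k x y| ≤ 3 * B := by
  have hF : ∀ j, BddMeasurable fun t => f j (unitClamp t) := fun j =>
    bddMeasurable_comp_of_continuousOn isCompact_Icc
      ((h.smooth₁ j).continuousOn hβ₁ (convex_Icc 0 1)) continuous_unitClamp unitClamp_mem
  have hG : ∀ j k, j < k →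
      BddMeasurable fun z : ℝ × ℝ => g j k (unitClamp z.1) (unitClamp z.2) := fun j k hjk =>
    bddMeasurable_comp_of_continuousOn (f := fun z : ℝ × ℝ => g j k z.1 z.2)
      (isCompact_Icc.prod isCompact_Icc)
      ((h.smooth₂ j k hjk).continuousOn hβ₂ ((convex_Icc 0 1).prod (convex_Icc 0 1)))
      (φ := fun z : ℝ × ℝ => (unitClamp z.1, unitClamp z.2))
      ((continuous_unitClamp.comp continuous_fst).prodMk
        (continuous_unitClamp.comp continuous_snd))
      fun z => ⟨unitClamp_mem _, unitClamp_mem _⟩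
  have hF0 : ∀ j, ∫ t, f j (unitClamp t) ∂unif = 0 := fun j => by
    rw [integral_comp_unitClamp, h.integral_zero]
  have hG1 : ∀ j k, j < k → ∀ y, ∫ x, g j k (unitClamp x) (unitClamp y) ∂unif = 0 :=
    fun j k hjk y => by
      rw [integral_comp_unitClamp fun x => g j k x (unitClamp y),
        h.marginal_fst j k hjk _ (unitClamp_mem y)]
  have hG2 : ∀ j k, j < k → ∀ x, ∫ y, g j k (unitClamp x) (unitClamp y) ∂unif = 0 :=
    fun j k hjk x => by
      rw [integral_comp_unitClamp fun y => g j k (unitClamp x) y,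
        h.marginal_snd j k hjk _ (unitClamp_mem x)]
  have hb := abs_component_le hF hG hF0 hG1 hG2 (B := B) fun x =>
    h.bounded (fun i => unitClamp (x i))
      ⟨fun i => (unitClamp_mem (x i)).1, fun i => (unitClamp_mem (x i)).2⟩
  exact ⟨_, _, hF, hG, fun j x hx => by rw [unitClamp_of_mem hx],
    fun j k x hx y hy => by rw [unitClamp_of_mem hx, unitClamp_of_mem hy],
    hF0, hG1, hG2, hb.1, hb.2⟩

/-! ### Membership in the structured classes -/

lemma log_two_le_log {N : ℕ} (hN : 2 ≤ N) : Real.log 2 ≤ Real.log N :=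
  Real.log_le_log (by norm_num) (by exact_mod_cast hN)

lemma natCast_mul_le_nlogn {N a A : ℕ} (hN : 2 ≤ N) (ha : a ≤ A) :
    ((a * N : ℕ) : ℝ) ≤ A / Real.log 2 * nlogn N := by
  have h2 : 0 < Real.log 2 := Real.log_pos (by norm_num)
  have h1 := log_two_le_log hN
  have h3 : (a : ℝ) ≤ A := by exact_mod_cast ha
  have e : (A : ℝ) / Real.log 2 * nlogn N = A * N * (Real.log N / Real.log 2) := by
    rw [nlogn]; ring
  have h4 : 1 ≤ Real.log N / Real.log 2 := (one_le_div h2).2 h1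
  rw [e, Nat.cast_mul]
  calc (a : ℝ) * N ≤ A * N := by gcongr
    _ ≤ A * N * (Real.log N / Real.log 2) := le_mul_of_one_le_right (by positivity) h4

lemma le_two_pow_clog (L : ℕ) : L ≤ 2 ^ Nat.clog 2 L := Nat.le_pow_clog (by norm_num) L

/-- Networks with `2 ^ l * (l + 1)` layers, where `2 ^ l` is `L` rounded up to a power of two,
have depth of order `L * log L`. -/
lemma natCast_depth_le_nlogn {L a A : ℕ} (hL : 2 ≤ L) (ha : a ≤ A) :
    ((a * (2 ^ Nat.clog 2 L * (Nat.clog 2 L + 1)) : ℕ) : ℝ) ≤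
      6 * A / Real.log 2 * nlogn L := by
  set l := Nat.clog 2 L with hl
  have h2 : 0 < Real.log 2 := Real.log_pos (by norm_num)
  have h3 : (a : ℝ) ≤ A := by exact_mod_cast ha
  have hpos : 0 < l := Nat.clog_pos (by norm_num) hL
  have hpow : (2 : ℝ) ^ l ≤ 2 * L := by
    have h4 : 2 ^ (l - 1) < L := Nat.pow_pred_clog_lt_self (by norm_num) hL
    have h5 : 2 ^ l = 2 * 2 ^ (l - 1) := by
      rw [← pow_succ']; congr 1; omega
    have : 2 ^ l ≤ 2 * L := by omega
    exact_mod_cast this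
  have hlog : (l : ℝ) * Real.log 2 ≤ Real.log 2 + Real.log L := by
    have hL0 : (L : ℝ) ≠ 0 := by positivity
    rw [← Real.log_pow, ← Real.log_mul (by norm_num) hL0]
    exact Real.log_le_log (by positivity) hpow
  have hl1 : (l : ℝ) + 1 ≤ 3 * (Real.log L / Real.log 2) := by
    rw [← mul_div_assoc, le_div_iff₀ h2]
    nlinarith [log_two_le_log hL]
  have e : 6 * (A : ℝ) / Real.log 2 * nlogn L =
      A * (2 * L * (3 * (Real.log L / Real.log 2))) := by
    rw [nlogn]; ring
  rw [e]
  push_cast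
  gcongr

/-- A bound for the number of weights of a fully connected network of width `w` and depth `D`. -/
def fullWeights (w D : ℕ) : ℕ := (D + 1) * ((w + 1) * (w + 1))

lemma fullWeights_le {w D : ℕ} (hw : 1 ≤ w) (hD : 1 ≤ D) {x y : ℝ} (hx : (w : ℝ) ≤ x)
    (hy : (D : ℝ) ≤ y) : (fullWeights w D : ℝ) ≤ 8 * (x ^ 2 * y) := by
  have h1 : fullWeights w D ≤ 8 * (w ^ 2 * D) := by
    calc (D + 1) * ((w + 1) * (w + 1)) ≤ (2 * D) * ((2 * w) * (2 * w)) :=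
          Nat.mul_le_mul (by omega) (Nat.mul_le_mul (by omega) (by omega))
      _ = 8 * (w ^ 2 * D) := by ring
  calc (fullWeights w D : ℝ) ≤ (8 * (w ^ 2 * D) : ℕ) := by exact_mod_cast h1
    _ = 8 * ((w : ℝ) ^ 2 * D) := by push_cast; ring
    _ ≤ 8 * (x ^ 2 * y) := by gcongr

/-- The depth of the component networks for the parameter `L`, which is rounded up to a power of
two. -/
def netDepth (a L : ℕ) : ℕ := a * (2 ^ Nat.clog 2 L * (Nat.clog 2 L + 1))

/-- The factor of `N * log N` in the bound on the width, for networks of width at most `A * N`. -/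
def widthConst (A : ℕ) : ℝ := A / Real.log 2

/-- The factor of `L * log L` in the bound on the depth, for networks of depth `netDepth A L`. -/
def depthConst (A : ℕ) : ℝ := 6 * A / Real.log 2

/-- The factor in the bound on the number of weights, by `fullWeights_le`. -/
def weightConst (A : ℕ) : ℝ := 8 * (widthConst A ^ 2 * depthConst A)

section Classes

variable {a A N L d : ℕ}

lemma fullWeights_le_nlogn (ha : 1 ≤ a) (haA : a ≤ A) (hN : 2 ≤ N) (hL : 2 ≤ L) :
    (fullWeights (a * N) (netDepth a L) : ℝ) ≤ weightConst A * nlogn N ^ 2 * nlogn L := by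
  have h1 : 1 ≤ a * N := Nat.mul_pos ha (by omega)
  have h2 : 1 ≤ netDepth a L := Nat.mul_pos ha (by positivity)
  refine (fullWeights_le h1 h2 (natCast_mul_le_nlogn hN haA)
    (natCast_depth_le_nlogn hL haA)).trans (le_of_eq ?_)
  rw [weightConst, widthConst, depthConst]
  ring

lemma ReLUNet.activeWeights_le_fullWeights {m : ℕ} (hm : m ≤ 2) (ha : 1 ≤ a) (hN : 2 ≤ N)
    {net : ReLUNet 1 m} (hw : net.width ≤ a * N) (hd : net.depth = netDepth a L) :
    net.activeWeights ≤ fullWeights (a * N) (netDepth a L) := by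
  have := net.activeWeights_le (a * N) (hm.trans (hN.trans (Nat.le_mul_of_pos_left _ ha))) hw
  rwa [hd] at this

lemma ReLUNet.eval_mem_FNN {m : ℕ} (hm : m ≤ 2) (ha : 1 ≤ a) (haA : a ≤ A) (hN : 2 ≤ N)
    (hL : 2 ≤ L) {net : ReLUNet 1 m} (hw : net.width ≤ a * N) (hd : net.depth = netDepth a L) :
    net.eval ∈ FNN m (widthConst A * nlogn N) (depthConst A * nlogn L)
      (weightConst A * nlogn N ^ 2 * nlogn L) 1 := by
  refine ⟨net, ?_, ?_, ?_, rfl⟩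
  · exact (Nat.cast_le.2 hw).trans (natCast_mul_le_nlogn hN haA)
  · rw [hd]
    exact natCast_depth_le_nlogn hL haA
  · exact (Nat.cast_le.2 (activeWeights_le_fullWeights hm ha hN hw hd)).trans
      (fullWeights_le_nlogn ha haA hN hL)

/-- Sums of networks in at most two of the `d` coordinates. -/
lemma sum_mem_FNN {ι : Type*} {m : ℕ} (hm : m ≤ 2) (ha : 1 ≤ a) (haA : a ≤ A) (hN : 2 ≤ N)
    (hL : 2 ≤ L) (S : Finset ι) (net : ι → ReLUNet 1 m) (σ : ι → Fin m → Fin d)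
    (hw : ∀ i ∈ S, (net i).width ≤ a * N) (hd : ∀ i ∈ S, (net i).depth = netDepth a L)
    {D : ℝ} (hD : (S.card : ℝ) ≤ D) :
    (fun x (_ : Fin 1) => ∑ i ∈ S, (net i).eval (fun p => x (σ i p)) 0) ∈
      FNN d (widthConst A * D * nlogn N) (depthConst A * nlogn L)
        (weightConst A * D * nlogn N ^ 2 * nlogn L) 1 := by
  obtain ⟨Φ, h1, h2, h3, h4⟩ := ReLUNet.exists_finset_sum S (netDepth a L) (a * N)
    (fullWeights (a * N) (netDepth a L)) net σ hd hw
    fun i hi => ReLUNet.activeWeights_le_fullWeights hm ha hN (hw i hi) (hd i hi)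
  refine ⟨Φ, ?_, ?_, ?_, ?_⟩
  · have h5 := natCast_mul_le_nlogn hN haA
    calc (Φ.width : ℝ) ≤ (S.card * (a * N) : ℕ) := Nat.cast_le.2 h2
      _ = S.card * (a * N : ℕ) := Nat.cast_mul _ _
      _ ≤ D * (widthConst A * nlogn N) := by
        refine mul_le_mul hD h5 (Nat.cast_nonneg _) ((Nat.cast_nonneg _).trans hD)
      _ = _ := by ring
  · rw [h1]
    exact natCast_depth_le_nlogn hL haA
  · have h5 := fullWeights_le_nlogn ha haA hN hL
    calc (Φ.activeWeights : ℝ) ≤ (S.card * fullWeights (a * N) (netDepth a L) : ℕ) :=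
          Nat.cast_le.2 h3
      _ = S.card * (fullWeights (a * N) (netDepth a L) : ℝ) := Nat.cast_mul _ _
      _ ≤ D * (weightConst A * nlogn N ^ 2 * nlogn L) := by
        refine mul_le_mul hD h5 (Nat.cast_nonneg _) ((Nat.cast_nonneg _).trans hD)
      _ = _ := by ring
  · funext x i
    rw [h4, Subsingleton.elim i 0, Finset.sum_apply]

lemma sum_mem_FNN1 (ha : 1 ≤ a) (haA : a ≤ A) (hN : 2 ≤ N) (hL : 2 ≤ L)
    (net : Fin d → ReLUNet 1 1) (hw : ∀ j, (net j).width ≤ a * N)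
    (hd : ∀ j, (net j).depth = netDepth a L) :
    (fun x => ∑ j, (net j).eval ![x j] 0) ∈
      FNN1 (widthConst A) (depthConst A) (weightConst A) d N L := by
  refine ⟨?_, fun j => (net j).eval,
    fun j => ReLUNet.eval_mem_FNN one_le_two ha haA hN hL (hw j) (hd j), fun x => rfl⟩
  have h := sum_mem_FNN (d := d) one_le_two ha haA hN hL Finset.univ net (fun j _ => j)
    (fun j _ => hw j) (fun j _ => hd j) (D := d) (by simp)
  have e : ∀ (x : Fin d → ℝ) j, (fun _ : Fin 1 => x j) = ![x j] := fun x j => by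
    ext i; fin_cases i; rfl
  simpa only [e] using h

lemma sum_mem_FNN2 (ha : 1 ≤ a) (haA : a ≤ A) (hN : 2 ≤ N) (hL : 2 ≤ L)
    (net : Fin d → Fin d → ReLUNet 1 2) (hw : ∀ j k, j < k → (net j k).width ≤ a * N)
    (hd : ∀ j k, j < k → (net j k).depth = netDepth a L) :
    (fun x => ∑ j, ∑ k ∈ Finset.Ioi j, (net j k).eval ![x j, x k] 0) ∈
      FNN2 (widthConst A) (depthConst A) (weightConst A) d N L := by
  refine ⟨?_, fun j k => (net j k).eval,
    fun j k hjk => ReLUNet.eval_mem_FNN le_rfl ha haA hN hL (hw j k hjk) (hd j k hjk),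
    fun x => rfl⟩
  have hD : ((pairs d).card : ℝ) ≤ (d : ℝ) ^ 2 := by
    rw [card_pairs]
    exact_mod_cast Nat.choose_le_pow d 2
  have h := sum_mem_FNN (d := d) le_rfl ha haA hN hL (pairs d) (fun p => net p.1 p.2)
    (fun p => ![p.1, p.2]) (fun p hp => hw _ _ (mem_pairs.1 hp))
    (fun p hp => hd _ _ (mem_pairs.1 hp)) hD
  have e : ∀ (x : Fin d → ℝ) (p : Fin d × Fin d),
      (fun i : Fin 2 => x (![p.1, p.2] i)) = ![x p.1, x p.2] := fun x p => by
    ext i; fin_cases i <;> rfl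
  simpa only [e, sum_pairs] using h

end Classes

/-! ### Approximation of the two parts of the mean function -/

lemma rpow_clog_le {N L : ℕ} (hN : 2 ≤ N) (hL : 2 ≤ L) {γ : ℝ} (hγ : γ ≤ 0) :
    ((N * 2 ^ Nat.clog 2 L : ℕ) : ℝ) ^ γ ≤ ((N : ℝ) * L) ^ γ := by
  refine Real.rpow_le_rpow_of_nonpos (by positivity) ?_ hγ
  exact_mod_cast Nat.mul_le_mul_left N (le_two_pow_clog L)

lemma integral_comp_eval {d : ℕ} (j : Fin d) {u : ℝ → ℝ} (hu : Measurable u) :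
    ∫ x, u (x j) ∂cubeUnif d = ∫ t, u t ∂unif := by
  have h := (measurePreserving_eval (fun _ : Fin d => unif) j).map_eq
  rw [← h, integral_map (measurable_pi_apply j).aemeasurable hu.aestronglyMeasurable]
  rfl

/-- Subtracting the mean does not increase the second moment. -/
lemma integral_sq_sub_integral_le {u : ℝ → ℝ} (hu : BddMeasurable u) :
    ∫ t, (u t - ∫ s, u s ∂unif) ^ 2 ∂unif ≤ ∫ t, u t ^ 2 ∂unif := by
  set m := ∫ s, u s ∂unif with hm
  have h1 : ∀ t, (u t - m) ^ 2 = (u t * u t - 2 * m * u t) + m ^ 2 := fun t => by ring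
  have h2 : ∫ t, (u t - m) ^ 2 ∂unif = ∫ t, u t * u t ∂unif - m ^ 2 := by
    simp only [h1]
    rw [integral_add ((hu.mul hu).sub ((BddMeasurable.const _).mul hu)).integrable
      (integrable_const _), integral_sub (hu.mul hu).integrable
      ((BddMeasurable.const _).mul hu).integrable, integral_const_mul, ← hm]
    simp
    ring
  have h3 : ∫ t, u t ^ 2 ∂unif = ∫ t, u t * u t ∂unif := by simp only [sq]
  rw [h2, h3]
  nlinarith [sq_nonneg m]

/-- The errors of the univariate networks, once centered, are orthogonal, so that their mean
squares add up. -/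
theorem exists_univariate_sum {β : ℝ} (hβ : 0 < β) : ∃ a : ℕ, 1 ≤ a ∧ ∀ H B : ℝ, 0 ≤ B →
    ∃ C : ℝ, 0 ≤ C ∧ ∀ A, a ≤ A → ∀ d N L : ℕ, 2 ≤ N → 2 ≤ L → ∀ f F : Fin d → ℝ → ℝ,
      (∀ j, HolderSmoothOn β H (f j) (Set.Icc 0 1)) → (∀ j, BddMeasurable (F j)) →
      (∀ j, ∀ x ∈ Set.Icc (0 : ℝ) 1, F j x = f j x) → (∀ j x, |F j x| ≤ B) →
      (∀ j, ∫ t, F j t ∂unif = 0) →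
      ∃ φ ∈ FNN1 (widthConst A) (depthConst A) (weightConst A) d N L,
        (BddMeasurable fun x => ∑ j, F j (x j) - φ x) ∧
        ∫ x, (∑ j, F j (x j) - φ x) ^ 2 ∂cubeUnif d ≤ C * (d * ((N : ℝ) * L) ^ (-4 * β)) := by
  obtain ⟨n, s, hnet⟩ := exists_univariate_net hβ
  refine ⟨netConst n s, by unfold netConst; omega, fun H B hB => ?_⟩
  obtain ⟨C, hC, hnet⟩ := hnet H B hB
  refine ⟨C, hC, fun A hA d N L hN hL f F hf hFm hFf hFB hF0 => ?_⟩
  choose net₀ hw₀ hd₀ hm₀ herr using fun j =>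
    hnet N (Nat.clog 2 L) hN (f j) (F j) (hf j) (hFm j) (hFf j) (hFB j)
  have hu : ∀ j, BddMeasurable fun t => F j t - (net₀ j).eval ![t] 0 :=
    fun j => (hFm j).sub (hm₀ j)
  -- adding the mean of the error to the output bias makes the error centered
  choose net hd hw hev using fun j =>
    (net₀ j).exists_add_const (∫ t, (F j t - (net₀ j).eval ![t] 0) ∂unif)
  set e : Fin d → ℝ → ℝ := fun j t => (F j t - (net₀ j).eval ![t] 0) -
    ∫ s, (F j s - (net₀ j).eval ![s] 0) ∂unif with he
  have hem : ∀ j, BddMeasurable (e j) := fun j => (hu j).sub (.const _)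
  have hsum : ∀ x : Fin d → ℝ,
      ∑ j, F j (x j) - ∑ j, (net j).eval ![x j] 0 = ∑ j, e j (x j) := fun x => by
    rw [← Finset.sum_sub_distrib]
    refine Finset.sum_congr rfl fun j _ => ?_
    rw [hev]
    simp only [he]
    ring
  refine ⟨_, sum_mem_FNN1 (by unfold netConst; omega) hA hN hL net
    (fun j => (hw j).trans_le (hw₀ j)) fun j => (hd j).trans (hd₀ j), ?_, ?_⟩
  · simp only [hsum]
    exact BddMeasurable.sum fun j _ => (hem j).comp (measurable_pi_apply j)
  · simp only [hsum]
    rw [integral_sq_sum_univariate e hem fun j => by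
      simp only [he]
      rw [integral_sub (hu j).integrable (integrable_const _)]
      simp]
    calc ∑ j, ∫ x, e j (x j) ^ 2 ∂cubeUnif d
        ≤ ∑ _j : Fin d, C * ((N : ℝ) * L) ^ (-4 * β) := by
          refine Finset.sum_le_sum fun j _ => ?_
          rw [integral_comp_eval j (u := fun t => e j t ^ 2) ((hem j).1.pow_const 2)]
          refine ((integral_sq_sub_integral_le (hu j)).trans (herr j)).trans ?_
          exact mul_le_mul_of_nonneg_left (rpow_clog_le hN hL (by linarith)) hC
      _ = C * (d * ((N : ℝ) * L) ^ (-4 * β)) := by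
          rw [Finset.sum_const, Finset.card_univ, Fintype.card_fin, nsmul_eq_mul]
          ring

lemma integral_sq_add_le {α : Type*} [MeasurableSpace α] {μ : Measure α} [IsFiniteMeasure μ]
    {u v : α → ℝ} (hu : BddMeasurable u) (hv : BddMeasurable v) :
    ∫ x, (u x + v x) ^ 2 ∂μ ≤ 2 * (∫ x, u x ^ 2 ∂μ + ∫ x, v x ^ 2 ∂μ) := by
  simp only [sq]
  rw [← integral_add (hu.mul hu).integrable (hv.mul hv).integrable, ← integral_const_mul]
  refine integral_mono ((hu.add hv).mul (hu.add hv)).integrable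
    (((hu.mul hu).add (hv.mul hv)).integrable.const_mul 2) fun x => ?_
  nlinarith [sq_nonneg (u x - v x)]

/-- A square of a sum over pairs, without any orthogonality. -/
lemma integral_sq_sum_le {α ι : Type*} [MeasurableSpace α] {μ : Measure α} [IsFiniteMeasure μ]
    (S : Finset ι) {u : ι → α → ℝ} (hu : ∀ i ∈ S, BddMeasurable (u i)) {R : ℝ}
    (hR : ∀ i ∈ S, ∫ x, u i x ^ 2 ∂μ ≤ R) :
    ∫ x, (∑ i ∈ S, u i x) ^ 2 ∂μ ≤ (S.card : ℝ) ^ 2 * R := by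
  have hu2 : ∀ i ∈ S, BddMeasurable fun x => u i x ^ 2 := fun i hi => by
    simpa only [sq] using (hu i hi).mul (hu i hi)
  have hs2 : BddMeasurable fun x => (∑ i ∈ S, u i x) ^ 2 := by
    simpa only [sq] using (BddMeasurable.sum hu).mul (BddMeasurable.sum hu)
  calc ∫ x, (∑ i ∈ S, u i x) ^ 2 ∂μ ≤ ∫ x, S.card * ∑ i ∈ S, u i x ^ 2 ∂μ :=
        integral_mono hs2.integrable ((BddMeasurable.sum hu2).integrable.const_mul _)
          fun x => sq_sum_le_card_mul_sum_sq
    _ = S.card * ∑ i ∈ S, ∫ x, u i x ^ 2 ∂μ := by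
        rw [integral_const_mul, integral_finsetSum _ fun i hi => (hu2 i hi).integrable]
    _ ≤ S.card * ∑ _i ∈ S, R := by
        gcongr with i hi
        exact hR i hi
    _ = (S.card : ℝ) ^ 2 * R := by
        rw [Finset.sum_const, nsmul_eq_mul]
        ring

/-- The errors of the piecewise polynomials without marginals are orthogonal. Those of the
networks which compute them are not, but they are smaller by a whole power of the rate, which
makes up for the number of pairs. -/
theorem exists_bivariate_sum {β : ℝ} (hβ : 0 < β) : ∃ a : ℕ, 1 ≤ a ∧ ∀ H B K : ℝ, 0 ≤ B →
    ∃ C : ℝ, 0 ≤ C ∧ ∀ A, a ≤ A → ∀ d N L : ℕ, 2 ≤ N → 2 ≤ L →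
      (d.choose 2 : ℝ) * ((N : ℝ) * L) ^ (-2 * β) ≤ K →
      ∀ g G : Fin d → Fin d → ℝ → ℝ → ℝ,
      (∀ j k, j < k → HolderSmoothOn β H (fun z : ℝ × ℝ => g j k z.1 z.2)
        (Set.Icc 0 1 ×ˢ Set.Icc 0 1)) →
      (∀ j k, j < k → BddMeasurable fun z : ℝ × ℝ => G j k z.1 z.2) →
      (∀ j k, ∀ x ∈ Set.Icc (0 : ℝ) 1, ∀ y ∈ Set.Icc (0 : ℝ) 1, G j k x y = g j k x y) →
      (∀ j k, j < k → ∀ x y, |G j k x y| ≤ B) →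
      (∀ j k, j < k → ∀ y, ∫ x, G j k x y ∂unif = 0) →
      (∀ j k, j < k → ∀ x, ∫ y, G j k x y ∂unif = 0) →
      ∃ φ ∈ FNN2 (widthConst A) (depthConst A) (weightConst A) d N L,
        (BddMeasurable fun x : Fin d → ℝ =>
          ∑ j, ∑ k ∈ Finset.Ioi j, G j k (x j) (x k) - φ x) ∧
        ∫ x, (∑ j, ∑ k ∈ Finset.Ioi j, G j k (x j) (x k) - φ x) ^ 2 ∂cubeUnif d ≤
          C * ((d.choose 2 : ℝ) * ((N : ℝ) * L) ^ (-2 * β)) := by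
  obtain ⟨n, s, hnet⟩ := exists_bivariate_net hβ
  refine ⟨netConst n s, by unfold netConst; omega, fun H B K hB => ?_⟩
  obtain ⟨C, hC, hnet⟩ := hnet H B hB
  refine ⟨2 * (C ^ 2 + C * |K|), by positivity, fun A hA d N L hN hL hK g G hg hGm hGg hGB h1 h2
    => ?_⟩
  -- the choice functions need some network for pairs which are not increasing
  have : Nonempty (ReLUNet 1 2) := ⟨.output 0 0⟩
  choose! p net hpn using fun j k (hjk : j < k) =>
    hnet N (Nat.clog 2 L) hN (g j k) (G j k) (hg j k hjk) (hGm j k hjk) (hGg j k)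
      (hGB j k hjk) (h1 j k hjk) (h2 j k hjk)
  set Q : ℝ := ((N * 2 ^ Nat.clog 2 L : ℕ) : ℝ) with hQ
  set q : ℝ := ((N : ℝ) * L) ^ (-2 * β) with hq
  have hNL : (0 : ℝ) < N * L := by positivity
  have hq0 : 0 ≤ q := Real.rpow_nonneg hNL.le _
  have hQ0 : 0 ≤ Q := Nat.cast_nonneg _
  have hQ2 : (Q ^ (-β)) ^ 2 ≤ q := by
    rw [← Real.rpow_natCast, ← Real.rpow_mul hQ0]
    have := rpow_clog_le hN hL (γ := -2 * β) (by linarith)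
    convert this using 2
    push_cast
    ring
  have hQ4 : Q ^ (-4 * β) ≤ q ^ 2 := by
    have := rpow_clog_le hN hL (γ := -4 * β) (by linarith)
    rw [hq, ← Real.rpow_natCast, ← Real.rpow_mul hNL.le]
    convert this using 2
    push_cast
    ring
  have hcoord : ∀ r : Fin d × Fin d, Measurable fun x : Fin d → ℝ => (x r.1, x r.2) := fun r =>
    (measurable_pi_apply r.1).prodMk (measurable_pi_apply r.2)
  have hum : ∀ j k, j < k → BddMeasurable fun z : ℝ × ℝ => G j k z.1 z.2 - p j k z.1 z.2 :=
    fun j k hjk => (hGm j k hjk).sub (hpn j k hjk).1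
  have hu : ∀ r ∈ pairs d, BddMeasurable fun x : Fin d → ℝ =>
      G r.1 r.2 (x r.1) (x r.2) - p r.1 r.2 (x r.1) (x r.2) := fun r hr =>
    (hum _ _ (mem_pairs.1 hr)).comp (hcoord r)
  have hv : ∀ r ∈ pairs d, BddMeasurable fun x : Fin d → ℝ =>
      p r.1 r.2 (x r.1) (x r.2) - (net r.1 r.2).eval ![x r.1, x r.2] 0 := fun r hr => by
    obtain ⟨c1, _, _, _, _, _, c2, _⟩ := hpn _ _ (mem_pairs.1 hr)
    exact (c1.sub c2).comp (hcoord r)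
  have hsum : ∀ x : Fin d → ℝ, ∑ j, ∑ k ∈ Finset.Ioi j, G j k (x j) (x k) -
      ∑ j, ∑ k ∈ Finset.Ioi j, (net j k).eval ![x j, x k] 0 =
      ∑ r ∈ pairs d, (G r.1 r.2 (x r.1) (x r.2) - p r.1 r.2 (x r.1) (x r.2)) +
      ∑ r ∈ pairs d,
        (p r.1 r.2 (x r.1) (x r.2) - (net r.1 r.2).eval ![x r.1, x r.2] 0) := fun x => by
    rw [sum_pairs fun j k => G j k (x j) (x k),
      sum_pairs fun j k => (net j k).eval ![x j, x k] 0, ← Finset.sum_add_distrib,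
      ← Finset.sum_sub_distrib]
    exact Finset.sum_congr rfl fun r _ => by ring
  refine ⟨_, sum_mem_FNN2 (by unfold netConst; omega) hA hN hL net
    (fun j k hjk => (hpn j k hjk).2.2.2.2.1) (fun j k hjk => (hpn j k hjk).2.2.2.2.2.1), ?_, ?_⟩
  · simp only [hsum]
    exact (BddMeasurable.sum hu).add (BddMeasurable.sum hv)
  · simp only [hsum]
    refine (integral_sq_add_le (BddMeasurable.sum hu) (BddMeasurable.sum hv)).trans ?_
    have i1 : ∫ x, (∑ r ∈ pairs d,
        (G r.1 r.2 (x r.1) (x r.2) - p r.1 r.2 (x r.1) (x r.2))) ^ 2 ∂cubeUnif d ≤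
        C ^ 2 * (d.choose 2 * q) := by
      rw [integral_sq_sum_bivariate (fun j k x y => G j k x y - p j k x y) hum
        (fun j k hjk y => by
          rw [integral_sub ((hGm j k hjk).left y).integrable
            ((hpn j k hjk).1.left y).integrable, h1 j k hjk, (hpn j k hjk).2.1, sub_zero])
        (fun j k hjk x => by
          rw [integral_sub ((hGm j k hjk).right x).integrable
            ((hpn j k hjk).1.right x).integrable, h2 j k hjk, (hpn j k hjk).2.2.1, sub_zero])]
      calc _ ≤ ∑ _r ∈ pairs d, C ^ 2 * q := by
            refine Finset.sum_le_sum fun r hr => ?_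
            have hsq : Integrable (fun x : Fin d → ℝ =>
                (G r.1 r.2 (x r.1) (x r.2) - p r.1 r.2 (x r.1) (x r.2)) ^ 2) (cubeUnif d) := by
              simpa only [sq] using ((hu r hr).mul (hu r hr)).integrable
            have hle : ∀ᵐ x ∂cubeUnif d,
                (G r.1 r.2 (x r.1) (x r.2) - p r.1 r.2 (x r.1) (x r.2)) ^ 2 ≤ C ^ 2 * q := by
              filter_upwards [ae_cubeUnif_mem r.1, ae_cubeUnif_mem r.2] with x hx hy
              have := (hpn _ _ (mem_pairs.1 hr)).2.2.2.1 _ hx _ hy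
              calc _ ≤ (C * Q ^ (-β)) ^ 2 := by
                    rw [← sq_abs]
                    exact pow_le_pow_left₀ (abs_nonneg _) this 2
                _ = C ^ 2 * (Q ^ (-β)) ^ 2 := by ring
                _ ≤ C ^ 2 * q := by gcongr
            refine (integral_mono_ae hsq (integrable_const _) hle).trans (le_of_eq ?_)
            simp
        _ = C ^ 2 * (d.choose 2 * q) := by
            rw [Finset.sum_const, card_pairs, nsmul_eq_mul]
            ring
    have i2 : ∫ x, (∑ r ∈ pairs d, (p r.1 r.2 (x r.1) (x r.2) -
        (net r.1 r.2).eval ![x r.1, x r.2] 0)) ^ 2 ∂cubeUnif d ≤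
        C * |K| * (d.choose 2 * q) := by
      refine (integral_sq_sum_le (pairs d) hv (R := C * q ^ 2) fun r hr => ?_).trans ?_
      · refine ((hpn _ _ (mem_pairs.1 hr)).2.2.2.2.2.2.2 d r.1 r.2).trans ?_
        gcongr
      · rw [card_pairs]
        calc (d.choose 2 : ℝ) ^ 2 * (C * q ^ 2)
            = C * (d.choose 2 * q) * (d.choose 2 * q) := by ring
          _ ≤ C * |K| * (d.choose 2 * q) := by
            gcongr
            exact hK.trans (le_abs_self K)
    linarith

/-! ### The risk bound -/

/-- A law with density bounded by `pmax` is dominated by a multiple of the uniform law. -/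
lemma HasBoundedDensity.le_smul {d : ℕ} {P : Measure (Fin d → ℝ)} {pmax : ℝ}
    (h : HasBoundedDensity P pmax) : P ≤ ENNReal.ofReal pmax • cubeUnif d := by
  obtain ⟨-, p, -, hp, rfl⟩ := h
  rw [← restrict_unitCube, ← withDensity_const]
  refine withDensity_mono ?_
  exact (ae_restrict_mem measurableSet_Icc).mono hp

lemma lintegral_ofReal_sq_le {d : ℕ} {P : Measure (Fin d → ℝ)} {pmax : ℝ}
    (h : HasBoundedDensity P pmax) {u : (Fin d → ℝ) → ℝ} (hu : BddMeasurable u) :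
    ∫⁻ x, ENNReal.ofReal (u x ^ 2) ∂P ≤
      ENNReal.ofReal (max pmax 0 * ∫ x, u x ^ 2 ∂cubeUnif d) := by
  have hi : Integrable (fun x => u x ^ 2) (cubeUnif d) := by
    simpa only [sq] using (hu.mul hu).integrable
  calc ∫⁻ x, ENNReal.ofReal (u x ^ 2) ∂P
      ≤ ∫⁻ x, ENNReal.ofReal (u x ^ 2) ∂(ENNReal.ofReal pmax • cubeUnif d) :=
        lintegral_mono' h.le_smul le_rfl
    _ = ENNReal.ofReal (max pmax 0 * ∫ x, u x ^ 2 ∂cubeUnif d) := by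
        rw [lintegral_smul_measure, ← ofReal_integral_eq_lintegral_ofReal hi
          (Filter.Eventually.of_forall fun x => sq_nonneg _),
          ENNReal.ofReal_mul (le_max_right _ _), smul_eq_mul, ENNReal.ofReal_max,
          ENNReal.ofReal_zero, max_eq_left zero_le]

end

theorem theorem2p2 (β₁ β₂ : ℝ) (hβ₁ : 0 < β₁) (hβ₂ : 0 < β₂) :
    ∃ c₁ c₂ c₃ : ℝ, 0 < c₁ ∧ 0 < c₂ ∧ 0 < c₃ ∧
      ∀ H B pmax K : ℝ, ∃ C : ℝ, 0 < C ∧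
        ∀ (d N₁ L₁ N₂ L₂ : ℕ), 2 ≤ N₁ → 2 ≤ L₁ → 2 ≤ N₂ → 2 ≤ L₂ →
          (d.choose 2 : ℝ) * ((N₂ : ℝ) * L₂) ^ (-2 * β₂) ≤ K →
          ∀ (P : Measure (Fin d → ℝ)), HasBoundedDensity P pmax →
          ∀ (f : Fin d → ℝ → ℝ) (g : Fin d → Fin d → ℝ → ℝ → ℝ),
            InteractionModel β₁ β₂ H B f g →
            (⨅ φ₁ ∈ FNN1 c₁ c₂ c₃ d N₁ L₁, ⨅ φ₂ ∈ FNN2 c₁ c₂ c₃ d N₂ L₂,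
                ∫⁻ x, ENNReal.ofReal ((interactionMean f g x - φ₁ x - φ₂ x) ^ 2) ∂P)
              ≤ ENNReal.ofReal (C * ((d : ℝ) * ((N₁ : ℝ) * L₁) ^ (-4 * β₁) +
                  (d.choose 2 : ℝ) * ((N₂ : ℝ) * L₂) ^ (-2 * β₂))) := by
  obtain ⟨a₁, ha₁, huni⟩ := exists_univariate_sum hβ₁
  obtain ⟨a₂, ha₂, hbiv⟩ := exists_bivariate_sum hβ₂
  have h2 : 0 < Real.log 2 := Real.log_pos (by norm_num)
  have hA : (0 : ℝ) < (a₁ + a₂ : ℕ) := by exact_mod_cast Nat.add_pos_left ha₁ _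
  have hw : 0 < widthConst (a₁ + a₂) := div_pos hA h2
  have hd : 0 < depthConst (a₁ + a₂) := div_pos (by positivity) h2
  refine ⟨widthConst (a₁ + a₂), depthConst (a₁ + a₂), weightConst (a₁ + a₂), hw, hd,
    by unfold weightConst; positivity, fun H B pmax K => ?_⟩
  obtain ⟨C₁, hC₁, huni⟩ := huni H |B| (abs_nonneg _)
  obtain ⟨C₂, hC₂, hbiv⟩ := hbiv H (3 * |B|) K (by positivity)
  have hp0 : 0 ≤ max pmax 0 := le_max_right _ _
  refine ⟨max pmax 0 * (2 * (C₁ + C₂)) + 1, by positivity,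
    fun d N₁ L₁ N₂ L₂ hN₁ hL₁ hN₂ hL₂ hK P hP f g hmod => ?_⟩
  obtain ⟨F, G, hF, hG, hFf, hGg, hF0, hG1, hG2, hFB, hGB⟩ := hmod.exists_extension hβ₁ hβ₂
  obtain ⟨φ₁, hφ₁, hm₁, he₁⟩ := huni (a₁ + a₂) (Nat.le_add_right _ _) d N₁ L₁ hN₁ hL₁ f F
    hmod.smooth₁ hF hFf (fun j x => (hFB j x).trans (le_abs_self B)) hF0
  obtain ⟨φ₂, hφ₂, hm₂, he₂⟩ := hbiv (a₁ + a₂) (Nat.le_add_left _ _) d N₂ L₂ hN₂ hL₂ hK g G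
    hmod.smooth₂ hG hGg (fun j k hjk x y => (hGB j k hjk x y).trans (by linarith [le_abs_self B]))
    hG1 hG2
  refine (iInf₂_le φ₁ hφ₁).trans ((iInf₂_le φ₂ hφ₂).trans ?_)
  set R₁ : ℝ := (d : ℝ) * ((N₁ : ℝ) * L₁) ^ (-4 * β₁) with hR₁
  set R₂ : ℝ := (d.choose 2 : ℝ) * ((N₂ : ℝ) * L₂) ^ (-2 * β₂) with hR₂
  have hR₁0 : 0 ≤ R₁ := by positivity
  have hR₂0 : 0 ≤ R₂ := by positivity
  set u : (Fin d → ℝ) → ℝ := fun x => (∑ j, F j (x j) - φ₁ x) +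
    (∑ j, ∑ k ∈ Finset.Ioi j, G j k (x j) (x k) - φ₂ x) with hu
  have hPc : ∀ᵐ x ∂P, x ∈ unitCube d := by
    obtain ⟨-, p, -, -, rfl⟩ := hP
    exact (withDensity_absolutelyContinuous _ _).ae_le (ae_restrict_mem measurableSet_Icc)
  have hcongr : ∫⁻ x, ENNReal.ofReal ((interactionMean f g x - φ₁ x - φ₂ x) ^ 2) ∂P =
      ∫⁻ x, ENNReal.ofReal (u x ^ 2) ∂P := by
    refine lintegral_congr_ae (hPc.mono fun x hx => ?_)
    have hxj : ∀ j, x j ∈ Set.Icc (0 : ℝ) 1 := fun j => ⟨hx.1 j, hx.2 j⟩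
    simp only [hu, interactionMean, hFf _ _ (hxj _), hGg _ _ _ (hxj _) _ (hxj _)]
    congr 2
    ring
  rw [hcongr]
  refine (lintegral_ofReal_sq_le hP (hm₁.add hm₂)).trans (ENNReal.ofReal_le_ofReal ?_)
  have hint : ∫ x, u x ^ 2 ∂cubeUnif d ≤ 2 * (C₁ * R₁ + C₂ * R₂) :=
    (integral_sq_add_le hm₁ hm₂).trans (by linarith)
  calc max pmax 0 * ∫ x, u x ^ 2 ∂cubeUnif d
      ≤ max pmax 0 * (2 * (C₁ * R₁ + C₂ * R₂)) := by gcongr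
    _ ≤ max pmax 0 * (2 * ((C₁ + C₂) * (R₁ + R₂))) := by
        gcongr
        nlinarith [mul_nonneg hC₁ hR₂0, mul_nonneg hC₂ hR₁0]
    _ ≤ (max pmax 0 * (2 * (C₁ + C₂)) + 1) * (R₁ + R₂) := by
        nlinarith
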